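/- **Theorem.** *Setting.* Let $G$ be a connected simple undirected graph with $n$ vertices, $m$ edges and real edge weights $w\ge 0$, let $r$ be a vertex of $G$, and let $T$ be a shortest-path tree of $G$ rooted at $r$, i.e. a spanning tree of $G$ in which every vertex has the same weighted distance from $r$ as in $G$. A *path failure* is a (possibly empty) set $F$ of consecutive edges of the path of $T$ from $r$ to some vertex. Write $d_{G-F}(t)$ for the weighted distance from $r$ to $t$ in $G-F$, with $d_{G-F}(t)=\infty$ if $t$ is not reachable from $r$ in $G-F$. In this statement paths may repeat vertices, and the weight of a path counts edges with multiplicity. *Model.* A word RAM with words of $O(\log n)$ bits and with registers and memory cells for exact real numbers, which can be moved, added, subtracted and compared, each in unit time. *Claim.* There are a preprocessing algorithm, a distance-query algorithm and a path-query algorithm such that, for all $G,w,r,T$ as above, the preprocessing algorithm, given $G$ (as a list of its edges with their weights), $r$ and $T$ (as a parent array), builds in $O(nm+n^2\log n+1)$ time an oracle of size $O(n\log n+1)$ (in memory cells). For every path failure $F$ with $|F|\le 2$ (given as a list of its edges) and every vertex $t$ there is a value $D$ with $$d_{G-F}(t)\;\le\; D\;\le\; 3\,d_{G-F}(t)$$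 such that, using only the oracle, $F$ and $t$, and leaving the oracle unchanged: 1. the distance query returns $D$ in constant time; 2. if $D<\infty$, then the path query returns a path from $r$ to $t$ in $G-F$ of weight exactly $D$ in time $O(\ell+1)$, where $\ell$ is the number of its edges; if $D=\infty$, it reports in constant time that there is no path. All implied constants are absolute. -/

import Mathlib

open scoped NNReal ENNReal

/-! ## Weighted graphs, shortest-path trees, path failures -/

/-- The total weight of the edges of a walk (with multiplicity). -/
def SimpleGraph.Walk.weight {V : Type*} {G : SimpleGraph V} (w : Sym2 V → ℝ≥0) {u v : V}
    (p : G.Walk u v) : ℝ≥0 :=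
  (p.edges.map w).sum

/-- The weighted distance from `u` to `v` in `G`; it is `⊤` if `v` is not reachable from `u`. -/
noncomputable def wdist {V : Type*} (G : SimpleGraph V) (w : Sym2 V → ℝ≥0) (u v : V) : ℝ≥0∞ :=
  ⨅ p : G.Walk u v, (p.weight w : ℝ≥0∞)

/-- `T` is a shortest-path tree of `G` rooted at `r`: a spanning tree of `G` that preserves all
weighted distances from `r`. -/
structure IsShortestPathTree {V : Type*} (G : SimpleGraph V) (w : Sym2 V → ℝ≥0) (r : V)
    (T : SimpleGraph V) : Prop where
  le : T ≤ G
  isTree : T.IsTree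
  wdist_eq : ∀ v, wdist T w r v = wdist G w r v

/-- `F` is a path failure with respect to the tree `T` rooted at `r`: the edges of `F` are
consecutive edges of the path of `T` from `r` to some vertex `v`. -/
def IsPathFailure {V : Type*} (T : SimpleGraph V) (r : V) (F : Set (Sym2 V)) : Prop :=
  ∃ (v : V) (p : T.Walk r v), p.IsPath ∧ ∃ l : List (Sym2 V), l <:+: p.edges ∧ F = {e | e ∈ l}

/-- `par v` is the parent of `v` in the tree `T` rooted at `r`, for every `v ≠ r`
(`SimpleGraph.dist` is the hop distance). The value at `r` is irrelevant. -/
def IsParentMap {V : Type*} (T : SimpleGraph V) (r : V) (par : V → V) : Prop :=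
  ∀ v, v ≠ r → T.Adj v (par v) ∧ T.dist r v = T.dist r (par v) + 1

/-- `L` lists every edge of `E` exactly once, in any order and any orientation. -/
def ListsEdges {V : Type*} (L : List (V × V)) (E : Set (Sym2 V)) : Prop :=
  (L.map fun a => s(a.1, a.2)).Nodup ∧ ∀ e, e ∈ L.map (fun a => s(a.1, a.2)) ↔ e ∈ E

/-! ## The machine: a word RAM with real registers

The machine has word variables and word arrays, which hold natural numbers below a bound `B`, and
real variables and real arrays, which hold exact real numbers. A program is a fixed finite
text, so it can name only finitely many variables and arrays. On words there are the usual
arithmetic operations; real numbers can only be moved, added, subtracted and compared.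
Every elementary instruction and every test costs one step. -/

/-- A memory state. -/
structure MState where
  /-- word variables -/
  ivar : ℕ → ℕ
  /-- real variables -/
  rvar : ℕ → ℝ
  /-- word arrays: `ints a i` is cell `i` of array `a` -/
  ints : ℕ → ℕ → ℕ
  /-- real arrays: `reals a i` is cell `i` of array `a` -/
  reals : ℕ → ℕ → ℝ

/-- Elementary instructions. In all of them `x`, `y`, `z`, `i` are names of variables, and `a` is
the name of an array. -/
inductive Instr where
  /-- `x := c` -/
  | const (x c : ℕ)
  /-- `x := y + z` -/
  | add (x y z : ℕ)
  /-- `x := y - z`, truncated at `0` -/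
  | sub (x y z : ℕ)
  /-- `x := y * z` -/
  | mul (x y z : ℕ)
  /-- `x := y / z`, rounded down, and `0` if `z` is `0` -/
  | div (x y z : ℕ)
  /-- `x := a[i]` -/
  | load (x a i : ℕ)
  /-- `a[i] := x` -/
  | store (a i x : ℕ)
  /-- `x := 0` for a real variable `x` -/
  | rzero (x : ℕ)
  /-- `x := y + z` for real variables -/
  | radd (x y z : ℕ)
  /-- `x := y - z` for real variables -/
  | rsub (x y z : ℕ)
  /-- `x := a[i]` for a real variable `x`, a real array `a` and a word variable `i` -/
  | rload (x a i : ℕ)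
  /-- `a[i] := x` for a real variable `x`, a real array `a` and a word variable `i` -/
  | rstore (a i x : ℕ)

/-- Write a word variable. -/
def MState.setI (σ : MState) (x v : ℕ) : MState :=
  { σ with ivar := Function.update σ.ivar x v }

/-- Write a real variable. -/
noncomputable def MState.setR (σ : MState) (x : ℕ) (v : ℝ) : MState :=
  { σ with rvar := Function.update σ.rvar x v }

/-- The effect of an elementary instruction. -/
noncomputable def Instr.apply (σ : MState) : Instr → MState
  | .const x c => σ.setI x c
  | .add x y z => σ.setI x (σ.ivar y + σ.ivar z)
  | .sub x y z => σ.setI x (σ.ivar y - σ.ivar z)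
  | .mul x y z => σ.setI x (σ.ivar y * σ.ivar z)
  | .div x y z => σ.setI x (σ.ivar y / σ.ivar z)
  | .load x a i => σ.setI x (σ.ints a (σ.ivar i))
  | .store a i x =>
      { σ with ints := Function.update σ.ints a
                (Function.update (σ.ints a) (σ.ivar i) (σ.ivar x)) }
  | .rzero x => σ.setR x 0
  | .radd x y z => σ.setR x (σ.rvar y + σ.rvar z)
  | .rsub x y z => σ.setR x (σ.rvar y - σ.rvar z)
  | .rload x a i => σ.setR x (σ.reals a (σ.ivar i))
  | .rstore a i x =>
      { σ with reals := Function.update σ.reals a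
                (Function.update (σ.reals a) (σ.ivar i) (σ.rvar x)) }

/-- The result of the instruction fits into a word. The other instructions cannot create a
value `≥ B` from values `< B`. -/
def Instr.Fits (B : ℕ) (σ : MState) : Instr → Prop
  | .const _ c => c < B
  | .add _ y z => σ.ivar y + σ.ivar z < B
  | .mul _ y z => σ.ivar y * σ.ivar z < B
  | _ => True

/-- Tests. -/
inductive Test where
  /-- `x < y` for word variables -/
  | lt (x y : ℕ)
  /-- `x = y` for word variables -/
  | eq (x y : ℕ)
  /-- `x < y` for real variables -/
  | rlt (x y : ℕ)
  /-- negation -/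
  | not (c : Test)

/-- The truth value of a test. -/
def Test.Holds (σ : MState) : Test → Prop
  | .lt x y => σ.ivar x < σ.ivar y
  | .eq x y => σ.ivar x = σ.ivar y
  | .rlt x y => σ.rvar x < σ.rvar y
  | .not c => ¬ Test.Holds σ c

/-- Programs. -/
inductive Prog where
  | skip
  | instr (i : Instr)
  | seq (p q : Prog)
  | ite (c : Test) (p q : Prog)
  | while (c : Test) (p : Prog)

/-- `Exec B p σ k σ'`: with words below `B`, the program `p` started in `σ` halts after exactly
`k` steps, without overflow, in the state `σ'`. -/
inductive Exec (B : ℕ) : Prog → MState → ℕ → MState → Prop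
  | skip (σ : MState) : Exec B .skip σ 1 σ
  | instr (i : Instr) (σ : MState) : i.Fits B σ → Exec B (.instr i) σ 1 (i.apply σ)
  | seq {p q : Prog} {σ σ' σ'' : MState} {k k' : ℕ} :
      Exec B p σ k σ' → Exec B q σ' k' σ'' → Exec B (.seq p q) σ (k + k') σ''
  | ite_true {c : Test} {p q : Prog} {σ σ' : MState} {k : ℕ} :
      c.Holds σ → Exec B p σ k σ' → Exec B (.ite c p q) σ (k + 1) σ'
  | ite_false {c : Test} {p q : Prog} {σ σ' : MState} {k : ℕ} :
      ¬ c.Holds σ → Exec B q σ k σ' → Exec B (.ite c p q) σ (k + 1) σ'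
  | while_true {c : Test} {p : Prog} {σ σ' σ'' : MState} {k k' : ℕ} :
      c.Holds σ → Exec B p σ k σ' → Exec B (.while c p) σ' k' σ'' →
        Exec B (.while c p) σ (k + k' + 1) σ''
  | while_false {c : Test} {p : Prog} {σ : MState} :
      ¬ c.Holds σ → Exec B (.while c p) σ 1 σ

/-- Started in `σ`, the program halts within `b` steps in a state that satisfies `Q`. -/
def Prog.RunsWithin (p : Prog) (B : ℕ) (σ : MState) (b : ℝ) (Q : MState → Prop) : Prop :=
  ∃ (k : ℕ) (σ' : MState), Exec B p σ k σ' ∧ (k : ℝ) ≤ b ∧ Q σ'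

/-! ## Input and output conventions -/

/-- The input of the construction: the numbers `n`, `m`, the source `r`, the list of the edges with
their weights, and the parent array of the tree. The rest of the memory is arbitrary. -/
structure BuildInput {n : ℕ} (w : Sym2 (Fin n) → ℝ≥0) (r : Fin n) (par : Fin n → Fin n)
    (L : List (Fin n × Fin n)) (σ : MState) : Prop where
  n_eq : σ.ivar 0 = n
  m_eq : σ.ivar 1 = L.length
  r_eq : σ.ivar 2 = r
  fst_eq : ∀ j : Fin L.length, σ.ints 0 j = (L.get j).1
  snd_eq : ∀ j : Fin L.length, σ.ints 1 j = (L.get j).2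
  weight_eq : ∀ j : Fin L.length, σ.reals 0 j = w s((L.get j).1, (L.get j).2)
  par_eq : ∀ v : Fin n, σ.ints 2 v = par v

/-- The states `σ` and `τ` hold the same oracle: they agree on the first `s` cells of each of the
first `K` word arrays and of each of the first `K` real arrays. These are `2 * K * s` cells. -/
def SameOracle (K s : ℕ) (σ τ : MState) : Prop :=
  ∀ a < K, ∀ i < s, σ.ints a i = τ.ints a i ∧ σ.reals a i = τ.reals a i

/-- A query about the target `t` and the failed edges listed in `L`, given in variables. -/
structure QueryInput {n : ℕ} (t : Fin n) (L : List (Fin n × Fin n)) (σ : MState) : Prop where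
  t_eq : σ.ivar 0 = t
  card_eq : σ.ivar 1 = L.length
  fst_eq : ∀ j : Fin L.length, σ.ivar (2 + 2 * j) = (L.get j).1
  snd_eq : ∀ j : Fin L.length, σ.ivar (3 + 2 * j) = (L.get j).2

/-- The state outputs the extended real `D`: a flag in word variable `0` tells whether `D` is
finite, and if so, then real variable `0` holds its value. -/
def OutputsDist (D : ℝ≥0∞) (σ : MState) : Prop :=
  (D = ⊤ ∧ σ.ivar 0 = 0) ∨ (D ≠ ⊤ ∧ σ.ivar 0 = 1 ∧ σ.rvar 0 = D.toReal)

/-- The state reports that there is no path. -/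
def OutputsNoPath (σ : MState) : Prop := σ.ivar 0 = 0

/-- The state outputs the walk `p`: word variable `0` holds the flag `1`, word variable `1` holds
the number of edges, and array `out` holds the vertices of the walk in their order. -/
def OutputsPath {n : ℕ} {G : SimpleGraph (Fin n)} {u v : Fin n} (out : ℕ) (p : G.Walk u v)
    (σ : MState) : Prop :=
  σ.ivar 0 = 1 ∧ σ.ivar 1 = p.length ∧ ∀ i ≤ p.length, σ.ints out i = p.getVert i

/-! Deleting one edge, or two consecutive edges, of a root path splits the tree into the part of the
root, which the tree still reaches, and at most two further parts. Let the failed edges be the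
parent edges of `v₁` and `v₂`, where `v₁ = par v₂` or `v₁ = v₂`. Then these parts are the subtree of
`v₂` and the rest of the subtree of `v₁`. One of them, the small part, has at most half of the
vertices of the subtree of `v₁`; for a single edge it is empty. The other one is the large part, a
connected piece of the tree with top `τ`. In the part of the root the tree distances `d` remain
exact. Every vertex of the small part gets a stored value and a stored predecessor. For the large
part only one arc is stored, the one through which it is entered.

The values come from a Dijkstra-like process in which the large part is settled all at once
(`Cfg.settle_small`, `Cfg.settle_large`). If it is entered at `x` by a walk of length `λ`, then a
vertex `y` of it is reached by climbing from `x` to `τ` along the tree and descending to `y`, at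
cost `λ + (d x - d τ) + (d y - d τ)`. By minimality `λ` is at most the true distance `D` of `y`;
moreover `d x ≤ λ` and `d y ≤ D`, because the tree distances are distances in the whole graph. Hence
the cost is at most `3 D`. Values assigned before that moment are exact, and values assigned later
inherit the factor `3`, by the usual argument about the arc on which a walk leaves the settled set
(`Cfg.le_of_crossing`).

Space: call a vertex light if its subtree has at most half of the vertices of its parent's subtree.
A vertex has at most `log₂ n` light ancestors. The small parts that contain a fixed vertex have
pairwise different keys, made of a light count and one bit (`RTree.rowKey_injOn`). So the values of
all small parts fit without collision into a table with `2 log₂ n + 2` rows of `n` cells.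

Time: for one failure only the arcs that touch the small part and the best arc from the part of the
root to the large part matter. Scanning this list once for every settled vertex costs about |small
part| times |arcs that touch it|, and no priority queue is needed. The sizes of the small parts that
contain a fixed vertex decrease geometrically with the key and add up to `O(n)`
(`RTree.sum_smallPart_le`). Double counting over the endpoints of arcs then gives `O(nm)` in total
(`RTree.sum_smallArcs_le`), besides `O(n + m)` for each of the `2n` failures.

Queries: the part of a vertex is found in constant time from preorder intervals
(`RTree.anc_iff_preNum`), and the value is read off. A path is traced from the target back to the
root, with constant time per vertex (`cmTrace_run`).

The programs are written in a small language with expressions. A compiler into the machine language,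
which multiplies running times by a constant that depends on the program only (`HExec.comp`),
carries the verified bounds over. -/

/-! ## A small imperative language with expressions, compiled to the machine -/

/-- Word expressions. -/
inductive Ex where
  | v (x : ℕ)
  | c (k : ℕ)
  | add (a b : Ex)
  | sub (a b : Ex)
  | mul (a b : Ex)
  | ld (a : ℕ) (e : Ex)

/-- Real expressions. -/
inductive RE where
  | v (x : ℕ)
  | zero
  | add (a b : RE)
  | sub (a b : RE)
  | ld (a : ℕ) (e : Ex)

/-- Conditions. -/
inductive Cd where
  | lt (a b : Ex)
  | eq (a b : Ex)
  | rlt (a b : RE)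
  | not (c : Cd)
  | and (c d : Cd)

/-- Commands. -/
inductive Cm where
  | skip
  | set (x : ℕ) (e : Ex)
  | rset (x : ℕ) (e : RE)
  | st (a : ℕ) (i e : Ex)
  | rst (a : ℕ) (i : Ex) (e : RE)
  | seq (p q : Cm)
  | ite (c : Cd) (p q : Cm)
  | while (c : Cd) (p : Cm)

infixl:65 " +ₑ " => Ex.add
infixl:65 " -ₑ " => Ex.sub
infixl:70 " *ₑ " => Ex.mul
infixl:65 " +ᵣ " => RE.add
infixl:65 " -ᵣ " => RE.sub
infix:50 " <ₑ " => Cd.lt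
infix:50 " =ₑ " => Cd.eq
infix:50 " <ᵣ " => Cd.rlt
infixr:35 " &ₑ " => Cd.and
infixr:20 " ;; " => Cm.seq
infix:30 " ≔ " => Cm.set
infix:30 " ≔ᵣ " => Cm.rset

/-- `a ∨ b` as a condition. -/
abbrev Cd.or (a b : Cd) : Cd := .not (.and (.not a) (.not b))

/-- Write a cell of a word array. -/
def MState.stI (σ : MState) (a i v : ℕ) : MState :=
  { σ with ints := Function.update σ.ints a (Function.update (σ.ints a) i v) }

/-- Write a cell of a real array. -/
noncomputable def MState.stR (σ : MState) (a i : ℕ) (v : ℝ) : MState :=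
  { σ with reals := Function.update σ.reals a (Function.update (σ.reals a) i v) }

namespace MState
variable (σ : MState) (x y a b i : ℕ) (k : ℕ) (u : ℝ)
@[simp] theorem setI_ivar : (σ.setI x k).ivar y = if y = x then k else σ.ivar y := by
  simp [setI, Function.update_apply]
@[simp] theorem setI_rvar : (σ.setI x k).rvar = σ.rvar := rfl
@[simp] theorem setI_ints : (σ.setI x k).ints = σ.ints := rfl
@[simp] theorem setI_reals : (σ.setI x k).reals = σ.reals := rfl
@[simp] theorem setR_ivar : (σ.setR x u).ivar = σ.ivar := rfl
@[simp] theorem setR_rvar : (σ.setR x u).rvar y = if y = x then u else σ.rvar y := by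
  simp [setR, Function.update_apply]
@[simp] theorem setR_ints : (σ.setR x u).ints = σ.ints := rfl
@[simp] theorem setR_reals : (σ.setR x u).reals = σ.reals := rfl
@[simp] theorem stI_ivar : (σ.stI a i k).ivar = σ.ivar := rfl
@[simp] theorem stI_rvar : (σ.stI a i k).rvar = σ.rvar := rfl
@[simp] theorem stI_ints : (σ.stI a i k).ints b =
    if b = a then Function.update (σ.ints a) i k else σ.ints b := by
  simp [stI, Function.update_apply]
@[simp] theorem stI_reals : (σ.stI a i k).reals = σ.reals := rfl
@[simp] theorem stR_ivar : (σ.stR a i u).ivar = σ.ivar := rfl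
@[simp] theorem stR_rvar : (σ.stR a i u).rvar = σ.rvar := rfl
@[simp] theorem stR_ints : (σ.stR a i u).ints = σ.ints := rfl
@[simp] theorem stR_reals : (σ.stR a i u).reals b =
    if b = a then Function.update (σ.reals a) i u else σ.reals b := by
  simp [stR, Function.update_apply]
end MState

/-- The value of a word expression. -/
@[simp] def Ex.eval (σ : MState) : Ex → ℕ
  | .v x => σ.ivar x
  | .c k => k
  | .add a b => a.eval σ + b.eval σ
  | .sub a b => a.eval σ - b.eval σ
  | .mul a b => a.eval σ * b.eval σ
  | .ld a e => σ.ints a (e.eval σ)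

/-- No overflow occurs in the evaluation. -/
@[simp] def Ex.fits (B : ℕ) (σ : MState) : Ex → Prop
  | .v _ => True
  | .c k => k < B
  | .add a b => a.fits B σ ∧ b.fits B σ ∧ a.eval σ + b.eval σ < B
  | .sub a b => a.fits B σ ∧ b.fits B σ
  | .mul a b => a.fits B σ ∧ b.fits B σ ∧ a.eval σ * b.eval σ < B
  | .ld _ e => e.fits B σ

/-- The value of a real expression. -/
@[simp] noncomputable def RE.eval (σ : MState) : RE → ℝ
  | .v x => σ.rvar x
  | .zero => 0
  | .add a b => a.eval σ + b.eval σ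
  | .sub a b => a.eval σ - b.eval σ
  | .ld a e => σ.reals a (e.eval σ)

/-- No overflow occurs in the evaluation. -/
@[simp] def RE.fits (B : ℕ) (σ : MState) : RE → Prop
  | .v _ => True
  | .zero => True
  | .add a b => a.fits B σ ∧ b.fits B σ
  | .sub a b => a.fits B σ ∧ b.fits B σ
  | .ld _ e => e.fits B σ

/-- The truth value of a condition. -/
@[simp] def Cd.holds (σ : MState) : Cd → Prop
  | .lt a b => a.eval σ < b.eval σ
  | .eq a b => a.eval σ = b.eval σ
  | .rlt a b => a.eval σ < b.eval σ
  | .not c => ¬ c.holds σ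
  | .and c d => c.holds σ ∧ d.holds σ

/-- No overflow occurs in the evaluation. -/
@[simp] def Cd.fits (B : ℕ) (σ : MState) : Cd → Prop
  | .lt a b => a.fits B σ ∧ b.fits B σ
  | .eq a b => a.fits B σ ∧ b.fits B σ
  | .rlt a b => a.fits B σ ∧ b.fits B σ
  | .not c => c.fits B σ
  | .and c d => c.fits B σ ∧ d.fits B σ

/-- Big-step semantics of commands, with a unit cost for every assignment and test. -/
inductive HExec (B : ℕ) : Cm → MState → ℕ → MState → Prop
  | skip (σ : MState) : HExec B .skip σ 1 σ
  | set (x : ℕ) (e : Ex) (σ : MState) : e.fits B σ → HExec B (.set x e) σ 1 (σ.setI x (e.eval σ))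
  | rset (x : ℕ) (e : RE) (σ : MState) :
      e.fits B σ → HExec B (.rset x e) σ 1 (σ.setR x (e.eval σ))
  | st (a : ℕ) (i e : Ex) (σ : MState) : i.fits B σ → e.fits B σ →
      HExec B (.st a i e) σ 1 (σ.stI a (i.eval σ) (e.eval σ))
  | rst (a : ℕ) (i : Ex) (e : RE) (σ : MState) : i.fits B σ → e.fits B σ →
      HExec B (.rst a i e) σ 1 (σ.stR a (i.eval σ) (e.eval σ))
  | seq {p q : Cm} {σ σ' σ'' : MState} {k k' : ℕ} :
      HExec B p σ k σ' → HExec B q σ' k' σ'' → HExec B (.seq p q) σ (k + k') σ''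
  | ite_true {c : Cd} {p q : Cm} {σ σ' : MState} {k : ℕ} :
      c.fits B σ → c.holds σ → HExec B p σ k σ' → HExec B (.ite c p q) σ (k + 1) σ'
  | ite_false {c : Cd} {p q : Cm} {σ σ' : MState} {k : ℕ} :
      c.fits B σ → ¬ c.holds σ → HExec B q σ k σ' → HExec B (.ite c p q) σ (k + 1) σ'
  | while_true {c : Cd} {p : Cm} {σ σ' σ'' : MState} {k k' : ℕ} :
      c.fits B σ → c.holds σ → HExec B p σ k σ' → HExec B (.while c p) σ' k' σ'' →
        HExec B (.while c p) σ (k + k' + 1) σ''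
  | while_false {c : Cd} {p : Cm} {σ : MState} :
      c.fits B σ → ¬ c.holds σ → HExec B (.while c p) σ 1 σ

/-! ### Compilation -/

/-- All variables that occur are below `T`. -/
def Ex.varsLt (T : ℕ) : Ex → Bool
  | .v x => decide (x < T)
  | .c _ => true
  | .add a b => a.varsLt T && b.varsLt T
  | .sub a b => a.varsLt T && b.varsLt T
  | .mul a b => a.varsLt T && b.varsLt T
  | .ld _ e => e.varsLt T

/-- All variables that occur are below `T`. -/
def RE.varsLt (T : ℕ) : RE → Bool
  | .v x => decide (x < T)
  | .zero => true
  | .add a b => a.varsLt T && b.varsLt T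
  | .sub a b => a.varsLt T && b.varsLt T
  | .ld _ e => e.varsLt T

/-- All variables that occur are below `T`. -/
def Cd.varsLt (T : ℕ) : Cd → Bool
  | .lt a b => a.varsLt T && b.varsLt T
  | .eq a b => a.varsLt T && b.varsLt T
  | .rlt a b => a.varsLt T && b.varsLt T
  | .not c => c.varsLt T
  | .and c d => c.varsLt T && d.varsLt T

/-- All variables that occur are below `T`. -/
def Cm.varsLt (T : ℕ) : Cm → Bool
  | .skip => true
  | .set x e => decide (x < T) && e.varsLt T
  | .rset x e => decide (x < T) && e.varsLt T
  | .st _ i e => i.varsLt T && e.varsLt T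
  | .rst _ i e => i.varsLt T && e.varsLt T
  | .seq p q => p.varsLt T && q.varsLt T
  | .ite c p q => c.varsLt T && p.varsLt T && q.varsLt T
  | .while c p => c.varsLt T && p.varsLt T

/-- Code that evaluates an expression into variable `t`, using only variables from `t` on. -/
def Ex.comp : Ex → ℕ → Prog
  | .v x, t => .seq (.instr (.const t 0)) (.instr (.sub t x t))
  | .c k, t => .instr (.const t k)
  | .add a b, t => .seq (a.comp t) (.seq (b.comp (t + 1)) (.instr (.add t t (t + 1))))
  | .sub a b, t => .seq (a.comp t) (.seq (b.comp (t + 1)) (.instr (.sub t t (t + 1))))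
  | .mul a b, t => .seq (a.comp t) (.seq (b.comp (t + 1)) (.instr (.mul t t (t + 1))))
  | .ld a e, t => .seq (e.comp t) (.instr (.load t a t))

/-- Code that evaluates an expression into real variable `t`. -/
def RE.comp : RE → ℕ → Prog
  | .v x, t => .seq (.instr (.rzero t)) (.instr (.radd t x t))
  | .zero, t => .instr (.rzero t)
  | .add a b, t => .seq (a.comp t) (.seq (b.comp (t + 1)) (.instr (.radd t t (t + 1))))
  | .sub a b, t => .seq (a.comp t) (.seq (b.comp (t + 1)) (.instr (.rsub t t (t + 1))))
  | .ld a e, t => .seq (e.comp t) (.instr (.rload t a t))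

/-- Code that sets variable `t` to `1` or `0` according to the condition. -/
def Cd.comp : Cd → ℕ → Prog
  | .lt a b, t => .seq (a.comp t) (.seq (b.comp (t + 1))
      (.ite (.lt t (t + 1)) (.instr (.const t 1)) (.instr (.const t 0))))
  | .eq a b, t => .seq (a.comp t) (.seq (b.comp (t + 1))
      (.ite (.eq t (t + 1)) (.instr (.const t 1)) (.instr (.const t 0))))
  | .rlt a b, t => .seq (a.comp t) (.seq (b.comp (t + 1))
      (.ite (.rlt t (t + 1)) (.instr (.const t 1)) (.instr (.const t 0))))
  | .not c, t => .seq (c.comp t)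
      (.seq (.instr (.const (t + 1) 1)) (.instr (.sub t (t + 1) t)))
  | .and c d, t => .seq (c.comp t) (.seq (d.comp (t + 1)) (.instr (.mul t t (t + 1))))

/-- Evaluate a condition and prepare the test `T + 1 < T`. -/
def Cd.flag (c : Cd) (T : ℕ) : Prog := .seq (c.comp T) (.instr (.const (T + 1) 0))

/-- The compiler; variables from `T` on are used as temporaries. -/
def Cm.comp (T : ℕ) : Cm → Prog
  | .skip => .skip
  | .set x e => .seq (e.comp T) (.seq (.instr (.const (T + 1) 0)) (.instr (.sub x T (T + 1))))
  | .rset x e => .seq (e.comp T) (.seq (.instr (.rzero (T + 1))) (.instr (.radd x T (T + 1))))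
  | .st a i e => .seq (i.comp T) (.seq (e.comp (T + 1)) (.instr (.store a T (T + 1))))
  | .rst a i e => .seq (i.comp T) (.seq (e.comp (T + 1)) (.instr (.rstore a T (T + 1))))
  | .seq p q => .seq (p.comp T) (q.comp T)
  | .ite c p q => .seq (c.flag T) (.ite (.lt (T + 1) T) (p.comp T) (q.comp T))
  | .while c p => .seq (c.flag T) (.while (.lt (T + 1) T) (.seq (p.comp T) (c.flag T)))

/-- A bound for the running time of the evaluation. -/
def Ex.size : Ex → ℕ
  | .v _ => 2
  | .c _ => 1
  | .add a b => a.size + b.size + 1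
  | .sub a b => a.size + b.size + 1
  | .mul a b => a.size + b.size + 1
  | .ld _ e => e.size + 1

/-- A bound for the running time of the evaluation. -/
def RE.size : RE → ℕ
  | .v _ => 2
  | .zero => 1
  | .add a b => a.size + b.size + 1
  | .sub a b => a.size + b.size + 1
  | .ld _ e => e.size + 1

/-- A bound for the running time of the evaluation. -/
def Cd.size : Cd → ℕ
  | .lt a b => a.size + b.size + 2
  | .eq a b => a.size + b.size + 2
  | .rlt a b => a.size + b.size + 2
  | .not c => c.size + 2
  | .and c d => c.size + d.size + 1

/-- A bound for the running time of a single step. -/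
def Cm.size : Cm → ℕ
  | .skip => 1
  | .set _ e => e.size + 2
  | .rset _ e => e.size + 2
  | .st _ i e => i.size + e.size + 1
  | .rst _ i e => i.size + e.size + 1
  | .seq p q => max p.size q.size
  | .ite c p q => max (c.size + 2) (max p.size q.size)
  | .while c p => max (c.size + 2) p.size

/-- Agreement below `T`. -/
structure MState.Sim (T : ℕ) (σ τ : MState) : Prop where
  ivar : ∀ x < T, τ.ivar x = σ.ivar x
  rvar : ∀ x < T, τ.rvar x = σ.rvar x
  ints : τ.ints = σ.ints
  reals : τ.reals = σ.reals

theorem MState.Sim.refl (T : ℕ) (σ : MState) : MState.Sim T σ σ :=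
  ⟨fun _ _ => rfl, fun _ _ => rfl, rfl, rfl⟩

theorem MState.Sim.trans {T : ℕ} {σ τ υ : MState} (h : MState.Sim T σ τ)
    (h' : MState.Sim T τ υ) : MState.Sim T σ υ :=
  ⟨fun x hx => (h'.ivar x hx).trans (h.ivar x hx), fun x hx => (h'.rvar x hx).trans (h.rvar x hx),
    h'.ints.trans h.ints, h'.reals.trans h.reals⟩

theorem MState.Sim.mono {T T' : ℕ} {σ τ : MState} (h : MState.Sim T σ τ) (hT : T' ≤ T) :
    MState.Sim T' σ τ :=
  ⟨fun x hx => h.ivar x (by omega), fun x hx => h.rvar x (by omega), h.ints, h.reals⟩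

theorem Ex.eval_congr {T : ℕ} {σ τ : MState} (h : MState.Sim T σ τ) (e : Ex)
    (he : e.varsLt T = true) : e.eval τ = e.eval σ := by
  induction e with
  | v x => exact h.ivar x (by simpa [Ex.varsLt] using he)
  | c k => rfl
  | add a b iha ihb | sub a b iha ihb | mul a b iha ihb =>
    simp only [Ex.varsLt, Bool.and_eq_true] at he
    simp [iha he.1, ihb he.2]
  | ld a e ih => simp only [Ex.varsLt] at he; simp [ih he, h.ints]

theorem Ex.fits_congr {T B : ℕ} {σ τ : MState} (h : MState.Sim T σ τ) (e : Ex)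
    (he : e.varsLt T = true) (hf : e.fits B σ) : e.fits B τ := by
  induction e with
  | v x => trivial
  | c k => exact hf
  | add a b iha ihb | mul a b iha ihb =>
    simp only [Ex.varsLt, Bool.and_eq_true] at he
    simp only [Ex.fits] at hf ⊢
    rw [Ex.eval_congr h a he.1, Ex.eval_congr h b he.2]
    exact ⟨iha he.1 hf.1, ihb he.2 hf.2.1, hf.2.2⟩
  | sub a b iha ihb =>
    simp only [Ex.varsLt, Bool.and_eq_true] at he
    exact ⟨iha he.1 hf.1, ihb he.2 hf.2⟩
  | ld a e ih => exact ih he hf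

theorem RE.eval_congr {T : ℕ} {σ τ : MState} (h : MState.Sim T σ τ) (e : RE)
    (he : e.varsLt T = true) : e.eval τ = e.eval σ := by
  induction e with
  | v x => exact h.rvar x (by simpa [RE.varsLt] using he)
  | zero => rfl
  | add a b iha ihb | sub a b iha ihb =>
    simp only [RE.varsLt, Bool.and_eq_true] at he
    simp [iha he.1, ihb he.2]
  | ld a e => simp only [RE.varsLt] at he; simp [Ex.eval_congr h e he, h.reals]

theorem RE.fits_congr {T B : ℕ} {σ τ : MState} (h : MState.Sim T σ τ) (e : RE)
    (he : e.varsLt T = true) (hf : e.fits B σ) : e.fits B τ := by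
  induction e with
  | v x => trivial
  | zero => trivial
  | add a b iha ihb | sub a b iha ihb =>
    simp only [RE.varsLt, Bool.and_eq_true] at he
    exact ⟨iha he.1 hf.1, ihb he.2 hf.2⟩
  | ld a e => exact Ex.fits_congr h e he hf

theorem Cd.holds_congr {T : ℕ} {σ τ : MState} (h : MState.Sim T σ τ) (c : Cd)
    (hc : c.varsLt T = true) : c.holds τ ↔ c.holds σ := by
  induction c with
  | lt a b | eq a b =>
    simp only [Cd.varsLt, Bool.and_eq_true] at hc
    simp [Ex.eval_congr h a hc.1, Ex.eval_congr h b hc.2]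
  | rlt a b =>
    simp only [Cd.varsLt, Bool.and_eq_true] at hc
    simp [RE.eval_congr h a hc.1, RE.eval_congr h b hc.2]
  | not c ih => simp [ih hc]
  | and c d ihc ihd =>
    simp only [Cd.varsLt, Bool.and_eq_true] at hc
    simp [ihc hc.1, ihd hc.2]

theorem Cd.fits_congr {T B : ℕ} {σ τ : MState} (h : MState.Sim T σ τ) (c : Cd)
    (hc : c.varsLt T = true) (hf : c.fits B σ) : c.fits B τ := by
  induction c with
  | lt a b | eq a b =>
    simp only [Cd.varsLt, Bool.and_eq_true] at hc
    exact ⟨Ex.fits_congr h a hc.1 hf.1, Ex.fits_congr h b hc.2 hf.2⟩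
  | rlt a b =>
    simp only [Cd.varsLt, Bool.and_eq_true] at hc
    exact ⟨RE.fits_congr h a hc.1 hf.1, RE.fits_congr h b hc.2 hf.2⟩
  | not c ih => exact ih hc hf
  | and c d ihc ihd =>
    simp only [Cd.varsLt, Bool.and_eq_true] at hc
    exact ⟨ihc hc.1 hf.1, ihd hc.2 hf.2⟩

theorem Ex.varsLt_mono {T T' : ℕ} (hT : T ≤ T') (e : Ex) (he : e.varsLt T = true) :
    e.varsLt T' = true := by
  induction e with
  | v x => simp only [Ex.varsLt, decide_eq_true_eq] at he ⊢; omega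
  | c k => rfl
  | add a b iha ihb | sub a b iha ihb | mul a b iha ihb =>
    simp only [Ex.varsLt, Bool.and_eq_true] at he ⊢
    exact ⟨iha he.1, ihb he.2⟩
  | ld a e ih => exact ih he

theorem RE.varsLt_mono {T T' : ℕ} (hT : T ≤ T') (e : RE) (he : e.varsLt T = true) :
    e.varsLt T' = true := by
  induction e with
  | v x => simp only [RE.varsLt, decide_eq_true_eq] at he ⊢; omega
  | zero => rfl
  | add a b iha ihb | sub a b iha ihb =>
    simp only [RE.varsLt, Bool.and_eq_true] at he ⊢
    exact ⟨iha he.1, ihb he.2⟩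
  | ld a e => exact Ex.varsLt_mono hT e he

theorem Cd.varsLt_mono {T T' : ℕ} (hT : T ≤ T') (c : Cd) (hc : c.varsLt T = true) :
    c.varsLt T' = true := by
  induction c with
  | lt a b | eq a b =>
    simp only [Cd.varsLt, Bool.and_eq_true] at hc ⊢
    exact ⟨Ex.varsLt_mono hT a hc.1, Ex.varsLt_mono hT b hc.2⟩
  | rlt a b =>
    simp only [Cd.varsLt, Bool.and_eq_true] at hc ⊢
    exact ⟨RE.varsLt_mono hT a hc.1, RE.varsLt_mono hT b hc.2⟩
  | not c ih => exact ih hc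
  | and c d ihc ihd =>
    simp only [Cd.varsLt, Bool.and_eq_true] at hc ⊢
    exact ⟨ihc hc.1, ihd hc.2⟩

theorem MState.sim_setI {T x : ℕ} (σ : MState) (k : ℕ) (hx : T ≤ x) :
    MState.Sim T σ (σ.setI x k) :=
  ⟨fun y hy => by simp; omega, fun _ _ => rfl, rfl, rfl⟩

theorem MState.sim_setR {T x : ℕ} (σ : MState) (k : ℝ) (hx : T ≤ x) :
    MState.Sim T σ (σ.setR x k) :=
  ⟨fun _ _ => rfl, fun y hy => by simp; omega, rfl, rfl⟩

/-- The left operand waits in variable `t` while the code for the right operand touches only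
variables from `t + 1` on; agreement below `t + 1` therefore preserves it. In this way temporaries
form a stack. -/
theorem Ex.comp_exec {B : ℕ} (hB : 1 < B) (e : Ex) : ∀ (t : ℕ) (σ : MState),
    e.varsLt t = true → e.fits B σ →
    ∃ k τ, Exec B (e.comp t) σ k τ ∧ k ≤ e.size ∧ τ.ivar t = e.eval σ ∧ MState.Sim t σ τ := by
  induction e with
  | v x =>
    intro t σ he _
    simp only [Ex.varsLt, decide_eq_true_eq] at he
    -- A copy is made by subtracting `0`, as the machine has no move between word variables;
    -- subtraction never overflows.
    refine ⟨_, _, .seq (.instr _ _ ?_) (.instr _ _ trivial), le_refl _, ?_, ?_⟩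
    · simp only [Instr.Fits]; omega
    · simp [Instr.apply, he.ne]
    · exact (MState.sim_setI _ _ le_rfl).trans (MState.sim_setI _ _ le_rfl)
  | c k =>
    intro t σ _ hf
    exact ⟨_, _, .instr _ _ hf, le_refl _, by simp [Instr.apply], MState.sim_setI _ _ le_rfl⟩
  | add a b iha ihb | mul a b iha ihb =>
    intro t σ he hf
    simp only [Ex.varsLt, Bool.and_eq_true] at he
    obtain ⟨k₁, τ₁, h₁, hk₁, hv₁, hs₁⟩ := iha t σ he.1 hf.1
    obtain ⟨k₂, τ₂, h₂, hk₂, hv₂, hs₂⟩ := ihb (t + 1) τ₁ (Ex.varsLt_mono (by omega) _ he.2)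
      (Ex.fits_congr hs₁ _ he.2 hf.2.1)
    have h1 : τ₂.ivar t = a.eval σ := by rw [hs₂.ivar t (by omega), hv₁]
    have h2 : τ₂.ivar (t + 1) = b.eval σ := by rw [hv₂, Ex.eval_congr hs₁ _ he.2]
    refine ⟨_, _, .seq h₁ (.seq h₂ (.instr _ _ ?_)), ?_, ?_, ?_⟩
    · simpa only [Instr.Fits, h1, h2] using hf.2.2
    · simp only [Ex.size]; omega
    · simp [Instr.apply, h1, h2]
    · exact hs₁.trans ((hs₂.mono (by omega)).trans (MState.sim_setI _ _ le_rfl))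
  | sub a b iha ihb =>
    intro t σ he hf
    simp only [Ex.varsLt, Bool.and_eq_true] at he
    obtain ⟨k₁, τ₁, h₁, hk₁, hv₁, hs₁⟩ := iha t σ he.1 hf.1
    obtain ⟨k₂, τ₂, h₂, hk₂, hv₂, hs₂⟩ := ihb (t + 1) τ₁ (Ex.varsLt_mono (by omega) _ he.2)
      (Ex.fits_congr hs₁ _ he.2 hf.2)
    have h1 : τ₂.ivar t = a.eval σ := by rw [hs₂.ivar t (by omega), hv₁]
    have h2 : τ₂.ivar (t + 1) = b.eval σ := by rw [hv₂, Ex.eval_congr hs₁ _ he.2]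
    refine ⟨_, _, .seq h₁ (.seq h₂ (.instr _ _ trivial)), ?_, ?_, ?_⟩
    · simp only [Ex.size]; omega
    · simp [Instr.apply, h1, h2]
    · exact hs₁.trans ((hs₂.mono (by omega)).trans (MState.sim_setI _ _ le_rfl))
  | ld a e ih =>
    intro t σ he hf
    obtain ⟨k₁, τ₁, h₁, hk₁, hv₁, hs₁⟩ := ih t σ he hf
    refine ⟨_, _, .seq h₁ (.instr _ _ trivial), by simp only [Ex.size]; omega, ?_,
      hs₁.trans (MState.sim_setI _ _ le_rfl)⟩
    simp [Instr.apply, hv₁, hs₁.ints]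

theorem RE.comp_exec {B : ℕ} (hB : 1 < B) (e : RE) : ∀ (t : ℕ) (σ : MState),
    e.varsLt t = true → e.fits B σ →
    ∃ k τ, Exec B (e.comp t) σ k τ ∧ k ≤ e.size ∧ τ.rvar t = e.eval σ ∧ MState.Sim t σ τ ∧
      (∀ x, x < t → τ.ivar x = σ.ivar x) := by
  suffices H : ∀ (t : ℕ) (σ : MState), e.varsLt t = true → e.fits B σ →
      ∃ k τ, Exec B (e.comp t) σ k τ ∧ k ≤ e.size ∧ τ.rvar t = e.eval σ ∧ MState.Sim t σ τ by
    intro t σ h h'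
    obtain ⟨k, τ, h1, h2, h3, h4⟩ := H t σ h h'
    exact ⟨k, τ, h1, h2, h3, h4, h4.ivar⟩
  induction e with
  | v x =>
    intro t σ he _
    simp only [RE.varsLt, decide_eq_true_eq] at he
    refine ⟨_, _, .seq (.instr _ _ trivial) (.instr _ _ trivial), le_refl _, ?_, ?_⟩
    · simp [Instr.apply, he.ne]
    · exact (MState.sim_setR _ _ le_rfl).trans (MState.sim_setR _ _ le_rfl)
  | zero =>
    intro t σ _ hf
    exact ⟨_, _, .instr _ _ trivial, le_refl _, by simp [Instr.apply], MState.sim_setR _ _ le_rfl⟩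
  | add a b iha ihb | sub a b iha ihb =>
    intro t σ he hf
    simp only [RE.varsLt, Bool.and_eq_true] at he
    obtain ⟨k₁, τ₁, h₁, hk₁, hv₁, hs₁⟩ := iha t σ he.1 hf.1
    obtain ⟨k₂, τ₂, h₂, hk₂, hv₂, hs₂⟩ := ihb (t + 1) τ₁ (RE.varsLt_mono (by omega) _ he.2)
      (RE.fits_congr hs₁ _ he.2 hf.2)
    have h1 : τ₂.rvar t = a.eval σ := by rw [hs₂.rvar t (by omega), hv₁]
    have h2 : τ₂.rvar (t + 1) = b.eval σ := by rw [hv₂, RE.eval_congr hs₁ _ he.2]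
    refine ⟨_, _, .seq h₁ (.seq h₂ (.instr _ _ trivial)), ?_, ?_, ?_⟩
    · simp only [RE.size]; omega
    · simp [Instr.apply, h1, h2]
    · exact hs₁.trans ((hs₂.mono (by omega)).trans (MState.sim_setR _ _ le_rfl))
  | ld a e =>
    intro t σ he hf
    obtain ⟨k₁, τ₁, h₁, hk₁, hv₁, hs₁⟩ := Ex.comp_exec hB e t σ he hf
    refine ⟨_, _, .seq h₁ (.instr _ _ trivial), by simp only [RE.size]; omega, ?_,
      hs₁.trans (MState.sim_setR _ _ le_rfl)⟩
    simp [Instr.apply, hv₁, hs₁.reals]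

-- Truth values become the words `1` and `0`, so that negation is `1 - t` and conjunction is a
-- product. Both conjuncts are always evaluated, which is why `Cd.fits` asks both of them to fit.
open Classical in
theorem Cd.comp_exec {B : ℕ} (hB : 1 < B) (c : Cd) : ∀ (t : ℕ) (σ : MState),
    c.varsLt t = true → c.fits B σ →
    ∃ k τ, Exec B (c.comp t) σ k τ ∧ k ≤ c.size ∧ τ.ivar t = (if c.holds σ then 1 else 0) ∧
      MState.Sim t σ τ := by
  have fin (t : ℕ) (τ : MState) (b : Test) (P : Prop) (hP : b.Holds τ ↔ P) :
      ∃ τ', Exec B (.ite b (.instr (.const t 1)) (.instr (.const t 0))) τ 2 τ' ∧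
        τ'.ivar t = (if P then 1 else 0) ∧ MState.Sim t τ τ' := by
    by_cases h : P
    · refine ⟨_, .ite_true (hP.2 h) (.instr _ _ ?_), ?_, MState.sim_setI _ _ le_rfl⟩
      · exact hB
      · simp [Instr.apply, h]
    · refine ⟨_, .ite_false (fun hb => h (hP.1 hb)) (.instr _ _ ?_), ?_,
        MState.sim_setI _ _ le_rfl⟩
      · simp only [Instr.Fits]; omega
      · simp [Instr.apply, h]
  induction c with
  | lt a b =>
    intro t σ hc hf
    simp only [Cd.varsLt, Bool.and_eq_true] at hc
    obtain ⟨k₁, τ₁, h₁, hk₁, hv₁, hs₁⟩ := Ex.comp_exec hB a t σ hc.1 hf.1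
    obtain ⟨k₂, τ₂, h₂, hk₂, hv₂, hs₂⟩ := Ex.comp_exec hB b (t + 1) τ₁
      (Ex.varsLt_mono (by omega) _ hc.2) (Ex.fits_congr hs₁ _ hc.2 hf.2)
    have h1 : τ₂.ivar t = a.eval σ := by rw [hs₂.ivar t (by omega), hv₁]
    have h2 : τ₂.ivar (t + 1) = b.eval σ := by rw [hv₂, Ex.eval_congr hs₁ _ hc.2]
    obtain ⟨τ₃, h₃, hv₃, hs₃⟩ := fin t τ₂ (.lt t (t + 1)) (a.eval σ < b.eval σ)
      (by simp only [Test.Holds, h1, h2])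
    refine ⟨_, _, .seq h₁ (.seq h₂ h₃), by simp only [Cd.size]; omega, hv₃, ?_⟩
    exact hs₁.trans ((hs₂.mono (by omega)).trans hs₃)
  | eq a b =>
    intro t σ hc hf
    simp only [Cd.varsLt, Bool.and_eq_true] at hc
    obtain ⟨k₁, τ₁, h₁, hk₁, hv₁, hs₁⟩ := Ex.comp_exec hB a t σ hc.1 hf.1
    obtain ⟨k₂, τ₂, h₂, hk₂, hv₂, hs₂⟩ := Ex.comp_exec hB b (t + 1) τ₁
      (Ex.varsLt_mono (by omega) _ hc.2) (Ex.fits_congr hs₁ _ hc.2 hf.2)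
    have h1 : τ₂.ivar t = a.eval σ := by rw [hs₂.ivar t (by omega), hv₁]
    have h2 : τ₂.ivar (t + 1) = b.eval σ := by rw [hv₂, Ex.eval_congr hs₁ _ hc.2]
    obtain ⟨τ₃, h₃, hv₃, hs₃⟩ := fin t τ₂ (.eq t (t + 1)) (a.eval σ = b.eval σ)
      (by simp only [Test.Holds, h1, h2])
    refine ⟨_, _, .seq h₁ (.seq h₂ h₃), by simp only [Cd.size]; omega, hv₃, ?_⟩
    exact hs₁.trans ((hs₂.mono (by omega)).trans hs₃)
  | rlt a b =>
    intro t σ hc hf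
    simp only [Cd.varsLt, Bool.and_eq_true] at hc
    obtain ⟨k₁, τ₁, h₁, hk₁, hv₁, hs₁, -⟩ := RE.comp_exec hB a t σ hc.1 hf.1
    obtain ⟨k₂, τ₂, h₂, hk₂, hv₂, hs₂, -⟩ := RE.comp_exec hB b (t + 1) τ₁
      (RE.varsLt_mono (by omega) _ hc.2) (RE.fits_congr hs₁ _ hc.2 hf.2)
    have h1 : τ₂.rvar t = a.eval σ := by rw [hs₂.rvar t (by omega), hv₁]
    have h2 : τ₂.rvar (t + 1) = b.eval σ := by rw [hv₂, RE.eval_congr hs₁ _ hc.2]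
    obtain ⟨τ₃, h₃, hv₃, hs₃⟩ := fin t τ₂ (.rlt t (t + 1)) (a.eval σ < b.eval σ)
      (by simp only [Test.Holds, h1, h2])
    refine ⟨_, _, .seq h₁ (.seq h₂ h₃), by simp only [Cd.size]; omega, hv₃, ?_⟩
    exact hs₁.trans ((hs₂.mono (by omega)).trans hs₃)
  | not c ih =>
    intro t σ hc hf
    obtain ⟨k₁, τ₁, h₁, hk₁, hv₁, hs₁⟩ := ih t σ hc hf
    refine ⟨_, _, .seq h₁ (.seq (.instr _ _ ?_) (.instr _ _ trivial)),
      by simp only [Cd.size]; omega, ?_, ?_⟩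
    · exact hB
    · by_cases h : c.holds σ <;> simp [Instr.apply, hv₁, h]
    · exact hs₁.trans ((MState.sim_setI _ _ (by omega)).trans (MState.sim_setI _ _ le_rfl))
  | and c d ihc ihd =>
    intro t σ hc hf
    simp only [Cd.varsLt, Bool.and_eq_true] at hc
    obtain ⟨k₁, τ₁, h₁, hk₁, hv₁, hs₁⟩ := ihc t σ hc.1 hf.1
    obtain ⟨k₂, τ₂, h₂, hk₂, hv₂, hs₂⟩ := ihd (t + 1) τ₁ (Cd.varsLt_mono (by omega) _ hc.2)
      (Cd.fits_congr hs₁ _ hc.2 hf.2)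
    have h1 : τ₂.ivar t = if c.holds σ then 1 else 0 := by rw [hs₂.ivar t (by omega), hv₁]
    have h2 : τ₂.ivar (t + 1) = if d.holds σ then 1 else 0 := by
      rw [hv₂]; simp only [Cd.holds_congr hs₁ _ hc.2]
    refine ⟨_, _, .seq h₁ (.seq h₂ (.instr _ _ ?_)), by simp only [Cd.size]; omega, ?_, ?_⟩
    · simp only [Instr.Fits, h1, h2]; split_ifs <;> omega
    · by_cases h : c.holds σ <;> by_cases h' : d.holds σ <;> simp [Instr.apply, h1, h2, h, h']
    · exact hs₁.trans ((hs₂.mono (by omega)).trans (MState.sim_setI _ _ le_rfl))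

theorem Cd.flag_exec {B T : ℕ} (hB : 1 < B) (c : Cd) (σ : MState) (hc : c.varsLt T = true)
    (hf : c.fits B σ) :
    ∃ k τ, Exec B (c.flag T) σ k τ ∧ k ≤ c.size + 1 ∧
      ((Test.lt (T + 1) T).Holds τ ↔ c.holds σ) ∧ MState.Sim T σ τ := by
  obtain ⟨k₁, τ₁, h₁, hk₁, hv₁, hs₁⟩ := c.comp_exec hB T σ hc hf
  refine ⟨_, _, .seq h₁ (.instr _ _ ?_), by omega, ?_,
    hs₁.trans (MState.sim_setI _ _ (by omega))⟩
  · simp only [Instr.Fits]; omega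
  · by_cases h : c.holds σ <;> simp [Instr.apply, Test.Holds, hv₁, h]

theorem Exec.seq_inv {B : ℕ} {p q : Prog} {σ σ'' : MState} {k : ℕ}
    (h : Exec B (.seq p q) σ k σ'') :
    ∃ k₁ k₂ σ', Exec B p σ k₁ σ' ∧ Exec B q σ' k₂ σ'' ∧ k = k₁ + k₂ := by
  cases h with
  | seq h₁ h₂ => exact ⟨_, _, _, h₁, h₂, rfl⟩

/-- Correctness of the compiler. -/
theorem HExec.comp {B T M : ℕ} (hB : 1 < B) {c : Cm} {σ σ' : MState} {k : ℕ}
    (h : HExec B c σ k σ') (hc : c.varsLt T = true) (hM : c.size ≤ M) :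
    ∀ τ, MState.Sim T σ τ →
      ∃ k' τ', Exec B (c.comp T) τ k' τ' ∧ k' ≤ M * k ∧ MState.Sim T σ' τ' := by
  induction h with
  | skip σ =>
    intro τ hτ
    exact ⟨1, τ, .skip τ, by simp only [Cm.size] at hM; omega, hτ⟩
  | set x e σ hf =>
    intro τ hτ
    simp only [Cm.varsLt, Bool.and_eq_true, decide_eq_true_eq] at hc
    obtain ⟨k₁, τ₁, h₁, hk₁, hv₁, hs₁⟩ := e.comp_exec hB T τ hc.2 (Ex.fits_congr hτ _ hc.2 hf)
    refine ⟨_, _, .seq h₁ (.seq (.instr _ _ ?_) (.instr _ _ trivial)), ?_, ?_⟩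
    · simp only [Instr.Fits]; omega
    · simp only [Cm.size] at hM; omega
    · have := hτ.trans hs₁
      refine ⟨fun y hy => ?_, this.rvar, this.ints, this.reals⟩
      have h1 := this.ivar y hy
      have h2 : y ≠ T + 1 := by omega
      simp [Instr.apply, hv₁, Ex.eval_congr hτ _ hc.2, h1, h2]
  | rset x e σ hf =>
    intro τ hτ
    simp only [Cm.varsLt, Bool.and_eq_true, decide_eq_true_eq] at hc
    obtain ⟨k₁, τ₁, h₁, hk₁, hv₁, hs₁, -⟩ := e.comp_exec hB T τ hc.2 (RE.fits_congr hτ _ hc.2 hf)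
    refine ⟨_, _, .seq h₁ (.seq (.instr _ _ trivial) (.instr _ _ trivial)), ?_, ?_⟩
    · simp only [Cm.size] at hM; omega
    · have := hτ.trans hs₁
      refine ⟨this.ivar, fun y hy => ?_, this.ints, this.reals⟩
      have h1 := this.rvar y hy
      have h2 : y ≠ T + 1 := by omega
      simp [Instr.apply, hv₁, RE.eval_congr hτ _ hc.2, h1, h2]
  | st a i e σ hi hf =>
    intro τ hτ
    simp only [Cm.varsLt, Bool.and_eq_true] at hc
    obtain ⟨k₁, τ₁, h₁, hk₁, hv₁, hs₁⟩ := i.comp_exec hB T τ hc.1 (Ex.fits_congr hτ _ hc.1 hi)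
    have hs := hτ.trans hs₁
    obtain ⟨k₂, τ₂, h₂, hk₂, hv₂, hs₂⟩ := e.comp_exec hB (T + 1) τ₁
      (Ex.varsLt_mono (by omega) _ hc.2) (Ex.fits_congr hs _ hc.2 hf)
    refine ⟨_, _, .seq h₁ (.seq h₂ (.instr _ _ trivial)), by simp only [Cm.size] at hM; omega, ?_⟩
    have h3 := hs.trans (hs₂.mono (by omega))
    have h1 : τ₂.ivar T = i.eval σ := by
      rw [hs₂.ivar T (by omega), hv₁, Ex.eval_congr hτ _ hc.1]
    refine ⟨h3.ivar, h3.rvar, ?_, h3.reals⟩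
    simp [Instr.apply, MState.stI, h1, hv₂, Ex.eval_congr hs _ hc.2, h3.ints]
  | rst a i e σ hi hf =>
    intro τ hτ
    simp only [Cm.varsLt, Bool.and_eq_true] at hc
    obtain ⟨k₁, τ₁, h₁, hk₁, hv₁, hs₁⟩ := i.comp_exec hB T τ hc.1 (Ex.fits_congr hτ _ hc.1 hi)
    have hs := hτ.trans hs₁
    obtain ⟨k₂, τ₂, h₂, hk₂, hv₂, hs₂, -⟩ := e.comp_exec hB (T + 1) τ₁
      (RE.varsLt_mono (by omega) _ hc.2) (RE.fits_congr hs _ hc.2 hf)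
    refine ⟨_, _, .seq h₁ (.seq h₂ (.instr _ _ trivial)), by simp only [Cm.size] at hM; omega, ?_⟩
    have h3 := hs.trans (hs₂.mono (by omega))
    have h1 : τ₂.ivar T = i.eval σ := by
      rw [hs₂.ivar T (by omega), hv₁, Ex.eval_congr hτ _ hc.1]
    refine ⟨h3.ivar, h3.rvar, h3.ints, ?_⟩
    simp [Instr.apply, MState.stR, h1, hv₂, RE.eval_congr hs _ hc.2, h3.reals]
  | seq _ _ ih₁ ih₂ =>
    intro τ hτ
    simp only [Cm.varsLt, Bool.and_eq_true] at hc
    simp only [Cm.size, sup_le_iff] at hM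
    obtain ⟨k₁, τ₁, h₁, hk₁, hs₁⟩ := ih₁ hc.1 hM.1 τ hτ
    obtain ⟨k₂, τ₂, h₂, hk₂, hs₂⟩ := ih₂ hc.2 hM.2 τ₁ hs₁
    exact ⟨_, _, .seq h₁ h₂, by rw [Nat.mul_add]; omega, hs₂⟩
  | @ite_true c p q σ σ' k hf hh _ ih =>
    intro τ hτ
    simp only [Cm.varsLt, Bool.and_eq_true] at hc
    simp only [Cm.size, sup_le_iff] at hM
    obtain ⟨k₁, τ₁, h₁, hk₁, hv₁, hs₁⟩ := c.flag_exec hB τ hc.1.1 (Cd.fits_congr hτ _ hc.1.1 hf)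
    obtain ⟨k₂, τ₂, h₂, hk₂, hs₂⟩ := ih hc.1.2 hM.2.1 τ₁ (hτ.trans hs₁)
    refine ⟨_, _, .seq h₁ (.ite_true ?_ h₂), by rw [Nat.mul_add]; omega, hs₂⟩
    rwa [hv₁, Cd.holds_congr hτ _ hc.1.1]
  | @ite_false c p q σ σ' k hf hh _ ih =>
    intro τ hτ
    simp only [Cm.varsLt, Bool.and_eq_true] at hc
    simp only [Cm.size, sup_le_iff] at hM
    obtain ⟨k₁, τ₁, h₁, hk₁, hv₁, hs₁⟩ := c.flag_exec hB τ hc.1.1 (Cd.fits_congr hτ _ hc.1.1 hf)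
    obtain ⟨k₂, τ₂, h₂, hk₂, hs₂⟩ := ih hc.2 hM.2.2 τ₁ (hτ.trans hs₁)
    refine ⟨_, _, .seq h₁ (.ite_false ?_ h₂), by rw [Nat.mul_add]; omega, hs₂⟩
    rwa [hv₁, Cd.holds_congr hτ _ hc.1.1]
  | @while_true c p σ σ' σ'' k k' hf hh _ _ ih₁ ih₂ =>
    intro τ hτ
    have hc' := hc
    have hM' := hM
    simp only [Cm.varsLt, Bool.and_eq_true] at hc
    simp only [Cm.size, sup_le_iff] at hM
    obtain ⟨k₁, τ₁, h₁, hk₁, hv₁, hs₁⟩ := c.flag_exec hB τ hc.1 (Cd.fits_congr hτ _ hc.1 hf)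
    obtain ⟨k₂, τ₂, h₂, hk₂, hs₂⟩ := ih₁ hc.2 hM.2 τ₁ (hτ.trans hs₁)
    obtain ⟨k₃, τ₃, h₃, hk₃, hs₃⟩ := ih₂ hc' hM' τ₂ hs₂
    -- Compiled code computes the flag before the loop and again at the end of every pass. The
    -- initial flag computation of the remaining run is thus regrouped as the end of the present
    -- pass.
    obtain ⟨k₄, k₅, τ₄, h₄, h₅, rfl⟩ := h₃.seq_inv
    refine ⟨_, _, .seq h₁ (.while_true ?_ (.seq h₂ h₄) h₅), ?_, hs₃⟩
    · rwa [hv₁, Cd.holds_congr hτ _ hc.1]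
    · rw [Nat.mul_add, Nat.mul_add]; omega
  | @while_false c p σ hf hh =>
    intro τ hτ
    simp only [Cm.varsLt, Bool.and_eq_true] at hc
    simp only [Cm.size, sup_le_iff] at hM
    obtain ⟨k₁, τ₁, h₁, hk₁, hv₁, hs₁⟩ := c.flag_exec hB τ hc.1 (Cd.fits_congr hτ _ hc.1 hf)
    refine ⟨_, _, .seq h₁ (.while_false ?_), by omega, hτ.trans hs₁⟩
    rwa [hv₁, Cd.holds_congr hτ _ hc.1]

/-! ### Frame conditions -/

/-- The variables and arrays that a command may write, with a tag for the kind of memory. -/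
def Cm.wr : Cm → List (ℕ × ℕ)
  | .skip => []
  | .set x _ => [(0, x)]
  | .rset x _ => [(1, x)]
  | .st a _ _ => [(2, a)]
  | .rst a _ _ => [(3, a)]
  | .seq p q => p.wr ++ q.wr
  | .ite _ p q => p.wr ++ q.wr
  | .while _ p => p.wr

/-- `τ` differs from `σ` only in what is listed in `W`. -/
structure Frame (W : List (ℕ × ℕ)) (σ τ : MState) : Prop where
  i : ∀ x, (0, x) ∉ W → τ.ivar x = σ.ivar x
  r : ∀ x, (1, x) ∉ W → τ.rvar x = σ.rvar x
  ai : ∀ x, (2, x) ∉ W → τ.ints x = σ.ints x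
  ar : ∀ x, (3, x) ∉ W → τ.reals x = σ.reals x

theorem Frame.refl (W : List (ℕ × ℕ)) (σ : MState) : Frame W σ σ :=
  ⟨fun _ _ => rfl, fun _ _ => rfl, fun _ _ => rfl, fun _ _ => rfl⟩

theorem Frame.trans {W : List (ℕ × ℕ)} {σ τ υ : MState} (h : Frame W σ τ) (h' : Frame W τ υ) :
    Frame W σ υ :=
  ⟨fun x hx => (h'.i x hx).trans (h.i x hx), fun x hx => (h'.r x hx).trans (h.r x hx),
    fun x hx => (h'.ai x hx).trans (h.ai x hx), fun x hx => (h'.ar x hx).trans (h.ar x hx)⟩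

theorem Frame.mono {W W' : List (ℕ × ℕ)} {σ τ : MState} (h : Frame W σ τ) (hW : W ⊆ W') :
    Frame W' σ τ :=
  ⟨fun x hx => h.i x fun hh => hx (hW hh), fun x hx => h.r x fun hh => hx (hW hh),
    fun x hx => h.ai x fun hh => hx (hW hh), fun x hx => h.ar x fun hh => hx (hW hh)⟩

/-- The list `Cm.wr` is computed from the program text, so later claims that some memory is
untouched reduce to `decide`. -/
theorem HExec.frame {B : ℕ} {c : Cm} {σ σ' : MState} {k : ℕ} (h : HExec B c σ k σ') :
    Frame c.wr σ σ' := by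
  induction h with
  | skip σ => exact .refl _ _
  | set x e σ hf =>
    refine ⟨fun y hy => ?_, fun _ _ => rfl, fun _ _ => rfl, fun _ _ => rfl⟩
    simp only [Cm.wr, List.mem_singleton, Prod.mk.injEq, true_and] at hy
    simp [hy]
  | rset x e σ hf =>
    refine ⟨fun _ _ => rfl, fun y hy => ?_, fun _ _ => rfl, fun _ _ => rfl⟩
    simp only [Cm.wr, List.mem_singleton, Prod.mk.injEq, true_and] at hy
    simp [hy]
  | st a i e σ hi hf =>
    refine ⟨fun _ _ => rfl, fun _ _ => rfl, fun y hy => ?_, fun _ _ => rfl⟩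
    simp only [Cm.wr, List.mem_singleton, Prod.mk.injEq, true_and] at hy
    simp [hy]
  | rst a i e σ hi hf =>
    refine ⟨fun _ _ => rfl, fun _ _ => rfl, fun _ _ => rfl, fun y hy => ?_⟩
    simp only [Cm.wr, List.mem_singleton, Prod.mk.injEq, true_and] at hy
    simp [hy]
  | seq _ _ ih₁ ih₂ =>
    exact (ih₁.mono (List.subset_append_left _ _)).trans (ih₂.mono (List.subset_append_right _ _))
  | ite_true _ _ _ ih => exact ih.mono (List.subset_append_left _ _)
  | ite_false _ _ _ ih => exact ih.mono (List.subset_append_right _ _)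
  | while_true _ _ _ _ ih₁ ih₂ => exact ih₁.trans ih₂
  | while_false _ _ => exact .refl _ _

/-! ### Program logic -/

/-- The command halts within `b` steps in a state that satisfies `Q`. -/
def HRun (B : ℕ) (c : Cm) (σ : MState) (b : ℕ) (Q : MState → Prop) : Prop :=
  ∃ k σ', HExec B c σ k σ' ∧ k ≤ b ∧ Q σ'

namespace HRun
variable {B : ℕ} {c p q : Cm} {σ : MState} {b b₁ b₂ : ℕ} {Q R : MState → Prop}

theorem mono (h : HRun B c σ b₁ Q) (hb : b₁ ≤ b₂) (hQ : ∀ τ, Q τ → R τ) : HRun B c σ b₂ R := by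
  obtain ⟨k, τ, h, hk, hq⟩ := h
  exact ⟨k, τ, h, hk.trans hb, hQ τ hq⟩

theorem imp (h : HRun B c σ b Q) (hQ : ∀ τ, Q τ → R τ) : HRun B c σ b R := h.mono le_rfl hQ

theorem le (h : HRun B c σ b₁ Q) (hb : b₁ ≤ b₂) : HRun B c σ b₂ Q := h.mono hb fun _ h => h

theorem seq (h₁ : HRun B p σ b₁ R) (h₂ : ∀ τ, R τ → HRun B q τ b₂ Q) :
    HRun B (p ;; q) σ (b₁ + b₂) Q := by
  obtain ⟨k, τ, h, hk, hq⟩ := h₁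
  obtain ⟨k', τ', h', hk', hq'⟩ := h₂ τ hq
  exact ⟨_, _, .seq h h', by omega, hq'⟩

theorem frame (h : HRun B c σ b Q) : HRun B c σ b fun τ => Q τ ∧ Frame c.wr σ τ := by
  obtain ⟨k, τ, h, hk, hq⟩ := h
  exact ⟨k, τ, h, hk, hq, h.frame⟩

theorem ite {d : Cd} (hf : d.fits B σ) (h₁ : d.holds σ → HRun B p σ b Q)
    (h₂ : ¬ d.holds σ → HRun B q σ b Q) : HRun B (.ite d p q) σ (b + 1) Q := by
  by_cases h : d.holds σ
  · obtain ⟨k, τ, h', hk, hq⟩ := h₁ h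
    exact ⟨_, _, .ite_true hf h h', by omega, hq⟩
  · obtain ⟨k, τ, h', hk, hq⟩ := h₂ h
    exact ⟨_, _, .ite_false hf h h', by omega, hq⟩

end HRun

/-- Weakest preconditions of loop-free commands. -/
@[simp] def wp (B : ℕ) : Cm → (MState → Prop) → MState → Prop
  | .skip, Q, σ => Q σ
  | .set x e, Q, σ => e.fits B σ ∧ Q (σ.setI x (e.eval σ))
  | .rset x e, Q, σ => e.fits B σ ∧ Q (σ.setR x (e.eval σ))
  | .st a i e, Q, σ => i.fits B σ ∧ e.fits B σ ∧ Q (σ.stI a (i.eval σ) (e.eval σ))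
  | .rst a i e, Q, σ => i.fits B σ ∧ e.fits B σ ∧ Q (σ.stR a (i.eval σ) (e.eval σ))
  | .seq p q, Q, σ => wp B p (wp B q Q) σ
  | .ite c p q, Q, σ => c.fits B σ ∧ (c.holds σ → wp B p Q σ) ∧ (¬ c.holds σ → wp B q Q σ)
  | .while _ _, _, _ => False

/-- A bound for the number of steps of a loop-free command. -/
def Cm.len : Cm → ℕ
  | .seq p q => p.len + q.len
  | .ite _ p q => max p.len q.len + 1
  | _ => 1

/-- Straight-line code is verified by simplifying one formula, and its time bound `Cm.len` is a
numeral. Loops have precondition `False` here and need the rules below. -/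
theorem HRun.of_wp {B : ℕ} {c : Cm} : ∀ {σ : MState} {Q : MState → Prop},
    wp B c Q σ → HRun B c σ c.len Q := by
  induction c with
  | skip => exact fun h => ⟨_, _, .skip _, le_refl _, h⟩
  | set x e => exact fun h => ⟨_, _, .set _ _ _ h.1, le_refl _, h.2⟩
  | rset x e => exact fun h => ⟨_, _, .rset _ _ _ h.1, le_refl _, h.2⟩
  | st a i e => exact fun h => ⟨_, _, .st _ _ _ _ h.1 h.2.1, le_refl _, h.2.2⟩
  | rst a i e => exact fun h => ⟨_, _, .rst _ _ _ _ h.1 h.2.1, le_refl _, h.2.2⟩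
  | seq p q ihp ihq => exact fun h => (ihp h).seq fun τ hτ => ihq hτ
  | ite c p q ihp ihq =>
    intro σ Q h
    exact HRun.ite h.1 (fun hc => (ihp (h.2.1 hc)).le (le_max_left _ _))
      (fun hc => (ihq (h.2.2 hc)).le (le_max_right _ _))
  | _ => exact fun h => h.elim

/-- The rule for loops with a decreasing budget. -/
theorem HRun.while {B : ℕ} {c : Cd} {p : Cm} {Q : MState → Prop} (I : ℕ → MState → Prop)
    (hf : ∀ b τ, I b τ → c.fits B τ)
    (hstep : ∀ b τ, I b τ → c.holds τ → ∃ b₁ b₂, b₁ + b₂ + 1 ≤ b ∧ HRun B p τ b₁ (I b₂))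
    (hend : ∀ b τ, I b τ → ¬ c.holds τ → 1 ≤ b ∧ Q τ) :
    ∀ (b : ℕ) (σ : MState), I b σ → HRun B (.while c p) σ b Q := by
  intro b
  induction b using Nat.strong_induction_on with
  | _ b ih =>
    intro σ h
    by_cases hc : c.holds σ
    · obtain ⟨b₁, b₂, hb, k, τ, hp, hk, hI⟩ := hstep b σ h hc
      obtain ⟨k', τ', hw, hk', hq⟩ := ih b₂ (by omega) τ hI
      exact ⟨_, _, .while_true (hf _ _ h) hc hp hw, by omega, hq⟩
    · obtain ⟨hb, hq⟩ := hend b σ h hc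
      exact ⟨_, _, .while_false (hf _ _ h) hc, hb, hq⟩

/-- `for x < N`. -/
def Cm.for (x : ℕ) (N : Ex) (p : Cm) : Cm :=
  .set x (.c 0) ;; .while (.v x <ₑ N) (p ;; .set x (.v x +ₑ .c 1))

/-- The rule for `for` loops with individual costs of the passes. -/
theorem HRun.for {B x N : ℕ} {e : Ex} {p : Cm} {σ : MState} {Q : MState → Prop}
    (I : ℕ → MState → Prop) (cost : ℕ → ℕ)
    (hN : ∀ i ≤ N, ∀ τ, I i τ → Frame (Cm.for x e p).wr σ τ → e.fits B τ ∧ e.eval τ = N)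
    (hB : N + 1 < B)
    (h0 : I 0 (σ.setI x 0))
    (hx : (0, x) ∉ p.wr)
    (hstep : ∀ i < N, ∀ τ, I i τ → τ.ivar x = i → Frame (Cm.for x e p).wr σ τ →
      HRun B p τ (cost i) fun τ' => I (i + 1) (τ'.setI x (i + 1)))
    (hend : ∀ τ, I N τ → Frame (Cm.for x e p).wr σ τ → Q τ) :
    HRun B (Cm.for x e p) σ (∑ i ∈ Finset.range N, (cost i + 2) + 2) Q := by
  have h1 : HRun B (.set x (.c 0)) σ 1 fun τ => τ = σ.setI x 0 :=
    HRun.of_wp ⟨by simp only [Ex.fits]; omega, rfl⟩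
  have h2 := h1.seq (q := .while (.v x <ₑ e) (p ;; .set x (.v x +ₑ .c 1))) (Q := Q)
    (b₂ := ∑ i ∈ Finset.range N, (cost i + 2) + 1) ?_
  · exact h2.le (by omega)
  rintro τ rfl
  -- The budget is the cost of the remaining passes, each with `2` extra steps for the test and the
  -- increment, plus `1` for the final test.
  refine HRun.while (fun b τ => ∃ i ≤ N, I i τ ∧ τ.ivar x = i ∧ Frame (Cm.for x e p).wr σ τ ∧
    b = ∑ j ∈ Finset.Ico i N, (cost j + 2) + 1) ?_ ?_ ?_ _ _ ?_
  · rintro b τ ⟨i, hi, hI, -, hF, -⟩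
    exact ⟨trivial, (hN i hi τ hI hF).1⟩
  · rintro b τ ⟨i, hi, hI, hxi, hF, rfl⟩ hc
    have he := (hN i hi τ hI hF).2
    simp only [Cd.holds, Ex.eval, hxi, he] at hc
    refine ⟨cost i + 1, ∑ j ∈ Finset.Ico (i + 1) N, (cost j + 2) + 1, ?_, ?_⟩
    · rw [Finset.sum_eq_sum_Ico_succ_bot hc]; omega
    · refine (hstep i hc τ hI hxi hF).frame.seq fun τ' hτ' => ?_
      have hxi' : τ'.ivar x = i := by rw [hτ'.2.i x hx, hxi]
      refine ⟨_, _, .set _ _ _ ⟨trivial, by simp only [Ex.fits]; omega, ?_⟩, le_refl _,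
        i + 1, hc, ?_, ?_, ?_, rfl⟩
      · simp only [Ex.eval, hxi']; omega
      · simpa only [Ex.eval, hxi'] using hτ'.1
      · simp [hxi']
      · refine hF.trans ((hτ'.2.mono ?_).trans ⟨fun y hy => ?_, fun _ _ => rfl, fun _ _ => rfl,
          fun _ _ => rfl⟩)
        · intro z hz; simp [Cm.for, Cm.wr, hz]
        · have : y ≠ x := by rintro rfl; exact hy (by simp [Cm.for, Cm.wr])
          simp [this]
  · rintro b τ ⟨i, hi, hI, hxi, hF, rfl⟩ hc
    have he := (hN i hi τ hI hF).2
    simp only [Cd.holds, Ex.eval, hxi, he] at hc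
    obtain rfl : i = N := by omega
    exact ⟨by omega, hend τ hI hF⟩
  · refine ⟨0, by omega, h0, by simp, ⟨fun y hy => ?_, fun _ _ => rfl, fun _ _ => rfl,
          fun _ _ => rfl⟩, by rw [Finset.range_eq_Ico]⟩
    have : y ≠ x := by rintro rfl; exact hy (by simp [Cm.for, Cm.wr])
    simp [this]

/-- The rule for `for` loops with a uniform bound for the costs of the passes. -/
theorem HRun.for' {B x N : ℕ} {e : Ex} {p : Cm} {σ : MState} {Q : MState → Prop}
    (I : ℕ → MState → Prop) (cost : ℕ)
    (hN : ∀ i ≤ N, ∀ τ, I i τ → Frame (Cm.for x e p).wr σ τ → e.fits B τ ∧ e.eval τ = N)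
    (hB : N + 1 < B)
    (h0 : I 0 (σ.setI x 0))
    (hx : (0, x) ∉ p.wr)
    (hstep : ∀ i < N, ∀ τ, I i τ → τ.ivar x = i → Frame (Cm.for x e p).wr σ τ →
      HRun B p τ cost fun τ' => I (i + 1) (τ'.setI x (i + 1)))
    (hend : ∀ τ, I N τ → Frame (Cm.for x e p).wr σ τ → Q τ) :
    HRun B (Cm.for x e p) σ (N * (cost + 2) + 2) Q := by
  have := HRun.for I (fun _ => cost) hN hB h0 hx hstep hend
  simpa using this

/-- The rule for loops with a decreasing budget, with frame conditions. -/
theorem HRun.while' {B : ℕ} {c : Cd} {p : Cm} {Q : MState → Prop} {b : ℕ} {σ : MState}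
    (I : ℕ → MState → Prop) (h0 : I b σ)
    (hf : ∀ b τ, I b τ → Frame p.wr σ τ → c.fits B τ)
    (hstep : ∀ b τ, I b τ → Frame p.wr σ τ → c.holds τ →
      ∃ b₁ b₂, b₁ + b₂ + 1 ≤ b ∧ HRun B p τ b₁ (I b₂))
    (hend : ∀ b τ, I b τ → Frame p.wr σ τ → ¬ c.holds τ → 1 ≤ b ∧ Q τ) :
    HRun B (.while c p) σ b Q := by
  refine HRun.while (fun b τ => I b τ ∧ Frame p.wr σ τ) (fun b τ h => hf b τ h.1 h.2)
    (fun b τ h hc => ?_) (fun b τ h hc => hend b τ h.1 h.2 hc) b σ ⟨h0, Frame.refl _ _⟩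
  obtain ⟨b₁, b₂, hb, hr⟩ := hstep b τ h.1 h.2 hc
  exact ⟨b₁, b₂, hb, hr.frame.imp fun τ' h' => ⟨h'.1, h.2.trans h'.2⟩⟩

/-! ## Rooted trees given by parent functions -/

/-- `par` is the parent function of a rooted tree on `{0, …, n - 1}` with root `r` and depth
function `dep`. -/
structure RTree (n r : ℕ) (par dep : ℕ → ℕ) : Prop where
  r_lt : r < n
  par_lt : ∀ v < n, par v < n
  dep_r : dep r = 0
  dep_par : ∀ v < n, v ≠ r → dep v = dep (par v) + 1

/-- `v` is an ancestor of `y` (possibly `y` itself). -/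
def Anc (r : ℕ) (par : ℕ → ℕ) (v y : ℕ) : Prop :=
  Relation.ReflTransGen (fun y x => y ≠ r ∧ x = par y) y v

/-- The sum of `g` over the ancestors of `y`, without the root. -/
def climbSum {M : Type*} [AddCommMonoid M] (par dep : ℕ → ℕ) (g : ℕ → M) (y : ℕ) : M :=
  ∑ i ∈ Finset.range (dep y), g (par^[i] y)

open Classical in
/-- The vertices of the subtree of `v`. -/
noncomputable def subtree (n r : ℕ) (par : ℕ → ℕ) (v : ℕ) : Finset ℕ :=
  (Finset.range n).filter (Anc r par v)

/-- The number of vertices of the subtree of `v`. -/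
noncomputable def sz (n r : ℕ) (par : ℕ → ℕ) (v : ℕ) : ℕ := (subtree n r par v).card

/-- The sibling vertices that come before `v`. -/
def olderSiblings (r : ℕ) (par : ℕ → ℕ) (v : ℕ) : Finset ℕ :=
  (Finset.range v).filter fun u => u ≠ r ∧ par u = par v

/-- The difference between the preorder numbers of `v` and its parent. -/
noncomputable def preOff (n r : ℕ) (par : ℕ → ℕ) (v : ℕ) : ℕ :=
  1 + ∑ u ∈ olderSiblings r par v, sz n r par u

/-- The preorder number. -/
noncomputable def preNum (n r : ℕ) (par dep : ℕ → ℕ) (v : ℕ) : ℕ :=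
  climbSum par dep (preOff n r par) v

/-- The subtree of `v` has at most half of the vertices of the subtree of its parent. -/
def Light (n r : ℕ) (par : ℕ → ℕ) (v : ℕ) : Prop := 2 * sz n r par v ≤ sz n r par (par v)

open Classical in
/-- The number of light ancestors. -/
noncomputable def lightCount (n r : ℕ) (par dep : ℕ → ℕ) (v : ℕ) : ℕ :=
  climbSum par dep (fun a => if Light n r par a then 1 else 0) v

/-! ### Ancestors, preorder intervals and light vertices -/

theorem anc_refl {r : ℕ} {par : ℕ → ℕ} (v : ℕ) : Anc r par v v := Relation.ReflTransGen.refl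

theorem anc_iff {r : ℕ} {par : ℕ → ℕ} {v y : ℕ} :
    Anc r par v y ↔ y = v ∨ y ≠ r ∧ Anc r par v (par y) := by
  constructor
  · intro h
    rcases Relation.ReflTransGen.cases_head h with h | ⟨z, ⟨h1, rfl⟩, h2⟩
    · exact .inl h
    · exact .inr ⟨h1, h2⟩
  · rintro (rfl | ⟨h1, h2⟩)
    · exact anc_refl _
    · exact Relation.ReflTransGen.head ⟨h1, rfl⟩ h2

theorem anc_of_par {r : ℕ} {par : ℕ → ℕ} {v y : ℕ} (hy : y ≠ r) (h : Anc r par v (par y)) :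
    Anc r par v y := anc_iff.2 (.inr ⟨hy, h⟩)

theorem Anc.trans {r : ℕ} {par : ℕ → ℕ} {u v y : ℕ} (h : Anc r par u v) (h' : Anc r par v y) :
    Anc r par u y := Relation.ReflTransGen.trans h' h

theorem anc_par {r : ℕ} {par : ℕ → ℕ} {y : ℕ} (hy : y ≠ r) : Anc r par (par y) y :=
  anc_of_par hy (anc_refl _)

/-- Climbing is deterministic, so the ancestors of a vertex form a chain. -/
theorem Anc.total {r : ℕ} {par : ℕ → ℕ} {a b y : ℕ} (h : Anc r par a y) (h' : Anc r par b y) :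
    Anc r par a b ∨ Anc r par b a := by
  refine (Relation.ReflTransGen.total_of_right_unique ?_ h h').symm
  rintro x y z ⟨-, rfl⟩ ⟨-, rfl⟩
  rfl

theorem mem_subtree {n r : ℕ} {par : ℕ → ℕ} {v y : ℕ} :
    y ∈ subtree n r par v ↔ y < n ∧ Anc r par v y := by simp [subtree]

namespace RTree
variable {n r : ℕ} {par dep : ℕ → ℕ} (H : RTree n r par dep)
include H

theorem dep_eq_zero {v : ℕ} (hv : v < n) (h : dep v = 0) : v = r := by
  by_contra hr
  have := H.dep_par v hv hr
  omega

/-- Induction from the root. -/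
theorem induct {P : ℕ → Prop} (hr : P r) (hp : ∀ v < n, v ≠ r → P (par v) → P v) :
    ∀ v < n, P v := by
  suffices h : ∀ k, ∀ v < n, dep v = k → P v from fun v hv => h _ v hv rfl
  intro k
  induction k with
  | zero => intro v hv h; exact H.dep_eq_zero hv h ▸ hr
  | succ k ih =>
    intro v hv h
    have hvr : v ≠ r := by rintro rfl; rw [H.dep_r] at h; omega
    exact hp v hv hvr (ih _ (H.par_lt v hv) (by have := H.dep_par v hv hvr; omega))

theorem anc_r : ∀ v < n, Anc r par r v :=
  H.induct (anc_refl _) fun _ _ hr h => anc_of_par hr h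

theorem climbSum_r {M : Type*} [AddCommMonoid M] (g : ℕ → M) : climbSum par dep g r = 0 := by
  simp [climbSum, H.dep_r]

theorem climbSum_par {M : Type*} [AddCommMonoid M] (g : ℕ → M) {v : ℕ} (hv : v < n)
    (hr : v ≠ r) : climbSum par dep g v = g v + climbSum par dep g (par v) := by
  simp [climbSum, H.dep_par v hv hr, Finset.sum_range_succ', add_comm]

theorem anc_lt {v y : ℕ} (h : Anc r par v y) (hy : y < n) : v < n := by
  induction h with
  | refl => exact hy
  | tail _ h ih => rw [h.2]; exact H.par_lt _ ih

theorem anc_cases {v y : ℕ} (hy : y < n) (h : Anc r par v y) : y = v ∨ dep v < dep y := by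
  induction h with
  | refl => exact .inl rfl
  | @tail b c h' h ih =>
    have hb := H.anc_lt h' hy
    have := H.dep_par b hb h.1
    rw [← h.2] at this
    right
    rcases ih with rfl | ih <;> omega

theorem anc_dep {v y : ℕ} (hy : y < n) (h : Anc r par v y) : dep v ≤ dep y := by
  rcases H.anc_cases hy h with rfl | h <;> omega

theorem anc_antisymm {v y : ℕ} (hy : y < n) (h : Anc r par v y) (h' : Anc r par y v) :
    v = y := by
  have h1 := H.anc_dep (H.anc_lt h hy) h'
  rcases H.anc_cases hy h with h2 | h2
  · exact h2.symm
  · omega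

theorem not_anc_par {v : ℕ} (hv : v < n) (hr : v ≠ r) : ¬ Anc r par v (par v) := by
  intro h
  have h1 := H.anc_dep (H.par_lt v hv) h
  have := H.dep_par v hv hr
  omega

omit H in
/-- The child of `p` on the path to a proper descendant. -/
theorem exists_child {p y : ℕ} (h : Anc r par p y) (hne : p ≠ y) :
    ∃ a, par a = p ∧ a ≠ r ∧ Anc r par a y := by
  induction h with
  | refl => exact absurd rfl hne
  | @tail b c h' h ih => exact ⟨b, h.2.symm, h.1, h'⟩

omit H in
theorem sz_pos {v : ℕ} (hv : v < n) : 0 < sz n r par v :=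
  Finset.card_pos.2 ⟨v, mem_subtree.2 ⟨hv, anc_refl _⟩⟩

omit H in
theorem sz_le (v : ℕ) : sz n r par v ≤ n := by
  have : sz n r par v ≤ (Finset.range n).card :=
    Finset.card_le_card fun x hx => Finset.mem_range.2 (mem_subtree.1 hx).1
  simpa using this

omit H in
theorem sz_anc {v y : ℕ} (h : Anc r par v y) : sz n r par y ≤ sz n r par v := by
  refine Finset.card_le_card fun x hx => ?_
  rw [mem_subtree] at hx ⊢
  exact ⟨hx.1, h.trans hx.2⟩

omit H in
theorem disjoint_subtree {a b : ℕ} (hab : ¬ Anc r par a b) (hba : ¬ Anc r par b a) :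
    Disjoint (subtree n r par a) (subtree n r par b) := by
  rw [Finset.disjoint_left]
  intro x hx hx'
  rw [mem_subtree] at hx hx'
  rcases hx.2.total hx'.2 with h | h
  · exact hab h
  · exact hba h

theorem not_anc_sibling {a b : ℕ} (hb : b < n) (hbr : b ≠ r) (ha : a < n) (har : a ≠ r)
    (hp : par a = par b) (hab : a ≠ b) : ¬ Anc r par a b := by
  intro h
  rcases H.anc_cases hb h with h1 | h1
  · exact hab h1.symm
  · have h2 := H.dep_par b hb hbr
    have h3 := H.dep_par a ha har
    rw [hp] at h3
    omega

/-- The subtrees of distinct children are disjoint, lie in the subtree of `p` and miss `p` itself.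
Both the nesting of preorder intervals and the uniqueness of the heavy child follow from this count.
-/
theorem sum_children_le (p : ℕ) (hp : p < n) (s : Finset ℕ)
    (hs : ∀ a ∈ s, a < n ∧ a ≠ r ∧ par a = p) :
    1 + ∑ a ∈ s, sz n r par a ≤ sz n r par p := by
  have h1 : (s.biUnion (subtree n r par)).card = ∑ a ∈ s, sz n r par a := by
    refine Finset.card_biUnion fun a ha b hb hab => disjoint_subtree ?_ ?_
    · exact H.not_anc_sibling (hs b hb).1 (hs b hb).2.1 (hs a ha).1 (hs a ha).2.1
        ((hs a ha).2.2.trans (hs b hb).2.2.symm) hab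
    · exact H.not_anc_sibling (hs a ha).1 (hs a ha).2.1 (hs b hb).1 (hs b hb).2.1
        ((hs b hb).2.2.trans (hs a ha).2.2.symm) hab.symm
  have h2 : p ∉ s.biUnion (subtree n r par) := by
    intro h
    obtain ⟨a, ha, h⟩ := Finset.mem_biUnion.1 h
    refine H.not_anc_par (hs a ha).1 (hs a ha).2.1 ?_
    rw [(hs a ha).2.2]
    exact (mem_subtree.1 h).2
  rw [← h1, add_comm, ← Finset.card_insert_of_notMem h2]
  refine Finset.card_le_card fun x hx => ?_
  rcases Finset.mem_insert.1 hx with rfl | hx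
  · exact mem_subtree.2 ⟨hp, anc_refl _⟩
  · obtain ⟨a, ha, h⟩ := Finset.mem_biUnion.1 hx
    rw [mem_subtree] at h ⊢
    refine ⟨h.1, Anc.trans ?_ h.2⟩
    rw [← (hs a ha).2.2]
    exact anc_par (hs a ha).2.1

/-- The parent, the subtrees of the older siblings and the subtree of `v` are disjoint pieces of the
parent's subtree; hence the preorder interval of `v` ends inside that of its parent. -/
theorem preOff_add_le {v : ℕ} (hv : v < n) (hr : v ≠ r) :
    preOff n r par v + sz n r par v ≤ sz n r par (par v) := by
  have := H.sum_children_le (par v) (H.par_lt v hv) (insert v (olderSiblings r par v)) (by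
    intro a ha
    rcases Finset.mem_insert.1 ha with rfl | ha
    · exact ⟨hv, hr, rfl⟩
    · simp only [olderSiblings, Finset.mem_filter, Finset.mem_range] at ha
      exact ⟨ha.1.trans hv, ha.2⟩)
  rw [Finset.sum_insert (by simp [olderSiblings])] at this
  simp only [preOff]
  omega

omit H in
theorem preOff_sibling {u v : ℕ} (huv : u < v) (hu : u ≠ r)
    (hp : par u = par v) : preOff n r par u + sz n r par u ≤ preOff n r par v := by
  have h1 : insert u (olderSiblings r par u) ⊆ olderSiblings r par v := by
    intro a ha
    rcases Finset.mem_insert.1 ha with rfl | ha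
    · simp [olderSiblings, huv, hu, hp]
    · simp only [olderSiblings, Finset.mem_filter, Finset.mem_range] at ha ⊢
      exact ⟨ha.1.trans huv, ha.2.1, ha.2.2.trans hp⟩
  have := Finset.sum_le_sum_of_subset (f := sz n r par) h1
  rw [Finset.sum_insert (by simp [olderSiblings])] at this
  simp only [preOff]
  omega

theorem preNum_r : preNum n r par dep r = 0 := H.climbSum_r _

theorem preNum_par {v : ℕ} (hv : v < n) (hr : v ≠ r) :
    preNum n r par dep v = preOff n r par v + preNum n r par dep (par v) :=
  H.climbSum_par _ hv hr

theorem preNum_anc {v y : ℕ} (hy : y < n) (h : Anc r par v y) :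
    preNum n r par dep v ≤ preNum n r par dep y ∧
      preNum n r par dep y + sz n r par y ≤ preNum n r par dep v + sz n r par v := by
  induction h with
  | refl => exact ⟨le_rfl, le_rfl⟩
  | @tail b c h' h ih =>
    have hb := H.anc_lt h' hy
    have h1 := H.preNum_par hb h.1
    have h2 := H.preOff_add_le hb h.1
    rw [← h.2] at h1 h2
    omega

/-- Replacing the deeper of two incomparable vertices by its parent keeps them incomparable and
enlarges its interval, until they are siblings; there the offsets separate the intervals. The
induction is on the sum of the depths. -/
theorem preNum_disjoint : ∀ k, ∀ v < n, ∀ y < n, dep v + dep y = k → ¬ Anc r par v y →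
    ¬ Anc r par y v → preNum n r par dep v + sz n r par v ≤ preNum n r par dep y ∨
      preNum n r par dep y + sz n r par y ≤ preNum n r par dep v := by
  intro k
  induction k using Nat.strong_induction_on with
  | _ k ih =>
    suffices hw : ∀ v < n, ∀ y < n, dep v + dep y = k → dep y ≤ dep v → ¬ Anc r par v y →
        ¬ Anc r par y v → preNum n r par dep v + sz n r par v ≤ preNum n r par dep y ∨
        preNum n r par dep y + sz n r par y ≤ preNum n r par dep v by
      intro v hv y hy hk h1 h2
      rcases le_total (dep y) (dep v) with h | h
      · exact hw v hv y hy hk h h1 h2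
      · exact (hw y hy v hv (by omega) h h2 h1).symm
    intro v hv y hy hk hle h1 h2
    have hvr : v ≠ r := by rintro rfl; exact h1 (H.anc_r y hy)
    have hyr : y ≠ r := by rintro rfl; exact h2 (H.anc_r v hv)
    have hne : v ≠ y := by rintro rfl; exact h1 (anc_refl _)
    have dv := H.dep_par v hv hvr
    have dy := H.dep_par y hy hyr
    have pv := H.preNum_par hv hvr
    have py := H.preNum_par hy hyr
    by_cases hp : par v = par y
    · rcases lt_or_gt_of_ne hne with h | h
      · have := preOff_sibling (n := n) h hvr hp
        rw [hp] at pv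
        omega
      · have := preOff_sibling (n := n) h hyr hp.symm
        rw [hp] at pv
        omega
    · have h3 : ¬ Anc r par y (par v) := fun h => h2 (anc_of_par hvr h)
      have h4 : ¬ Anc r par (par v) y := by
        intro h
        rcases H.anc_cases hy h with h5 | h5
        · exact h3 (h5 ▸ anc_refl _)
        · obtain h6 := (anc_iff.1 h).resolve_left (by rintro rfl; omega)
          rcases H.anc_cases (H.par_lt y hy) h6.2 with h7 | h7
          · exact hp h7.symm
          · omega
      have := ih (dep (par v) + dep y) (by omega) (par v) (H.par_lt v hv) y hy rfl h4 h3
      have h5 := H.preOff_add_le hv hvr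
      omega

/-- The subtree of `v` is an interval of preorder numbers. -/
theorem anc_iff_preNum {v y : ℕ} (hv : v < n) (hy : y < n) :
    Anc r par v y ↔ preNum n r par dep v ≤ preNum n r par dep y ∧
      preNum n r par dep y < preNum n r par dep v + sz n r par v := by
  have sy := sz_pos (r := r) (par := par) hy
  have sv := sz_pos (r := r) (par := par) hv
  constructor
  · intro h
    have := H.preNum_anc hy h
    omega
  · rintro ⟨h1, h2⟩
    by_contra h
    -- A proper ancestor has a smaller preorder number because every offset is at least `1`;
    -- incomparable vertices have disjoint intervals.
    by_cases h' : Anc r par y v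
    · obtain ⟨a, ha, har, hav⟩ := exists_child h' (by rintro rfl; exact h (anc_refl _))
      have h3 := H.preNum_anc hv hav
      have h4 := H.preNum_par (H.anc_lt hav hv) har
      rw [ha, preOff] at h4
      omega
    · have := H.preNum_disjoint _ v hv y hy rfl h h'
      omega

theorem preNum_lt {v : ℕ} (hv : v < n) : preNum n r par dep v < n := by
  have h1 := H.preNum_anc hv (H.anc_r v hv)
  have h2 := H.preNum_r
  have h3 := sz_le (n := n) (r := r) (par := par) r
  have h4 := sz_pos (r := r) (par := par) hv
  omega

/-- Each step down loses at least one vertex of the current subtree, so the depth plus the size of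
the subtree never exceeds `n`. -/
theorem dep_lt {v : ℕ} (hv : v < n) : dep v < n := by
  suffices h : ∀ v < n, dep v + sz n r par v ≤ n by
    have := h v hv
    have := sz_pos (r := r) (par := par) hv
    omega
  refine H.induct ?_ ?_
  · rw [H.dep_r]; have := sz_le (n := n) (r := r) (par := par) r; omega
  · intro v hv hr ih
    have h1 := H.preOff_add_le hv hr
    have h2 := H.dep_par v hv hr
    simp only [preOff] at h1
    omega

open Classical in
theorem lightCount_par {v : ℕ} (hv : v < n) (hr : v ≠ r) :
    lightCount n r par dep v =
      (if Light n r par v then 1 else 0) + lightCount n r par dep (par v) :=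
  H.climbSum_par _ hv hr

theorem lightCount_anc {v y : ℕ} (hy : y < n) (h : Anc r par v y) :
    lightCount n r par dep v ≤ lightCount n r par dep y := by
  induction h with
  | refl => exact le_rfl
  | @tail b c h' h ih =>
    have hb := H.anc_lt h' hy
    have h1 := H.lightCount_par hb h.1
    rw [← h.2] at h1
    omega

/-- A step to a light child halves the subtree, and any other step does not enlarge it. -/
theorem two_pow_lightCount : ∀ v < n, 2 ^ lightCount n r par dep v * sz n r par v ≤ n := by
  refine H.induct ?_ ?_
  · rw [lightCount, H.climbSum_r]; simpa using sz_le r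
  · intro v hv hr ih
    rw [H.lightCount_par hv hr]
    refine le_trans ?_ ih
    split_ifs with h
    · rw [Light] at h
      rw [pow_add, pow_one, mul_comm 2, mul_assoc]
      exact Nat.mul_le_mul le_rfl h
    · rw [zero_add]
      exact Nat.mul_le_mul le_rfl (sz_anc (anc_par hr))

theorem lightCount_le {v : ℕ} (hv : v < n) : lightCount n r par dep v ≤ Nat.log 2 n := by
  refine Nat.le_log_of_pow_le (by norm_num) ?_
  exact le_trans (Nat.le_mul_of_pos_right _ (sz_pos (r := r) (par := par) hv)) (H.two_pow_lightCount v hv)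

/-- Two siblings with more than half of the parent's subtree each would not fit into it. -/
theorem heavy_unique {a b : ℕ} (ha : a < n) (hb : b < n) (har : a ≠ r) (hbr : b ≠ r)
    (hp : par a = par b) (hla : ¬ Light n r par a) (hlb : ¬ Light n r par b) : a = b := by
  by_contra hab
  have := H.sum_children_le (par b) (H.par_lt b hb) {a, b} (by
    intro x hx
    simp only [Finset.mem_insert, Finset.mem_singleton] at hx
    rcases hx with rfl | rfl
    exacts [⟨ha, har, hp⟩, ⟨hb, hbr, rfl⟩])
  rw [Finset.sum_pair hab] at this
  simp only [Light, hp] at hla hlb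
  omega

end RTree

/-- The small part of the subtree of `par v` after the failure of the parent edge of `v`. -/
def InSmall (n r : ℕ) (par : ℕ → ℕ) (v y : ℕ) : Prop :=
  Light n r par v ∧ Anc r par v y ∨ ¬ Light n r par v ∧ Anc r par (par v) y ∧ ¬ Anc r par v y

open Classical in
/-- The row of the table in which the data about the small part for `v` is stored. -/
noncomputable def rowKey (n r : ℕ) (par dep : ℕ → ℕ) (v : ℕ) : ℕ :=
  2 * lightCount n r par dep v + if Light n r par v then 0 else 1

open Classical in
/-- The small part as a set. -/
noncomputable def smallPart (n r : ℕ) (par : ℕ → ℕ) (v : ℕ) : Finset ℕ :=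
  (Finset.range n).filter (InSmall n r par v)

theorem mem_smallPart {n r : ℕ} {par : ℕ → ℕ} {v y : ℕ} :
    y ∈ smallPart n r par v ↔ y < n ∧ InSmall n r par v y := by simp [smallPart]

/-! ### Keys and total size of the small parts -/

namespace RTree
variable {n r : ℕ} {par dep : ℕ → ℕ} (H : RTree n r par dep)
include H

/-- This is why failures can share table rows. The last bit of the key separates light from heavy
`v`. If `a` and `b` are light ancestors of `y`, the lower one has the larger light count. If both
are heavy, `par a` and `par b` are comparable; on the way from the upper one, say `par a`, towards
`y` the first vertex cannot be `a`, because `y` is not below `a`, so it is light and raises the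
count. -/
theorem rowKey_injOn {y a b : ℕ} (ha : a < n) (hb : b < n) (har : a ≠ r)
    (hbr : b ≠ r) (hya : InSmall n r par a y) (hyb : InSmall n r par b y)
    (hk : rowKey n r par dep a = rowKey n r par dep b) : a = b := by
  unfold rowKey at hk
  rcases hya with ⟨la, h1⟩ | ⟨la, h1, h1'⟩ <;> rcases hyb with ⟨lb, h2⟩ | ⟨lb, h2, h2'⟩
  · simp only [la, lb, if_true] at hk
    by_contra hab
    have key : ∀ a b, a < n → b < n → b ≠ r → a ≠ b → Light n r par b → Anc r par a b →
        lightCount n r par dep a < lightCount n r par dep b := by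
      intro a b ha hb hbr hab lb h
      have h3 := (anc_iff.1 h).resolve_left (fun h => hab h.symm)
      have h4 := H.lightCount_anc (H.par_lt b hb) h3.2
      have h5 := H.lightCount_par hb hbr
      simp only [lb, if_true] at h5
      omega
    rcases h1.total h2 with h | h
    · have := key a b ha hb hbr hab lb h; omega
    · have := key b a hb ha har (Ne.symm hab) la h; omega
  · simp only [la, lb, if_true, if_false] at hk; omega
  · simp only [la, lb, if_true, if_false] at hk; omega
  · simp only [la, lb, if_false] at hk
    by_contra hab
    have key : ∀ a b, a < n → b < n → a ≠ r → b ≠ r → a ≠ b → ¬ Light n r par a →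
        ¬ Light n r par b → Anc r par (par b) y → ¬ Anc r par a y → Anc r par (par a) (par b) →
        lightCount n r par dep a < lightCount n r par dep b := by
      intro a b ha hb har hbr hab la lb h2 h1' h
      by_cases hp : par a = par b
      · exact absurd (H.heavy_unique ha hb har hbr hp la lb) hab
      -- Here `c` is the child of `par a` on the way to `par b`. Were it heavy, it would be `a`, and
      -- then `y` would lie below `a`.
      obtain ⟨c, hc, hcr, hcb⟩ := exists_child h hp
      have hcn := H.anc_lt hcb (H.par_lt b hb)
      have lc : Light n r par c := by
        by_contra lc
        have := H.heavy_unique ha hcn har hcr hc.symm la lc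
        subst this
        exact h1' (hcb.trans h2)
      have e1 := H.lightCount_par ha har
      have e2 := H.lightCount_par hb hbr
      have e3 := H.lightCount_par hcn hcr
      have e4 := H.lightCount_anc (H.par_lt b hb) hcb
      simp only [la, lb, lc, if_true, if_false, hc] at e1 e2 e3
      omega
    rcases h1.total h2 with h | h
    · have := key a b ha hb har hbr hab la lb h2 h1' h; omega
    · have := key b a hb ha hbr har (Ne.symm hab) lb la h1 h2' h; omega

theorem rowKey_lt {v : ℕ} (hv : v < n) : rowKey n r par dep v < 2 * Nat.log 2 n + 2 := by
  have := H.lightCount_le hv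
  unfold rowKey
  split_ifs <;> omega

/-- Half of the key is the light count of a vertex whose subtree contains the small part: `v` itself
if it is light, and `par v` otherwise, whose light count equals that of the heavy vertex `v`. -/
theorem card_smallPart_le {v : ℕ} (hv : v < n) (hr : v ≠ r) :
    (smallPart n r par v).card ≤ n / 2 ^ (rowKey n r par dep v / 2) := by
  rw [Nat.le_div_iff_mul_le (by positivity), mul_comm]
  have e1 := H.lightCount_par hv hr
  by_cases l : Light n r par v
  · have h1 : rowKey n r par dep v / 2 = lightCount n r par dep v := by
      simp only [rowKey, l, if_true]; omega
    have h2 : smallPart n r par v ⊆ subtree n r par v := by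
      intro y hy
      rw [mem_smallPart] at hy
      rw [mem_subtree]
      exact ⟨hy.1, (hy.2.resolve_right fun h => h.1 l).2⟩
    rw [h1]
    exact le_trans (Nat.mul_le_mul le_rfl (Finset.card_le_card h2)) (H.two_pow_lightCount v hv)
  · simp only [l, if_false] at e1
    have h1 : rowKey n r par dep v / 2 = lightCount n r par dep (par v) := by
      simp only [rowKey, l, if_false]; omega
    have h2 : smallPart n r par v ⊆ subtree n r par (par v) := by
      intro y hy
      rw [mem_smallPart] at hy
      rw [mem_subtree]
      exact ⟨hy.1, (hy.2.resolve_left fun h => l h.1).2.1⟩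
    rw [h1]
    exact le_trans (Nat.mul_le_mul le_rfl (Finset.card_le_card h2))
      (H.two_pow_lightCount _ (H.par_lt v hv))

/-- For every vertex, the total size of the small parts that contain it is linear. -/
theorem sum_smallPart_le {y : ℕ} (s : Finset ℕ)
    (hs : ∀ v ∈ s, v < n ∧ v ≠ r ∧ y ∈ smallPart n r par v) :
    ∑ v ∈ s, (smallPart n r par v).card ≤ 4 * n := by
  -- Each exponent belongs to two keys, and a geometric series with ratio one half sums to at most
  -- `2 * n`; this gives the constant `4`.
  have geom : ∀ M : ℕ, ∑ k ∈ Finset.range (2 * M), n / 2 ^ (k / 2) ≤ 4 * n := by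
    intro M
    have h1 : ∑ k ∈ Finset.range (2 * M), n / 2 ^ (k / 2) =
        2 * ∑ j ∈ Finset.range M, n / 2 ^ j := by
      induction M with
      | zero => simp
      | succ M ih =>
        rw [show 2 * (M + 1) = 2 * M + 1 + 1 by ring, Finset.sum_range_succ,
          Finset.sum_range_succ, ih, Finset.sum_range_succ, show 2 * M / 2 = M by omega,
          show (2 * M + 1) / 2 = M by omega]
        ring
    have h2 := Nat.geom_sum_le (le_refl 2) n M
    rw [h1]
    simp only [Nat.add_one_sub_one, Nat.div_one] at h2
    omega
  calc ∑ v ∈ s, (smallPart n r par v).card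
      ≤ ∑ v ∈ s, n / 2 ^ (rowKey n r par dep v / 2) :=
        Finset.sum_le_sum fun v hv => H.card_smallPart_le (hs v hv).1 (hs v hv).2.1
    _ = ∑ k ∈ s.image (rowKey n r par dep), n / 2 ^ (k / 2) := by
        rw [Finset.sum_image]
        intro a ha b hb hab
        have hya := mem_smallPart.1 (hs a ha).2.2
        have hyb := mem_smallPart.1 (hs b hb).2.2
        exact H.rowKey_injOn (hs a ha).1 (hs b hb).1 (hs a ha).2.1 (hs b hb).2.1 hya.2
          hyb.2 hab
    _ ≤ ∑ k ∈ Finset.range (2 * (Nat.log 2 n + 1)), n / 2 ^ (k / 2) := by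
        refine Finset.sum_le_sum_of_subset fun k hk => ?_
        obtain ⟨v, hv, rfl⟩ := Finset.mem_image.1 hk
        have := H.rowKey_lt (hs v hv).1
        rw [Finset.mem_range]
        omega
    _ ≤ 4 * n := geom _

end RTree

/-! ## Approximate distances after a failure -/

/-- `RevWalk E r y l x`: along the arcs `E` there is a walk of weight `x` from `r` to `y` that
visits the vertices of `l`, listed from `y` back to `r`. -/
inductive RevWalk (E : ℕ → ℕ → ℝ → Prop) (r : ℕ) : ℕ → List ℕ → ℝ → Prop
  | nil : RevWalk E r r [r] 0
  | cons {a b : ℕ} {l : List ℕ} {x c : ℝ} : RevWalk E r a l x → E a b c →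
      RevWalk E r b (b :: l) (x + c)

/-- The first `k` vertices on the way from `y` to the root. -/
def climbList (par : ℕ → ℕ) (y k : ℕ) : List ℕ := (List.range k).map fun i => par^[i] y

/-- The vertices are divided into a set around the root (class `0`), which is still reached by the
tree, a small part (class `1`) and a large part (class `2`), which is a subtree with top `τ`. -/
structure Cfg (n r : ℕ) (par dep : ℕ → ℕ) (d : ℕ → ℝ) (E : ℕ → ℕ → ℝ → Prop) (cls : ℕ → ℕ)
    (τ : ℕ) : Prop where
  tree : RTree n r par dep
  nonneg : ∀ a b c, E a b c → 0 ≤ c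
  lt : ∀ a b c, E a b c → a < n ∧ b < n
  symm : ∀ a b c, E a b c → E b a c
  d_r : d r = 0
  d_nonneg : ∀ y < n, 0 ≤ d y
  d_le : ∀ a b c, E a b c → d b ≤ d a + c
  cls_r : cls r = 0
  cls_le : ∀ y < n, cls y ≤ 2
  base : ∀ y < n, cls y = 0 → y ≠ r → cls (par y) = 0 ∧ E (par y) y (d y - d (par y))
  large : ∀ y < n, cls y = 2 → y ≠ τ →
    y ≠ r ∧ cls (par y) = 2 ∧ E (par y) y (d y - d (par y)) ∧ dep τ < dep y

/-- The trace of a path query, from `y` back to the root. Here `sp` holds the parents in the small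
part, shifted by one, and the large part is entered by the arc from `z` to `xs - 1`. -/
inductive Trace (par dep cls : ℕ → ℕ) (τ : ℕ) (sp : ℕ → ℕ) (xs z : ℕ) : ℕ → List ℕ → Prop
  | base {y : ℕ} : cls y = 0 → Trace par dep cls τ sp xs z y (climbList par y (dep y + 1))
  | small {y : ℕ} {l : List ℕ} : cls y = 1 → sp y ≠ 0 →
      Trace par dep cls τ sp xs z (sp y - 1) l → Trace par dep cls τ sp xs z y (y :: l)
  | large {y : ℕ} {l : List ℕ} : cls y = 2 → xs ≠ 0 → Trace par dep cls τ sp xs z z l →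
      Trace par dep cls τ sp xs z y (climbList par y (dep y - dep τ + 1) ++
        ((climbList par (xs - 1) (dep (xs - 1) - dep τ)).reverse ++ l))

/-- The vertex has got a value. -/
def Settled (cls sp : ℕ → ℕ) (xs y : ℕ) : Prop :=
  cls y = 0 ∨ cls y = 1 ∧ sp y ≠ 0 ∨ cls y = 2 ∧ xs ≠ 0

/-- The value of a settled vertex. -/
noncomputable def settledVal (d : ℕ → ℝ) (cls : ℕ → ℕ) (τ : ℕ) (sv : ℕ → ℝ) (xs : ℕ) (lam : ℝ)
    (y : ℕ) : ℝ :=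
  if cls y = 0 then d y else if cls y = 1 then sv y else
    lam + (d (xs - 1) - d τ) + (d y - d τ)

/-- The invariant of the construction. -/
structure CfgInv (n r : ℕ) (par dep : ℕ → ℕ) (d : ℕ → ℝ) (E : ℕ → ℕ → ℝ → Prop) (cls : ℕ → ℕ)
    (τ : ℕ) (sp : ℕ → ℕ) (sv : ℕ → ℝ) (xs z : ℕ) (lam : ℝ) : Prop where
  walk : ∀ y < n, Settled cls sp xs y →
    ∃ l, Trace par dep cls τ sp xs z y l ∧ RevWalk E r y l (settledVal d cls τ sv xs lam y)
  approx : ∀ y < n, Settled cls sp xs y → ∀ l x, RevWalk E r y l x →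
    settledVal d cls τ sv xs lam y ≤ (if xs = 0 then 1 else 3) * x
  sp_lt : ∀ y < n, cls y = 1 → sp y ≤ n
  xs_lt : xs ≤ n
  z_lt : xs ≠ 0 → z < n

/-! ### The settling process and its invariant -/

theorem climbList_succ (par : ℕ → ℕ) (y k : ℕ) :
    climbList par y (k + 1) = y :: climbList par (par y) k := by
  simp [climbList, List.range_succ_eq_map, Function.comp_def]

theorem climbList_succ' (par : ℕ → ℕ) (y k : ℕ) :
    climbList par y (k + 1) = climbList par y k ++ [par^[k] y] := by
  simp [climbList, List.range_succ]

@[simp] theorem climbList_zero (par : ℕ → ℕ) (y : ℕ) : climbList par y 0 = [] := rfl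

@[simp] theorem climbList_length (par : ℕ → ℕ) (y k : ℕ) : (climbList par y k).length = k := by
  simp [climbList]

theorem RevWalk.cons_eq {E : ℕ → ℕ → ℝ → Prop} {r a b : ℕ} {l : List ℕ} {x c x' : ℝ}
    (h : RevWalk E r a l x) (hE : E a b c) (hx : x' = x + c) : RevWalk E r b (b :: l) x' :=
  hx ▸ h.cons hE

/-- Predecessors and the entry arc are written once and never changed, so traces found earlier
survive later steps. -/
theorem Trace.mono {par dep cls : ℕ → ℕ} {τ : ℕ} {sp sp' : ℕ → ℕ} {xs z xs' z' y : ℕ}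
    {l : List ℕ} (h : Trace par dep cls τ sp xs z y l)
    (hsp : ∀ y, cls y = 1 → sp y ≠ 0 → sp' y = sp y) (hxs : xs ≠ 0 → xs' = xs ∧ z' = z) :
    Trace par dep cls τ sp' xs' z' y l := by
  induction h with
  | base h => exact .base h
  | small h h' _ ih =>
    have := hsp _ h h'
    exact .small h (by rwa [this]) (by rwa [this])
  | large h h' _ ih =>
    obtain ⟨rfl, rfl⟩ := hxs h'
    exact .large h h' ih

namespace Cfg
variable {n r : ℕ} {par dep : ℕ → ℕ} {d : ℕ → ℝ} {E : ℕ → ℕ → ℝ → Prop} {cls : ℕ → ℕ} {τ : ℕ}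
  (C : Cfg n r par dep d E cls τ)
include C

theorem revWalk_nonneg {y : ℕ} {l : List ℕ} {x : ℝ} (h : RevWalk E r y l x) : 0 ≤ x := by
  induction h with
  | nil => exact le_rfl
  | cons _ hE ih => exact add_nonneg ih (C.nonneg _ _ _ hE)

/-- The function `d` grows by at most the weight along every arc, hence it is a lower bound for all
walks from the root, also after the failure. -/
theorem le_revWalk {y : ℕ} {l : List ℕ} {x : ℝ} (h : RevWalk E r y l x) : d y ≤ x := by
  induction h with
  | nil => exact C.d_r.le
  | cons _ hE ih => exact (C.d_le _ _ _ hE).trans (by linarith)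

theorem revWalk_base : ∀ y < n, cls y = 0 → RevWalk E r y (climbList par y (dep y + 1)) (d y) := by
  refine C.tree.induct ?_ ?_
  · intro _
    rw [C.tree.dep_r, C.d_r]
    exact .nil
  · intro v hv hr ih hc
    obtain ⟨h1, h2⟩ := C.base v hv hc hr
    rw [climbList_succ, C.tree.dep_par v hv hr]
    exact (ih h1).cons_eq h2 (by ring)

/-- All tree edges inside the large part survive, so a walk that has reached the top extends to
every vertex of the part along the tree. -/
theorem revWalk_down {x : ℝ} {l : List ℕ} (h : RevWalk E r τ (τ :: l) x) :
    ∀ k, ∀ y < n, cls y = 2 → dep y - dep τ = k →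
      RevWalk E r y (climbList par y (k + 1) ++ l) (x + (d y - d τ)) := by
  intro k
  induction k with
  | zero =>
    intro y hy hc hk
    by_cases hyt : y = τ
    · subst hyt; simpa [climbList] using h
    · have := (C.large y hy hc hyt).2.2.2; omega
  | succ k ih =>
    intro y hy hc hk
    have hyt : y ≠ τ := by rintro rfl; omega
    obtain ⟨h1, h2, h3, h4⟩ := C.large y hy hc hyt
    have h5 := C.tree.dep_par y hy h1
    rw [climbList_succ]
    exact (ih (par y) (C.tree.par_lt y hy) h2 (by omega)).cons_eq h3 (by ring)

theorem large_iterate {y : ℕ} (hy : y < n) (hc : cls y = 2) : ∀ k ≤ dep y - dep τ,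
    par^[k] y < n ∧ cls (par^[k] y) = 2 ∧ dep (par^[k] y) = dep y - k := by
  intro k
  induction k with
  | zero => intro _; exact ⟨hy, hc, rfl⟩
  | succ k ih =>
    intro hk
    obtain ⟨h1, h2, h3⟩ := ih (by omega)
    rw [Function.iterate_succ_apply']
    have hyt : par^[k] y ≠ τ := by intro h; rw [h] at h3; omega
    obtain ⟨h4, h5, h6, h7⟩ := C.large _ h1 h2 hyt
    have h8 := C.tree.dep_par _ h1 h4
    exact ⟨C.tree.par_lt _ h1, h5, by omega⟩

theorem top_iterate {y : ℕ} (hy : y < n) (hc : cls y = 2) : par^[dep y - dep τ] y = τ := by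
  obtain ⟨h1, h2, h3⟩ := C.large_iterate hy hc _ le_rfl
  by_contra h
  have := (C.large _ h1 h2 h).2.2.2
  omega

/-- The counterpart of `revWalk_down`: from the entry vertex the walk goes up to the top along
reversed tree arcs. Here the graph has to be undirected. -/
theorem revWalk_up {y : ℕ} (hy : y < n) (hc : cls y = 2) {x : ℝ} {l : List ℕ}
    (h : RevWalk E r y (y :: l) x) : ∀ k ≤ dep y - dep τ,
      RevWalk E r (par^[k] y) (par^[k] y :: ((climbList par y k).reverse ++ l))
        (x + (d y - d (par^[k] y))) := by
  intro k
  induction k with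
  | zero => intro _; simpa using h
  | succ k ih =>
    intro hk
    obtain ⟨h1, h2, h3⟩ := C.large_iterate hy hc k (by omega)
    have hyt : par^[k] y ≠ τ := by intro h; rw [h] at h3; omega
    obtain ⟨h4, h5, h6, h7⟩ := C.large _ h1 h2 hyt
    rw [Function.iterate_succ_apply', climbList_succ']
    simpa using (ih (by omega)).cons_eq (C.symm _ _ _ h6)
      (show x + (d y - d (par (par^[k] y))) = _ by ring)

/-- A lower bound for the distances of all vertices that have no value yet. -/
theorem le_of_crossing {P : ℕ → Prop} {val : ℕ → ℝ} {κ θ : ℝ} (hθ : 1 ≤ θ) (hr : P r)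
    (hval : ∀ y < n, P y → ∀ l x, RevWalk E r y l x → val y ≤ θ * x)
    (hκ : ∀ a b c, E a b c → P a → ¬ P b → κ ≤ val a + c) {y : ℕ} {l : List ℕ} {x : ℝ}
    (h : RevWalk E r y l x) : ¬ P y → κ ≤ θ * x := by
  induction h with
  | nil => exact fun h => absurd hr h
  | @cons a b l x c h hE ih =>
    intro hb
    have hc := C.nonneg _ _ _ hE
    -- Either the last arc leaves the settled set, and `κ ≤ val a + c ≤ θ * x + c ≤ θ * (x + c)`
    -- since `1 ≤ θ`, or the shorter walk already ends at an unsettled vertex.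
    by_cases ha : P a
    · have h1 := hκ a b c hE ha hb
      have h2 := hval a (C.lt _ _ _ hE).1 ha l x h
      nlinarith
    · have := ih ha
      nlinarith

/-- Initially just the part of the root is settled. There the tree paths survive and are optimal,
since `d` bounds every walk from below. -/
theorem init {sp : ℕ → ℕ} {sv : ℕ → ℝ} {z : ℕ} {lam : ℝ} (hsp : ∀ y < n, cls y = 1 → sp y = 0) :
    CfgInv n r par dep d E cls τ sp sv 0 z lam := by
  have key : ∀ y < n, Settled cls sp 0 y → cls y = 0 := by
    rintro y hy (h | ⟨h, h'⟩ | ⟨h, h'⟩)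
    · exact h
    · exact absurd (hsp y hy h) h'
    · exact absurd rfl h'
  refine ⟨fun y hy h => ?_, fun y hy h l x hx => ?_, fun y hy h => ?_, by omega,
    fun h => absurd rfl h⟩
  · have hc := key y hy h
    refine ⟨_, .base hc, ?_⟩
    rw [settledVal, if_pos hc]
    exact C.revWalk_base y hy hc
  · rw [settledVal, if_pos (key y hy h)]
    simpa using C.le_revWalk hx
  · rw [hsp y hy h]; omega

/-- The step of Dijkstra's algorithm: every walk to `b` leaves the settled set on some arc, and the
chosen arc is at least as good as that one. The current factor, `1` or `3`, carries over from the
settled vertices to `b`. -/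
theorem settle_small {sp : ℕ → ℕ} {sv : ℕ → ℝ} {xs z : ℕ} {lam : ℝ}
    (I : CfgInv n r par dep d E cls τ sp sv xs z lam) {a b : ℕ} {c : ℝ} (hE : E a b c)
    (ha : Settled cls sp xs a) (hb : ¬ Settled cls sp xs b) (hcb : cls b = 1)
    (hmin : ∀ a' b' c', E a' b' c' → Settled cls sp xs a' → ¬ Settled cls sp xs b' →
      settledVal d cls τ sv xs lam a + c ≤ settledVal d cls τ sv xs lam a' + c') :
    CfgInv n r par dep d E cls τ (Function.update sp b (a + 1))
      (Function.update sv b (settledVal d cls τ sv xs lam a + c)) xs z lam := by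
  obtain ⟨han, hbn⟩ := C.lt _ _ _ hE
  set κ := settledVal d cls τ sv xs lam a + c with hκ
  have hspb : sp b = 0 := by
    by_contra h
    exact hb (.inr (.inl ⟨hcb, h⟩))
  have hold : ∀ y, y ≠ b → (Settled cls (Function.update sp b (a + 1)) xs y ↔
      Settled cls sp xs y) := by
    intro y hy
    simp [Settled, hy]
  have hval : ∀ y, y ≠ b → settledVal d cls τ (Function.update sv b κ) xs lam y =
      settledVal d cls τ sv xs lam y := by
    intro y hy
    simp [settledVal, hy]
  have hvb : settledVal d cls τ (Function.update sv b κ) xs lam b = κ := by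
    simp [settledVal, hcb]
  have hmono : ∀ y l, Trace par dep cls τ sp xs z y l →
      Trace par dep cls τ (Function.update sp b (a + 1)) xs z y l := by
    intro y l h
    refine h.mono (fun y hy hy' => ?_) fun _ => ⟨rfl, rfl⟩
    rw [Function.update_of_ne]
    -- The cell of `b` was empty, so no earlier trace passes through it.
    rintro rfl
    exact hy' hspb
  refine ⟨fun y hy h => ?_, fun y hy h l x hx => ?_, fun y hy h => ?_, I.xs_lt, I.z_lt⟩
  · by_cases hyb : y = b
    · subst hyb
      obtain ⟨l, h1, h2⟩ := I.walk a han ha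
      refine ⟨y :: l, .small hcb (by simp) (by simpa using hmono _ _ h1), ?_⟩
      rw [hvb]
      exact h2.cons hE
    · obtain ⟨l, h1, h2⟩ := I.walk y hy ((hold y hyb).1 h)
      exact ⟨l, hmono _ _ h1, by rwa [hval y hyb]⟩
  · by_cases hyb : y = b
    · subst hyb
      rw [hvb]
      exact C.le_of_crossing (by split_ifs <;> norm_num) (.inl C.cls_r) I.approx hmin hx hb
    · rw [hval y hyb]
      exact I.approx y hy ((hold y hyb).1 h) l x hx
  · by_cases hyb : y = b
    · subst hyb; simpa using han
    · simpa [hyb] using I.sp_lt y hy h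

/-- As long as the large part is unsettled, all values are exact. Hence the new value `κ` of the
entry vertex `b` is a lower bound for the distances of all vertices of the large part. This is the
only place where the factor rises from `1` to `3`. -/
theorem settle_large {sp : ℕ → ℕ} {sv : ℕ → ℝ} {xs z : ℕ} {lam : ℝ} (hτ : τ < n)
    (I : CfgInv n r par dep d E cls τ sp sv xs z lam) {a b : ℕ} {c : ℝ} (hE : E a b c)
    (ha : Settled cls sp xs a) (hb : ¬ Settled cls sp xs b) (hcb : cls b = 2)
    (hmin : ∀ a' b' c', E a' b' c' → Settled cls sp xs a' → ¬ Settled cls sp xs b' →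
      settledVal d cls τ sv xs lam a + c ≤ settledVal d cls τ sv xs lam a' + c') :
    CfgInv n r par dep d E cls τ sp sv (b + 1) a (settledVal d cls τ sv xs lam a + c) := by
  obtain ⟨han, hbn⟩ := C.lt _ _ _ hE
  set κ := settledVal d cls τ sv xs lam a + c with hκ
  obtain rfl : xs = 0 := by
    by_contra h
    exact hb (.inr (.inr ⟨hcb, h⟩))
  have hold : ∀ y, cls y ≠ 2 → (Settled cls sp (b + 1) y ↔ Settled cls sp 0 y) := by
    intro y hy
    simp [Settled, hy]
  have hval : ∀ y, cls y ≤ 2 → cls y ≠ 2 → settledVal d cls τ sv (b + 1) κ y =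
      settledVal d cls τ sv 0 lam y := by
    intro y hy hy'
    rcases (by omega : cls y = 0 ∨ cls y = 1) with h | h <;> simp [settledVal, h]
  have hv2 : ∀ y, cls y = 2 →
      settledVal d cls τ sv (b + 1) κ y = κ + (d b - d τ) + (d y - d τ) := by
    intro y hy
    simp [settledVal, hy]
  have hmono : ∀ y l, Trace par dep cls τ sp 0 z y l →
      Trace par dep cls τ sp (b + 1) a y l := fun y l h =>
    h.mono (fun _ _ _ => rfl) fun h => absurd rfl h
  obtain ⟨la, ta, wa⟩ := I.walk a han ha
  have wb := wa.cons hE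
  refine ⟨fun y hy h => ?_, fun y hy h l x hx => ?_, I.sp_lt, by omega, fun _ => han⟩
  · by_cases hy2 : cls y = 2
    -- The recorded walk goes from the entry `b` up to the top and from there down to `y`; it may
    -- use the common edges twice.
    · refine ⟨_, .large hy2 (by omega) (hmono _ _ ta), ?_⟩
      have h1 := C.revWalk_up hbn hcb wb _ le_rfl
      rw [C.top_iterate hbn hcb] at h1
      rw [hv2 y hy2, Nat.add_sub_cancel]
      exact C.revWalk_down h1 _ y hy hy2 rfl
    · obtain ⟨l, h1, h2⟩ := I.walk y hy ((hold y hy2).1 h)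
      exact ⟨l, hmono _ _ h1, by rwa [hval y (C.cls_le y hy) hy2]⟩
  · simp only [Nat.add_eq_zero_iff, one_ne_zero, and_false, if_false]
    have h0 := C.revWalk_nonneg hx
    by_cases hy2 : cls y = 2
    · have hyn : ¬ Settled cls sp 0 y := by simp [Settled, hy2]
      -- With `x` the length of any walk to `y`: `κ ≤ x`, `d b ≤ κ` and `d y ≤ x`, and `d τ` is
      -- nonnegative, so the value is at most `3 * x`.
      have h1 := C.le_of_crossing (by norm_num) (.inl C.cls_r) I.approx hmin hx hyn
      have h2 := C.le_revWalk wb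
      have h3 := C.le_revWalk hx
      have h4 := C.d_nonneg τ hτ
      rw [hv2 y hy2]
      simp only [if_true, one_mul] at h1
      linarith
    · rw [hval y (C.cls_le y hy) hy2]
      have := I.approx y hy ((hold y hy2).1 h) l x hx
      simp only [if_true, one_mul] at this
      linarith

omit C in
/-- Without crossing arcs all other vertices are unreachable. -/
theorem unreachable {P : ℕ → Prop} (hr : P r) (hP : ∀ a b c, E a b c → P a → P b) {y : ℕ}
    {l : List ℕ} {x : ℝ} (h : RevWalk E r y l x) : P y := by
  induction h with
  | nil => exact hr
  | cons _ hE ih => exact hP _ _ _ hE ih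

end Cfg

/-! ### The parts of the tree after a failure -/

/-- A network with `M` arcs (both orientations of every edge) and a shortest-path tree; `pw v` is
the weight of the parent edge of `v`. -/
structure Net (n M r : ℕ) (par dep : ℕ → ℕ) (pw : ℕ → ℝ) (aS aD : ℕ → ℕ) (aW : ℕ → ℝ) : Prop where
  tree : RTree n r par dep
  src_lt : ∀ q < M, aS q < n
  dst_lt : ∀ q < M, aD q < n
  nonneg : ∀ q < M, 0 ≤ aW q
  symm : ∀ q < M, ∃ q' < M, aS q' = aD q ∧ aD q' = aS q ∧ aW q' = aW q
  parArc : ∀ v < n, v ≠ r → ∃ q < M, aS q = par v ∧ aD q = v ∧ aW q = pw v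
  parWt : ∀ q < M, aD q ≠ r → aS q = par (aD q) → aW q = pw (aD q)
  short : ∀ q < M, climbSum par dep pw (aD q) ≤ climbSum par dep pw (aS q) + aW q

/-- The lower endpoint of a tree edge, and `n` for other edges. -/
def arcChild (n r : ℕ) (par : ℕ → ℕ) (a b : ℕ) : ℕ :=
  if b ≠ r ∧ par b = a then b else if a ≠ r ∧ par a = b then a else n

/-- The arcs that survive the failure of the parent edges of `v₁` and `v₂`. -/
def LiveArc (n M r : ℕ) (par : ℕ → ℕ) (aS aD : ℕ → ℕ) (aW : ℕ → ℝ) (v₁ v₂ : ℕ) (a b : ℕ) (c : ℝ) :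
    Prop :=
  ∃ q < M, aS q = a ∧ aD q = b ∧ aW q = c ∧ arcChild n r par a b ≠ v₁ ∧ arcChild n r par a b ≠ v₂

/-- The parent edges of `v₁` and `v₂` form a path failure; `n + 1` stands for no edge. -/
def ValidPair (n r : ℕ) (par : ℕ → ℕ) (v₁ v₂ : ℕ) : Prop :=
  v₁ = n + 1 ∧ v₂ = n + 1 ∨
    v₁ < n ∧ v₂ < n ∧ v₁ ≠ r ∧ v₂ ≠ r ∧ (v₁ = v₂ ∨ v₁ = par v₂)

/-- The subtree of `v₂` is the small part. -/
def LowSmall (n r : ℕ) (par : ℕ → ℕ) (v₁ v₂ : ℕ) : Prop := 2 * sz n r par v₂ ≤ sz n r par v₁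

open Classical in
/-- The class of a vertex. -/
noncomputable def cfgCls (n r : ℕ) (par : ℕ → ℕ) (v₁ v₂ y : ℕ) : ℕ :=
  if Anc r par v₁ y then if Anc r par v₂ y ↔ LowSmall n r par v₁ v₂ then 1 else 2 else 0

open Classical in
/-- The top of the large part. -/
noncomputable def cfgTop (n r : ℕ) (par : ℕ → ℕ) (v₁ v₂ : ℕ) : ℕ :=
  if LowSmall n r par v₁ v₂ then v₁ else v₂

theorem cfgCls_eq_zero {n r : ℕ} {par : ℕ → ℕ} {v₁ v₂ y : ℕ} :
    cfgCls n r par v₁ v₂ y = 0 ↔ ¬ Anc r par v₁ y := by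
  unfold cfgCls; split_ifs <;> simp [*]

theorem cfgCls_eq_one {n r : ℕ} {par : ℕ → ℕ} {v₁ v₂ y : ℕ} :
    cfgCls n r par v₁ v₂ y = 1 ↔ Anc r par v₁ y ∧ (Anc r par v₂ y ↔ LowSmall n r par v₁ v₂) := by
  unfold cfgCls; split_ifs <;> simp [*]

theorem cfgCls_eq_two {n r : ℕ} {par : ℕ → ℕ} {v₁ v₂ y : ℕ} :
    cfgCls n r par v₁ v₂ y = 2 ↔
      Anc r par v₁ y ∧ ¬ (Anc r par v₂ y ↔ LowSmall n r par v₁ v₂) := by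
  unfold cfgCls; split_ifs <;> simp [*]

/-- Two vertices cannot be parents of each other, since depths differ by one; therefore both
orientations of an edge fail together. -/
theorem arcChild_comm {n r : ℕ} {par dep : ℕ → ℕ} (H : RTree n r par dep) {a b : ℕ} (ha : a < n)
    (hb : b < n) : arcChild n r par a b = arcChild n r par b a := by
  unfold arcChild
  split_ifs with h1 h2 h2
  · have e1 := H.dep_par b hb h1.1
    have e2 := H.dep_par a ha h2.1
    rw [h1.2] at e1
    rw [h2.2] at e2
    omega
  all_goals rfl

theorem ValidPair.anc {n r : ℕ} {par : ℕ → ℕ} {v₁ v₂ : ℕ} (h : ValidPair n r par v₁ v₂) :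
    Anc r par v₁ v₂ := by
  rcases h with ⟨rfl, rfl⟩ | ⟨-, -, -, h2, rfl | rfl⟩
  · exact anc_refl _
  · exact anc_refl _
  · exact anc_par h2

namespace Net
variable {n M r : ℕ} {par dep : ℕ → ℕ} {pw : ℕ → ℝ} {aS aD : ℕ → ℕ} {aW : ℕ → ℝ}
  (N : Net n M r par dep pw aS aD aW)
include N

theorem pw_nonneg {v : ℕ} (hv : v < n) (hr : v ≠ r) : 0 ≤ pw v := by
  obtain ⟨q, hq, -, -, h⟩ := N.parArc v hv hr
  exact h ▸ N.nonneg q hq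

theorem dist_nonneg : ∀ v < n, 0 ≤ climbSum par dep pw v := by
  refine N.tree.induct ?_ fun v hv hr ih => ?_
  · rw [N.tree.climbSum_r]
  · rw [N.tree.climbSum_par _ hv hr]
    exact add_nonneg (N.pw_nonneg hv hr) ih

theorem liveArc_par {v₁ v₂ v : ℕ} (hv : v < n) (hr : v ≠ r) (h₁ : v ≠ v₁) (h₂ : v ≠ v₂) :
    LiveArc n M r par aS aD aW v₁ v₂ (par v) v
      (climbSum par dep pw v - climbSum par dep pw (par v)) := by
  obtain ⟨q, hq, h3, h4, h5⟩ := N.parArc v hv hr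
  refine ⟨q, hq, h3, h4, ?_, ?_⟩
  · rw [N.tree.climbSum_par _ hv hr, h5]; ring
  · simp [arcChild, hr, h₁, h₂]

/-- A tree edge is lost exactly at `v₁` and `v₂`. In the part of the root neither is present. In the
large part one of them may be its top, which is exempt, and the other lies outside. So every other
vertex keeps its parent edge and its parent is in the same part. -/
theorem cfg {v₁ v₂ : ℕ} (hV : ValidPair n r par v₁ v₂) :
    Cfg n r par dep (climbSum par dep pw) (LiveArc n M r par aS aD aW v₁ v₂)
      (cfgCls n r par v₁ v₂) (cfgTop n r par v₁ v₂) := by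
  have hanc := hV.anc
  refine ⟨N.tree, ?_, ?_, ?_, N.tree.climbSum_r _, N.dist_nonneg, ?_, ?_, ?_, ?_, ?_⟩
  · rintro a b c ⟨q, hq, -, -, rfl, -⟩
    exact N.nonneg q hq
  · rintro a b c ⟨q, hq, rfl, rfl, -⟩
    exact ⟨N.src_lt q hq, N.dst_lt q hq⟩
  · rintro a b c ⟨q, hq, rfl, rfl, rfl, h⟩
    obtain ⟨q', hq', h1, h2, h3⟩ := N.symm q hq
    rw [arcChild_comm N.tree (N.src_lt q hq) (N.dst_lt q hq)] at h
    exact ⟨q', hq', h1, h2, h3, h⟩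
  · rintro a b c ⟨q, hq, rfl, rfl, rfl, -⟩
    exact N.short q hq
  · rw [cfgCls_eq_zero]
    intro h
    -- For the empty failure `v₁ = n + 1` is not a vertex and hence no ancestor of one.
    rcases hV with ⟨rfl, rfl⟩ | ⟨h1, -, h2, -⟩
    · have := N.tree.anc_lt h N.tree.r_lt; omega
    · exact h2 (N.tree.anc_antisymm N.tree.r_lt h (N.tree.anc_r _ h1))
  · intro y _
    unfold cfgCls
    split_ifs <;> omega
  · intro y hy h hr
    rw [cfgCls_eq_zero] at h ⊢
    refine ⟨fun h' => h (anc_of_par hr h'), N.liveArc_par hy hr ?_ ?_⟩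
    · rintro rfl; exact h (anc_refl _)
    · rintro rfl; exact h hanc
  · intro y hy h ht
    rw [cfgCls_eq_two] at h ⊢
    by_cases hl : LowSmall n r par v₁ v₂
    · simp only [cfgTop, hl, if_true, iff_true] at h ht ⊢
      obtain ⟨h1, h2⟩ := (anc_iff.1 h.1).resolve_left ht
      refine ⟨h1, ⟨h2, fun h' => h.2 (anc_of_par h1 h')⟩, N.liveArc_par hy h1 ht ?_, ?_⟩
      · rintro rfl; exact h.2 (anc_refl _)
      · exact (N.tree.anc_cases hy h.1).resolve_left ht
    · simp only [cfgTop, hl, if_false, iff_false, not_not] at h ht ⊢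
      obtain ⟨h1, h2⟩ := (anc_iff.1 h.2).resolve_left ht
      refine ⟨h1, ⟨hanc.trans h2, h2⟩, N.liveArc_par hy h1 ?_ ht, ?_⟩
      · rintro rfl
        exact ht (N.tree.anc_antisymm (N.tree.anc_lt h.2 hy) hanc h.2)
      · exact (N.tree.anc_cases hy h.2).resolve_left ht

end Net

/-! ## From graphs to networks -/

/-- The depth of a vertex. -/
noncomputable def depN {n : ℕ} (T : SimpleGraph (Fin n)) (r : Fin n) (v : ℕ) : ℕ :=
  if h : v < n then T.dist r ⟨v, h⟩ else 0

/-- The weight of the parent edge of a vertex. -/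
noncomputable def pwN {n : ℕ} (w : Sym2 (Fin n) → ℝ≥0) (par : Fin n → Fin n) (v : ℕ) : ℝ :=
  if h : v < n then w s(par ⟨v, h⟩, ⟨v, h⟩) else 0

/-- The two orientations of the edges: first all edges in their given orientation, then all in the
other one. -/
def twoWay {α : Type*} (m : ℕ) (f g : ℕ → α) (q : ℕ) : α := if q < m then f q else g (q - m)

/-! ### Parent maps and distances in trees -/

namespace SimpleGraph
variable {V : Type*} {G T : SimpleGraph V}

theorem Walk.weight_concat (w : Sym2 V → ℝ≥0) {u v x : V} (p : G.Walk u v) (h : G.Adj v x) :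
    (p.concat h).weight w = p.weight w + w s(v, x) := by
  simp [Walk.weight, Walk.edges_concat]

/-- Shortest walks to `a` and `a'`, extended to `b`, are both shortest and hence paths. Paths in a
tree are unique, so their penultimate vertices agree. -/
theorem IsTree.parent_unique (hT : T.IsTree) {r a a' b : V} (h : T.Adj a b) (h' : T.Adj a' b)
    (hd : T.dist r b = T.dist r a + 1) (hd' : T.dist r b = T.dist r a' + 1) : a = a' := by
  obtain ⟨p, -, hp⟩ := (hT.connected r a).exists_path_of_dist
  obtain ⟨p', -, hp'⟩ := (hT.connected r a').exists_path_of_dist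
  have h1 := (p.concat h).isPath_of_length_eq_dist (by rw [Walk.length_concat]; omega)
  have h2 := (p'.concat h').isPath_of_length_eq_dist (by rw [Walk.length_concat]; omega)
  have h3 := (hT.isAcyclic.subsingleton_path _ _).elim ⟨_, h1⟩ ⟨_, h2⟩
  have h4 := congrArg (fun q : T.Path r b => (q : T.Walk r b).penultimate) h3
  simpa using h4

theorem IsTree.length_eq_dist (hT : T.IsTree) {u v : V} {p : T.Walk u v} (hp : p.IsPath) :
    p.length = T.dist u v := by
  obtain ⟨q, hq, hq'⟩ := (hT.connected u v).exists_path_of_dist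
  have := (hT.isAcyclic.subsingleton_path _ _).elim (⟨p, hp⟩ : T.Path u v) ⟨q, hq⟩
  rw [← hq', show p = q from congrArg Subtype.val this]

end SimpleGraph

open SimpleGraph

section ParentMap
variable {n : ℕ} {T : SimpleGraph (Fin n)} {r : Fin n} {par : Fin n → Fin n}

theorem depN_coe (v : Fin n) : depN T r v = T.dist r v := by simp [depN]

theorem IsParentMap.eq_par (hT : T.IsTree) (hp : IsParentMap T r par) {a b : Fin n}
    (h : T.Adj a b) (hd : T.dist r b = T.dist r a + 1) : b ≠ r ∧ par b = a := by
  have hb : b ≠ r := by rintro rfl; simp at hd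
  exact ⟨hb, hT.parent_unique (hp b hb).1.symm h (hp b hb).2 hd⟩

theorem IsParentMap.adj_cases (hT : T.IsTree) (hp : IsParentMap T r par) {a b : Fin n}
    (h : T.Adj a b) : b ≠ r ∧ par b = a ∨ a ≠ r ∧ par a = b := by
  rcases hT.dist_eq_dist_add_one_of_adj r h with hd | hd
  · exact .inr (hp.eq_par hT h.symm hd)
  · exact .inl (hp.eq_par hT h hd)

theorem IsParentMap.rTree (hp : IsParentMap T r par) {p : ℕ → ℕ}
    (hpar : ∀ v : Fin n, p v = par v) : RTree n r p (depN T r) := by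
  refine ⟨r.2, fun v hv => ?_, by simp [depN_coe], fun v hv hr => ?_⟩
  · rw [hpar ⟨v, hv⟩]; exact (par ⟨v, hv⟩).2
  · have h1 := (hp ⟨v, hv⟩ (fun h => hr (by rw [← h]))).2
    rw [hpar ⟨v, hv⟩, depN_coe, ← h1, ← depN_coe]

variable {w : Sym2 (Fin n) → ℝ≥0}

theorem pwN_coe (v : Fin n) : pwN w par v = w s(par v, v) := by simp [pwN]

/-- Every tree distance is realized in the tree. -/
theorem IsParentMap.exists_walk (hp : IsParentMap T r par) {p : ℕ → ℕ}
    (hpar : ∀ v : Fin n, p v = par v) : ∀ v (hv : v < n),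
    ∃ q : T.Walk r ⟨v, hv⟩, (q.weight w : ℝ) = climbSum p (depN T r) (pwN w par) v := by
  have H := hp.rTree hpar
  refine H.induct (P := fun v => ∀ hv : v < n, ∃ q : T.Walk r ⟨v, hv⟩,
    (q.weight w : ℝ) = climbSum p (depN T r) (pwN w par) v) ?_ ?_ |> fun h v hv => h v hv hv
  · intro _
    exact ⟨.nil, by simp [Walk.weight, H.climbSum_r]⟩
  · intro v hv hr ih _
    have hpv := hpar ⟨v, hv⟩
    simp only at hpv
    rw [hpv] at ih
    obtain ⟨q, hq⟩ := ih (par ⟨v, hv⟩).2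
    have hadj := (hp ⟨v, hv⟩ (fun h => hr (by rw [← h]))).1.symm
    refine ⟨q.concat hadj, ?_⟩
    have hw := pwN_coe (w := w) (par := par) ⟨v, hv⟩
    simp only at hw
    rw [Walk.weight_concat, H.climbSum_par _ hv hr, NNReal.coe_add, hq, hpv, hw, add_comm]

/-- Across a tree edge the climbing sum grows by at most the weight of the edge: it grows by exactly
that going down, and does not grow going up. Together with `IsParentMap.exists_walk` this identifies
the climbing sum with the distance in the tree. -/
theorem IsParentMap.le_walk (hT : T.IsTree) (hp : IsParentMap T r par) {p : ℕ → ℕ}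
    (hpar : ∀ v : Fin n, p v = par v) {u v : Fin n} (q : T.Walk u v) :
    climbSum p (depN T r) (pwN w par) v ≤
      climbSum p (depN T r) (pwN w par) u + q.weight w := by
  have H := hp.rTree hpar
  induction q with
  | nil => simp [Walk.weight]
  | @cons u x v h q ih =>
    have h1 : (Walk.cons h q).weight w = w s(u, x) + q.weight w := by simp [Walk.weight]
    rw [h1, NNReal.coe_add]
    have h2 : climbSum p (depN T r) (pwN w par) x ≤
        climbSum p (depN T r) (pwN w par) u + w s(u, x) := by
      rcases hp.adj_cases hT h with ⟨h3, h4⟩ | ⟨h3, h4⟩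
      · rw [H.climbSum_par _ x.2 (fun h => h3 (Fin.ext h)), hpar, h4, pwN_coe, h4, add_comm]
      · have h5 : (0 : ℝ) ≤ w s(par u, u) := NNReal.coe_nonneg _
        have h6 : (0 : ℝ) ≤ w s(u, x) := NNReal.coe_nonneg _
        rw [H.climbSum_par _ u.2 (fun h => h3 (Fin.ext h)), hpar, h4, pwN_coe]
        linarith
    linarith

end ParentMap

/-! ### The network of a graph and the failed edges -/

section Network
variable {n : ℕ} {G T : SimpleGraph (Fin n)} {w : Sym2 (Fin n) → ℝ≥0} {r : Fin n}
  {par : Fin n → Fin n} {L : List (Fin n × Fin n)} {p ea eb : ℕ → ℕ} {ew : ℕ → ℝ}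

/-- The list gives every edge in only one orientation, not known in advance; the second half of the
arcs supplies the other one. -/
theorem arc_iff (hL : ListsEdges L G.edgeSet)
    (hea : ∀ j : Fin L.length, ea j = (L.get j).1) (heb : ∀ j : Fin L.length, eb j = (L.get j).2)
    (hew : ∀ j : Fin L.length, ew j = w s((L.get j).1, (L.get j).2)) (a b : Fin n) (c : ℝ) :
    (∃ q < 2 * L.length, twoWay L.length ea eb q = a ∧ twoWay L.length eb ea q = b ∧
      twoWay L.length ew ew q = c) ↔ G.Adj a b ∧ c = w s(a, b) := by
  have hmem : ∀ j : Fin L.length, G.Adj (L.get j).1 (L.get j).2 := fun j => by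
    rw [← SimpleGraph.mem_edgeSet, ← hL.2, List.mem_map]
    exact ⟨_, List.get_mem _ _, rfl⟩
  constructor
  · rintro ⟨q, hq, h1, h2, rfl⟩
    by_cases hqm : q < L.length
    · simp only [twoWay, hqm, if_true] at h1 h2 ⊢
      have e1 := hea ⟨q, hqm⟩
      have e2 := heb ⟨q, hqm⟩
      have e3 := hew ⟨q, hqm⟩
      simp only at e1 e2 e3
      obtain rfl : (L.get ⟨q, hqm⟩).1 = a := Fin.ext (e1.symm.trans h1)
      obtain rfl : (L.get ⟨q, hqm⟩).2 = b := Fin.ext (e2.symm.trans h2)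
      exact ⟨hmem _, e3⟩
    · simp only [twoWay, hqm, if_false] at h1 h2 ⊢
      have hqm' : q - L.length < L.length := by omega
      have e1 := hea ⟨_, hqm'⟩
      have e2 := heb ⟨_, hqm'⟩
      have e3 := hew ⟨_, hqm'⟩
      simp only at e1 e2 e3
      obtain rfl : (L.get ⟨_, hqm'⟩).2 = a := Fin.ext (e2.symm.trans h1)
      obtain rfl : (L.get ⟨_, hqm'⟩).1 = b := Fin.ext (e1.symm.trans h2)
      exact ⟨(hmem _).symm, by rw [e3, Sym2.eq_swap]⟩
  · rintro ⟨h, rfl⟩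
    rw [← SimpleGraph.mem_edgeSet, ← hL.2, List.mem_map] at h
    obtain ⟨x, hx, hx'⟩ := h
    obtain ⟨j, rfl⟩ := List.get_of_mem hx
    have e1 := hea j
    have e2 := heb j
    have e3 := hew j
    rw [Sym2.eq_iff] at hx'
    rcases hx' with ⟨h1, h2⟩ | ⟨h1, h2⟩
    · refine ⟨j, by omega, ?_⟩
      simp only [twoWay, j.2, if_true]
      rw [e1, e2, e3, h1, h2]
      exact ⟨rfl, rfl, rfl⟩
    · refine ⟨j + L.length, by omega, ?_⟩
      have : ¬ (j : ℕ) + L.length < L.length := by omega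
      simp only [twoWay, this, if_false, Nat.add_sub_cancel]
      rw [e1, e2, e3, h1, h2, Sym2.eq_swap]
      exact ⟨rfl, rfl, rfl⟩

theorem twoWay_lt {m n : ℕ} {f g : ℕ → ℕ} (hf : ∀ j < m, f j < n) (hg : ∀ j < m, g j < n) :
    ∀ q < 2 * m, twoWay m f g q < n := by
  intro q hq
  unfold twoWay
  split_ifs with h
  · exact hf q h
  · exact hg _ (by omega)

theorem IsShortestPathTree.net (hT : IsShortestPathTree G w r T) (hp : IsParentMap T r par)
    (hL : ListsEdges L G.edgeSet) (hpar : ∀ v : Fin n, p v = par v)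
    (hea : ∀ j : Fin L.length, ea j = (L.get j).1) (heb : ∀ j : Fin L.length, eb j = (L.get j).2)
    (hew : ∀ j : Fin L.length, ew j = w s((L.get j).1, (L.get j).2)) :
    Net n (2 * L.length) r p (depN T r) (pwN w par) (twoWay L.length ea eb)
      (twoWay L.length eb ea) (twoWay L.length ew ew) := by
  have hA := arc_iff hL hea heb hew
  have hs : ∀ q < 2 * L.length, twoWay L.length ea eb q < n :=
    twoWay_lt (fun j hj => by rw [hea ⟨j, hj⟩]; exact Fin.is_lt _)
      (fun j hj => by rw [heb ⟨j, hj⟩]; exact Fin.is_lt _)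
  have hd : ∀ q < 2 * L.length, twoWay L.length eb ea q < n :=
    twoWay_lt (fun j hj => by rw [heb ⟨j, hj⟩]; exact Fin.is_lt _)
      (fun j hj => by rw [hea ⟨j, hj⟩]; exact Fin.is_lt _)
  have hq : ∀ q (h : q < 2 * L.length), G.Adj ⟨_, hs q h⟩ ⟨_, hd q h⟩ ∧
      twoWay L.length ew ew q = w s(⟨_, hs q h⟩, ⟨_, hd q h⟩) := fun q h =>
    (hA ⟨_, hs q h⟩ ⟨_, hd q h⟩ _).1 ⟨q, h, rfl, rfl, rfl⟩
  refine ⟨hp.rTree hpar, hs, hd, fun q h => ?_, fun q h => ?_, fun v hv hr => ?_,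
    fun q h hr hq' => ?_, fun q h => ?_⟩
  · rw [(hq q h).2]; exact NNReal.coe_nonneg _
  · refine (hA ⟨_, hd q h⟩ ⟨_, hs q h⟩ _).2 ⟨(hq q h).1.symm, ?_⟩
    rw [(hq q h).2, Sym2.eq_swap]
  · have hadj := hT.le (hp ⟨v, hv⟩ (fun h => hr (by rw [← h]))).1.symm
    have := (hA (par ⟨v, hv⟩) ⟨v, hv⟩ _).2 ⟨hadj, rfl⟩
    rwa [← hpar, ← pwN_coe] at this
  · have h1 := hpar ⟨_, hd q h⟩
    simp only at h1
    rw [(hq q h).2]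
    simp only [pwN, hd q h, dif_pos]
    have h2 : (⟨_, hs q h⟩ : Fin n) = par ⟨_, hd q h⟩ := by
      apply Fin.ext; rw [← h1]; exact hq'
    rw [h2]
  -- The triangle inequality for `d`: the tree walk to the source of the arc, extended by the arc,
  -- is a walk of `G`, and the tree distance of the target is minimal in `G` because the tree
  -- preserves distances.
  · obtain ⟨p₁, hp₁⟩ := hp.exists_walk (w := w) hpar _ (hs q h)
    have h0 := SimpleGraph.Walk.weight_concat w (p₁.mapLe hT.le) (hq q h).1
    have h0' : (p₁.mapLe hT.le).weight w = p₁.weight w := by simp [Walk.weight]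
    rw [h0'] at h0
    rw [(hq q h).2, ← hp₁, ← NNReal.coe_add, ← h0]
    have h1 : wdist T w r ⟨_, hd q h⟩ ≤
        (((p₁.mapLe hT.le).concat (hq q h).1).weight w : ℝ≥0∞) := by
      rw [hT.wdist_eq]
      exact iInf_le _ _
    have h2 : ENNReal.ofReal (climbSum p (depN T r) (pwN w par) (twoWay L.length eb ea q)) ≤
        wdist T w r ⟨_, hd q h⟩ := by
      refine le_iInf fun p₂ => ?_
      have := hp.le_walk (w := w) hT.isTree hpar p₂
      rw [(hp.rTree hpar).climbSum_r, zero_add] at this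
      exact ENNReal.ofReal_le_of_le_toReal this
    have h3 := h2.trans h1
    rw [← ENNReal.ofReal_coe_nnreal] at h3
    exact (ENNReal.ofReal_le_ofReal_iff (NNReal.coe_nonneg _)).1 h3

/-- A set of failed edges that consists of the parent edges of `v₁` and `v₂`. -/
def FailsAt (r : Fin n) (par : Fin n → Fin n) (v₁ v₂ : ℕ) (F : Set (Sym2 (Fin n))) : Prop :=
  ∀ e, e ∈ F ↔ ∃ v : Fin n, v ≠ r ∧ ((v : ℕ) = v₁ ∨ (v : ℕ) = v₂) ∧ e = s(par v, v)

theorem mem_failsAt {dep : ℕ → ℕ} (H : RTree n r p dep) (hpar : ∀ v : Fin n, p v = par v)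
    {v₁ v₂ : ℕ} (hV : ValidPair n r p v₁ v₂) {F : Set (Sym2 (Fin n))} (hF : FailsAt r par v₁ v₂ F)
    (a b : Fin n) :
    s(a, b) ∈ F ↔ arcChild n r p a b = v₁ ∨ arcChild n r p a b = v₂ := by
  rw [hF]
  constructor
  · rintro ⟨v, hv, h, he⟩
    have hv' : (v : ℕ) ≠ r := fun h => hv (Fin.ext h)
    have h1 : arcChild n r p (par v) v = v := by simp [arcChild, hv', hpar]
    rcases Sym2.eq_iff.1 he with ⟨rfl, rfl⟩ | ⟨rfl, rfl⟩
    · rw [h1]; exact h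
    · rw [arcChild_comm H a.2 (par a).2, h1]; exact h
  · intro h
    -- Arcs outside the tree have `arcChild` equal to `n`, while a missing failure is coded by `n +
    -- 1`; so such arcs never count as failed.
    have hn : v₁ ≠ n ∧ v₂ ≠ n := by rcases hV with h | h <;> omega
    unfold arcChild at h
    split_ifs at h with h1 h2
    · refine ⟨b, fun hh => h1.1 (congrArg _ hh), h, ?_⟩
      rw [show par b = a from Fin.ext ((hpar b).symm.trans h1.2)]
    · refine ⟨a, fun hh => h2.1 (congrArg _ hh), h, ?_⟩
      rw [show par a = b from Fin.ext ((hpar a).symm.trans h2.2), Sym2.eq_swap]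
    · omega

theorem liveArc_iff {dep : ℕ → ℕ} (H : RTree n r p dep) (hL : ListsEdges L G.edgeSet)
    (hpar : ∀ v : Fin n, p v = par v)
    (hea : ∀ j : Fin L.length, ea j = (L.get j).1) (heb : ∀ j : Fin L.length, eb j = (L.get j).2)
    (hew : ∀ j : Fin L.length, ew j = w s((L.get j).1, (L.get j).2))
    {v₁ v₂ : ℕ} (hV : ValidPair n r p v₁ v₂) {F : Set (Sym2 (Fin n))} (hF : FailsAt r par v₁ v₂ F)
    (a b : Fin n) (c : ℝ) :
    LiveArc n (2 * L.length) r p (twoWay L.length ea eb) (twoWay L.length eb ea)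
      (twoWay L.length ew ew) v₁ v₂ a b c ↔ (G.deleteEdges F).Adj a b ∧ c = w s(a, b) := by
  rw [SimpleGraph.deleteEdges_adj, mem_failsAt H hpar hV hF, not_or, and_right_comm,
    ← arc_iff hL hea heb hew]
  simp only [LiveArc]
  constructor
  · rintro ⟨q, h1, h2, h3, h4, h5⟩
    exact ⟨⟨q, h1, h2, h3, h4⟩, h5⟩
  · rintro ⟨⟨q, h1, h2, h3, h4⟩, h5⟩
    exact ⟨q, h1, h2, h3, h4, h5⟩

/-- A `RevWalk` lists its vertices from the end back to the root, so it corresponds to a walk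
towards the root; the graph being undirected, reversal costs nothing. -/
theorem revWalk_of_walk {G' : SimpleGraph (Fin n)} {E : ℕ → ℕ → ℝ → Prop}
    (hE : ∀ a b : Fin n, G'.Adj a b → E a b (w s(a, b))) {y x : Fin n} (q : G'.Walk y x) :
    RevWalk E x y (q.support.map Fin.val) (q.weight w) := by
  induction q with
  | nil => simpa [Walk.weight] using RevWalk.nil
  | @cons u v x h q ih =>
    have h1 : (Walk.cons h q).weight w = w s(u, v) + q.weight w := by simp [Walk.weight]
    rw [Walk.support_cons, List.map_cons]
    refine ih.cons_eq (hE _ _ h.symm) ?_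
    rw [h1, NNReal.coe_add, Sym2.eq_swap, add_comm]

theorem walk_of_revWalk {G' : SimpleGraph (Fin n)} {E : ℕ → ℕ → ℝ → Prop}
    (hlt : ∀ a b c, E a b c → a < n ∧ b < n)
    (hE : ∀ (a b : Fin n) (c : ℝ), E a b c → G'.Adj a b ∧ c = w s(a, b)) {y : ℕ} {l : List ℕ}
    {x : ℝ} (h : RevWalk E r y l x) : ∀ hy : y < n,
    ∃ q : G'.Walk ⟨y, hy⟩ r, q.support.map Fin.val = l ∧ (q.weight w : ℝ) = x := by
  induction h with
  | nil => exact fun _ => ⟨.nil, by simp, by simp [Walk.weight]⟩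
  | @cons a b l x c h hab ih =>
    intro hb
    obtain ⟨q, h1, h2⟩ := ih (hlt _ _ _ hab).1
    obtain ⟨h3, h4⟩ := hE ⟨a, (hlt _ _ _ hab).1⟩ ⟨b, hb⟩ c hab
    refine ⟨.cons h3.symm q, by simp [h1], ?_⟩
    have h5 : (Walk.cons h3.symm q).weight w = w s(⟨b, hb⟩, ⟨a, (hlt _ _ _ hab).1⟩) + q.weight w := by
      simp [Walk.weight]
    rw [h5, NNReal.coe_add, h2, Sym2.eq_swap]
    linarith

/-- A description of at most two failed edges by their lower endpoints. -/
def PairInput (n : ℕ) (par : ℕ → ℕ) (v₁ v₂ k a₀ b₀ a₁ b₁ : ℕ) : Prop :=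
  let E := fun v a b => a = v ∧ b = par v ∨ a = par v ∧ b = v
  k = 0 ∧ v₁ = n + 1 ∧ v₂ = n + 1 ∨
  k = 1 ∧ v₂ < n ∧ v₁ = v₂ ∧ E v₂ a₀ b₀ ∨
  k = 2 ∧ v₂ < n ∧ v₁ = par v₂ ∧ (E v₁ a₀ b₀ ∧ E v₂ a₁ b₁ ∨ E v₂ a₀ b₀ ∧ E v₁ a₁ b₁)

/-- A path failure with at most two edges. -/
theorem IsPathFailure.exists_pair (hT : T.IsTree) (hp : IsParentMap T r par)
    (hpar : ∀ v : Fin n, p v = par v) {F : Set (Sym2 (Fin n))} (hF : IsPathFailure T r F)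
    (hF2 : F.ncard ≤ 2) : ∃ v₁ v₂, ValidPair n r p v₁ v₂ ∧ FailsAt r par v₁ v₂ F ∧
      ∀ (LF : List (Fin n × Fin n)) (σ : MState) (t : Fin n), ListsEdges LF F →
        QueryInput t LF σ →
        PairInput n p v₁ v₂ (σ.ivar 1) (σ.ivar 2) (σ.ivar 3) (σ.ivar 4) (σ.ivar 5) := by
  have H := hp.rTree hpar
  obtain ⟨v, q, hq, l, hl, rfl⟩ := hF
  have hnd : l.Nodup := hq.isTrail.edges_nodup.sublist hl.sublist
  have hlen : l.length ≤ 2 := by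
    have h1 : ({e | e ∈ l} : Set (Sym2 (Fin n))) = (l.toFinset : Set (Sym2 (Fin n))) := by
      ext; simp
    rwa [h1, Set.ncard_coe_finset, List.toFinset_card_of_nodup hnd] at hF2
  -- Prefixes of a tree path are tree paths, so its `i`-th vertex has depth `i`, and each vertex is
  -- the parent of the next.
  have hedge : ∀ i < q.length, q.getVert (i + 1) ≠ r ∧ par (q.getVert (i + 1)) = q.getVert i := by
    intro i hi
    have h1 : ∀ j ≤ q.length, T.dist r (q.getVert j) = j := by
      intro j hj
      rw [← hT.length_eq_dist (hq.take j), Walk.take_length]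
      omega
    exact hp.eq_par hT (q.adj_getVert_succ hi) (by rw [h1 _ hi, h1 _ hi.le])
  have hval : ∀ v : Fin n, v ≠ r → (v : ℕ) ≠ r := fun v hv h => hv (Fin.ext h)
  have hE : ∀ {x : Fin n × Fin n} {v : Fin n}, s(x.1, x.2) = s(par v, v) →
      ((x.1 : ℕ) = v ∧ (x.2 : ℕ) = p v ∨ (x.1 : ℕ) = p v ∧ (x.2 : ℕ) = v) := by
    intro x v h
    rw [hpar]
    rcases Sym2.eq_iff.1 h with ⟨h1, h2⟩ | ⟨h1, h2⟩
    · exact .inr ⟨congrArg _ h1, congrArg _ h2⟩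
    · exact .inl ⟨congrArg _ h1, congrArg _ h2⟩
  obtain ⟨l₁, l₂, hl⟩ := hl
  -- A query may list the failed edges in any order and orientation, whereas `v₁` and `v₂` depend on
  -- the failure only.
  have hperm : ∀ LF : List (Fin n × Fin n), ListsEdges LF {e | e ∈ l} →
      (LF.map fun a => s(a.1, a.2)).Perm l := fun LF h =>
    (List.perm_ext_iff_of_nodup h.1 hnd).2 fun e => h.2 e
  obtain _ | ⟨e, _ | ⟨e', _ | ⟨e'', l⟩⟩⟩ := l
  · refine ⟨n + 1, n + 1, .inl ⟨rfl, rfl⟩, fun e => ?_, fun LF σ t h hσ => ?_⟩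
    · simp only [List.not_mem_nil, Set.ofPred_false, Set.mem_empty_iff_false, false_iff]
      rintro ⟨v, -, h, -⟩
      omega
    · have h1 := (hperm LF h).length_eq
      rw [List.length_map, List.length_nil] at h1
      exact .inl ⟨hσ.card_eq.trans h1, rfl, rfl⟩
  · have hi : l₁.length < q.length := by
      rw [← Walk.length_edges, ← hl]; simp
    obtain ⟨h1, h2⟩ := hedge _ hi
    have he : e = s(par (q.getVert (l₁.length + 1)), q.getVert (l₁.length + 1)) := by
      rw [h2, ← Walk.getElem_edges (h := by rw [Walk.length_edges]; exact hi)]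
      simp [← hl]
    set v₁ := q.getVert (l₁.length + 1)
    refine ⟨v₁, v₁, .inr ⟨v₁.2, v₁.2, hval _ h1, hval _ h1, .inl rfl⟩, fun e' => ?_,
      fun LF σ t h hσ => ?_⟩
    · simp only [List.mem_singleton, Set.mem_ofPred_eq, or_self]
      constructor
      · rintro rfl; exact ⟨v₁, h1, rfl, he⟩
      · rintro ⟨u, -, hu, rfl⟩
        rw [he, Fin.ext hu]
    · have h3 := List.perm_singleton.1 (hperm LF h)
      obtain _ | ⟨x, _ | ⟨x', LF⟩⟩ := LF
      · simp at h3
      · simp only [List.map_cons, List.map_nil, List.cons.injEq, and_true] at h3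
        have e1 := hσ.fst_eq ⟨0, by simp⟩
        have e2 := hσ.snd_eq ⟨0, by simp⟩
        simp only [mul_zero, add_zero, List.get_eq_getElem, List.getElem_cons_zero] at e1 e2
        refine .inr (.inl ⟨hσ.card_eq, v₁.2, rfl, ?_⟩)
        simp only [e1, e2]
        exact hE (h3.trans he)
      · simp at h3
  · have hi : l₁.length + 1 < q.length := by
      rw [← Walk.length_edges, ← hl]; simp
    obtain ⟨h1, h2⟩ := hedge _ hi
    obtain ⟨h3, h4⟩ := hedge l₁.length (by omega)
    have he : e = s(par (q.getVert (l₁.length + 1)), q.getVert (l₁.length + 1)) := by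
      rw [h4, ← Walk.getElem_edges (h := by rw [Walk.length_edges]; omega)]
      simp [← hl]
    have he' : e' = s(par (q.getVert (l₁.length + 1 + 1)), q.getVert (l₁.length + 1 + 1)) := by
      rw [h2, ← Walk.getElem_edges (h := by rw [Walk.length_edges]; omega)]
      simp [← hl]
    set v₁ := q.getVert (l₁.length + 1)
    set v₂ := q.getVert (l₁.length + 1 + 1)
    have hpv : (v₁ : ℕ) = p v₂ := by rw [hpar, h2]
    refine ⟨v₁, v₂, .inr ⟨v₁.2, v₂.2, hval _ h3, hval _ h1, .inr hpv⟩, fun e'' => ?_,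
      fun LF σ t h hσ => ?_⟩
    · simp only [List.mem_cons, List.not_mem_nil, or_false, Set.mem_ofPred_eq]
      constructor
      · rintro (rfl | rfl)
        · exact ⟨v₁, h3, .inl rfl, he⟩
        · exact ⟨v₂, h1, .inr rfl, he'⟩
      · rintro ⟨u, -, hu | hu, rfl⟩
        · left; rw [he, Fin.ext hu]
        · right; rw [he', Fin.ext hu]
    · have h5 := hperm LF h
      have h6 := h5.length_eq
      rw [List.length_map] at h6
      obtain _ | ⟨x, _ | ⟨x', _ | ⟨x'', LF⟩⟩⟩ := LF
      · simp at h6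
      · simp at h6
      · simp only [List.map_cons, List.map_nil] at h5
        have e1 := hσ.fst_eq ⟨0, by simp⟩
        have e2 := hσ.snd_eq ⟨0, by simp⟩
        have e3 := hσ.fst_eq ⟨1, by simp⟩
        have e4 := hσ.snd_eq ⟨1, by simp⟩
        simp only [mul_zero, add_zero, List.get_eq_getElem, List.getElem_cons_zero, mul_one,
          Nat.reduceAdd, List.getElem_cons_succ] at e1 e2 e3 e4
        refine .inr (.inr ⟨hσ.card_eq, v₂.2, hpv, ?_⟩)
        simp only [e1, e2, e3, e4]
        rcases List.perm_pair.1 h5 with h7 | h7 <;>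
          simp only [List.cons.injEq, and_true] at h7
        · exact .inl ⟨hE (h7.1.trans he), hE (h7.2.trans he')⟩
        · exact .inr ⟨hE (h7.1.trans he'), hE (h7.2.trans he)⟩
      · simp at h6
  · simp at hlen

end Network

/-! ## The construction

Memory layout. Word variables: `0` number of vertices, `1` number of edges, `2` root, `3` number of
arcs. Word arrays of the oracle: `2` parents, `3` preorder numbers, `4` subtree sizes, `5` depths,
`6` offsets of the table rows, `7` table of parents, `8` and `9` entry arcs of the large parts,
`10` number of vertices. Real arrays of the oracle: `1` distances, `2` table of values, `3` lengths
of the ways to the entries. Scratch word arrays: `11`, `12`, `13` sources, targets and lower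
endpoints of the arcs, `14` preorder offsets, `15` classes, `16` flags, `17` list of arcs. Scratch
real arrays: `4` weights of the arcs, `5` weights of the parent edges, `6` values. -/

/-- Words are large enough. -/
def BigWord (B n m : ℕ) : Prop := 8 * (n * n) + 8 * n + 4 * m + 40 < B

/-- Store both orientations of all edges. -/
def cmArcs : Cm :=
  .for 5 (.v 1)
    (.st 11 (.v 5) (.ld 0 (.v 5)) ;; .st 12 (.v 5) (.ld 1 (.v 5)) ;;
     .st 11 (.v 5 +ₑ .v 1) (.ld 1 (.v 5)) ;; .st 12 (.v 5 +ₑ .v 1) (.ld 0 (.v 5)) ;;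
     .rst 4 (.v 5) (.ld 0 (.v 5)) ;; .rst 4 (.v 5 +ₑ .v 1) (.ld 0 (.v 5)))

theorem cmArcs_run {B m : ℕ} {σ : MState} (hB : BigWord B 0 m) (hm : σ.ivar 1 = m) :
    HRun B cmArcs σ (m * 8 + 2) fun τ => ∀ q < 2 * m,
      τ.ints 11 q = twoWay m (σ.ints 0) (σ.ints 1) q ∧
      τ.ints 12 q = twoWay m (σ.ints 1) (σ.ints 0) q ∧
      τ.reals 4 q = twoWay m (σ.reals 0) (σ.reals 0) q := by
  unfold BigWord at hB
  refine HRun.for' (N := m) (fun i τ => ∀ j < i,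
      τ.ints 11 j = σ.ints 0 j ∧ τ.ints 11 (j + m) = σ.ints 1 j ∧
      τ.ints 12 j = σ.ints 1 j ∧ τ.ints 12 (j + m) = σ.ints 0 j ∧
      τ.reals 4 j = σ.reals 0 j ∧ τ.reals 4 (j + m) = σ.reals 0 j) 6 ?_ (by omega) ?_ (by decide)
      ?_ ?_
  · intro i _ τ _ hF
    exact ⟨trivial, (hF.i 1 (by decide)).trans hm⟩
  · intro j hj; omega
  · intro i hi τ hI hx hF
    have e1 := (hF.i 1 (by decide)).trans hm
    have e2 := hF.ai 0 (by decide)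
    have e3 := hF.ai 1 (by decide)
    have e4 := hF.ar 0 (by decide)
    refine HRun.of_wp ?_
    simp [hx, e1, e2, e3, e4]
    refine ⟨by omega, ?_⟩
    grind [Function.update_apply]
  · intro τ hI _ q hq
    grind [twoWay]

/-- Find the lower endpoints of the arcs and the weights of the parent edges. -/
def cmChild : Cm :=
  3 ≔ .v 1 +ₑ .v 1 ;;
  .for 5 (.v 3)
    (21 ≔ .ld 11 (.v 5) ;; 22 ≔ .ld 12 (.v 5) ;;
     .ite (.not (.v 22 =ₑ .v 2) &ₑ .ld 2 (.v 22) =ₑ .v 21)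
       (.st 13 (.v 5) (.v 22) ;; .rst 5 (.v 22) (.ld 4 (.v 5)))
       (.ite (.not (.v 21 =ₑ .v 2) &ₑ .ld 2 (.v 21) =ₑ .v 22)
         (.st 13 (.v 5) (.v 21)) (.st 13 (.v 5) (.v 0))))

/-- Compute depths, distances and sizes of subtrees by walking up from every vertex. -/
def cmClimb : Cm :=
  .for 30 (.v 0) (.st 4 (.v 30) (.c 0)) ;;
  .for 30 (.v 0)
    ((26 ≔ .v 30 ;; 27 ≔ .c 0 ;; 3 ≔ᵣ .zero ;; .st 4 (.v 26) (.ld 4 (.v 26) +ₑ .c 1)) ;;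
     .while (.not (.v 26 =ₑ .v 2))
      (3 ≔ᵣ .v 3 +ᵣ .ld 5 (.v 26) ;; 27 ≔ .v 27 +ₑ .c 1 ;; 26 ≔ .ld 2 (.v 26) ;;
       .st 4 (.v 26) (.ld 4 (.v 26) +ₑ .c 1)) ;;
     (.st 5 (.v 30) (.v 27) ;; .rst 1 (.v 30) (.v 3)))

/-- Compute the preorder offsets. -/
def cmOff : Cm :=
  .for 30 (.v 0)
    (28 ≔ .c 1 ;;
     .for 29 (.v 30)
      (.ite (.not (.v 29 =ₑ .v 2) &ₑ .ld 2 (.v 29) =ₑ .ld 2 (.v 30))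
        (28 ≔ .v 28 +ₑ .ld 4 (.v 29)) .skip) ;;
     .st 14 (.v 30) (.v 28))

/-- Compute the preorder numbers and the table rows. -/
def cmPre : Cm :=
  .for 30 (.v 0)
    ((26 ≔ .v 30 ;; 27 ≔ .c 0 ;; 28 ≔ .c 0) ;;
     .while (.not (.v 26 =ₑ .v 2))
      (28 ≔ .v 28 +ₑ .ld 14 (.v 26) ;;
       .ite (.ld 4 (.ld 2 (.v 26)) <ₑ .ld 4 (.v 26) +ₑ .ld 4 (.v 26)) .skip
         (27 ≔ .v 27 +ₑ .c 1) ;;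
       26 ≔ .ld 2 (.v 26)) ;;
     (.st 3 (.v 30) (.v 28) ;;
      .ite (.ld 4 (.ld 2 (.v 30)) <ₑ .ld 4 (.v 30) +ₑ .ld 4 (.v 30))
        (.st 6 (.v 30) ((.v 27 +ₑ .v 27 +ₑ .c 1) *ₑ .v 0))
        (.st 6 (.v 30) ((.v 27 +ₑ .v 27) *ₑ .v 0))))

/-! ### Correctness of the tree preprocessing -/

theorem cmChild_run {B n m r : ℕ} {par dep : ℕ → ℕ} {pw : ℕ → ℝ} {aS aD : ℕ → ℕ} {aW : ℕ → ℝ}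
    (N : Net n (2 * m) r par dep pw aS aD aW) {σ : MState} (hB : BigWord B n m)
    (hn : σ.ivar 0 = n) (hm : σ.ivar 1 = m) (hr : σ.ivar 2 = r) (hpar : σ.ints 2 = par)
    (hS : ∀ q < 2 * m, σ.ints 11 q = aS q) (hD : ∀ q < 2 * m, σ.ints 12 q = aD q)
    (hW : ∀ q < 2 * m, σ.reals 4 q = aW q) :
    HRun B cmChild σ (m * 20 + 10) fun τ => τ.ivar 3 = 2 * m ∧
      (∀ q < 2 * m, τ.ints 13 q = arcChild n r par (aS q) (aD q)) ∧
      ∀ v < n, v ≠ r → τ.reals 5 v = pw v := by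
  unfold BigWord at hB
  refine HRun.le (HRun.seq (b₁ := 1) (b₂ := 2 * m * 8 + 2)
    (R := fun τ => τ = σ.setI 3 (2 * m)) (HRun.of_wp ?_) ?_) (by omega)
  · simp [hm]; refine ⟨by omega, by rw [two_mul]⟩
  rintro τ rfl
  refine HRun.for' (N := 2 * m) (fun i τ =>
      (∀ q < i, τ.ints 13 q = arcChild n r par (aS q) (aD q)) ∧
      ∀ q < i, aD q ≠ r → par (aD q) = aS q → τ.reals 5 (aD q) = pw (aD q)) 6 ?_ (by omega) ?_
      (by decide) ?_ ?_
  · intro i _ τ _ hF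
    exact ⟨trivial, (hF.i 3 (by decide)).trans (by simp)⟩
  · simp
  · intro i hi τ hI hx hF
    have e0 := (hF.i 0 (by decide)).trans (by simpa using hn)
    have e1 := (hF.i 2 (by decide)).trans (by simpa using hr)
    have e2 := hF.ai 2 (by decide)
    have e3 := hF.ai 11 (by decide)
    have e4 := hF.ai 12 (by decide)
    have e5 := hF.ar 4 (by decide)
    have e6 := N.parWt i hi
    refine (HRun.of_wp ?_).le (show _ ≤ 6 by decide)
    simp only [MState.setI_ints, MState.setI_reals] at e2 e3 e4 e5
    simp [hx, e0, e1, e2, e3, e4, e5, hpar, hS i hi, hD i hi, hW i hi]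
    refine ⟨fun h1 h2 => ?_, fun h1 => ⟨fun h2 h3 => ?_, fun h2 => ?_⟩⟩ <;>
      grind [Function.update_apply, arcChild]
  · intro τ hI hF
    refine ⟨(hF.i 3 (by decide)).trans (by simp), hI.1, fun v hv hvr => ?_⟩
    -- Every parent edge occurs among the arcs, and by `parWt` all arcs that could have written its
    -- cell carry the same weight.
    obtain ⟨q, hq, h1, h2, -⟩ := N.parArc v hv hvr
    have := hI.2 q hq (by rwa [h2]) (by rw [h1, h2])
    rwa [h2] at this

namespace RTree
variable {n r : ℕ} {par dep : ℕ → ℕ} (H : RTree n r par dep)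
include H

/-- One climbing step from `x` adds exactly `par x` to the vertices visited so far. The loop that
counts subtree sizes relies on this. -/
theorem anc_between {x v a : ℕ} (hv : v < n) (hx : Anc r par x v) (hxr : x ≠ r) :
    Anc r par (par x) a ∧ Anc r par a v ↔ Anc r par x a ∧ Anc r par a v ∨ a = par x := by
  have hxn := H.anc_lt hx hv
  constructor
  · rintro ⟨h1, h2⟩
    rcases h2.total hx with h | h
    · rcases anc_iff.1 h with h3 | ⟨-, h3⟩
      · exact .inl ⟨h3 ▸ anc_refl _, h2⟩
      · exact .inr (H.anc_antisymm (H.par_lt x hxn) h3 h1)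
    · exact .inl ⟨h, h2⟩
  · rintro (⟨h1, h2⟩ | rfl)
    · exact ⟨(anc_par hxr).trans h1, h2⟩
    · exact ⟨anc_refl _, (anc_par hxr).trans hx⟩

omit H in
open Classical in
theorem card_anc_succ (a i : ℕ) : ((Finset.range (i + 1)).filter (Anc r par a)).card =
    ((Finset.range i).filter (Anc r par a)).card + if Anc r par a i then 1 else 0 := by
  rw [Finset.range_add_one, Finset.filter_insert]
  split_ifs with h
  · rw [Finset.card_insert_of_notMem (by simp)]
  · rfl

end RTree

-- Sizes are obtained by counting: every vertex adds one to each of its ancestors. After `i` rounds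
-- the counter of `v` is the number of vertices below `i` in the subtree of `v`. A climb has fewer
-- than `n` steps, hence quadratic time.
open Classical in
theorem cmClimb_run {B n m r : ℕ} {par dep : ℕ → ℕ} {pw : ℕ → ℝ} (H : RTree n r par dep)
    {σ : MState} (hB : BigWord B n m)
    (hn : σ.ivar 0 = n) (hr : σ.ivar 2 = r) (hpar : σ.ints 2 = par)
    (hpw : ∀ v < n, v ≠ r → σ.reals 5 v = pw v) :
    HRun B cmClimb σ (6 * (n * n) + 20 * n + 10) fun τ => ∀ v < n, τ.ints 5 v = dep v ∧
      τ.reals 1 v = climbSum par dep pw v ∧ τ.ints 4 v = sz n r par v := by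
  unfold BigWord at hB
  refine HRun.le (HRun.seq (b₁ := n * 3 + 2) (b₂ := n * (6 * n + 11) + 2)
    (R := fun τ => (∀ v < n, τ.ints 4 v = 0) ∧ Frame [(0, 30), (2, 4)] σ τ) ?_ ?_) ?_
  · refine HRun.imp (HRun.frame (HRun.for' (N := n) (fun i τ => ∀ v < i, τ.ints 4 v = 0) 1 ?_
      (by omega) (by simp) (by decide) ?_ (fun τ h _ => h))) (fun τ h => ⟨h.1, h.2.mono ?_⟩)
    · intro i _ τ _ hF
      exact ⟨trivial, (hF.i 0 (by decide)).trans hn⟩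
    · intro i hi τ hI hx hF
      refine HRun.of_wp ?_
      simp [hx]
      refine ⟨by omega, ?_⟩
      grind [Function.update_apply]
    · decide
  · rintro σ₁ ⟨h4, hF₁⟩
    have e0 := (hF₁.i 0 (by decide)).trans hn
    have e2 := (hF₁.i 2 (by decide)).trans hr
    have p2 := (hF₁.ai 2 (by decide)).trans hpar
    have p5 := hF₁.ar 5 (by decide)
    refine HRun.le (HRun.for' (N := n) (fun i τ => ∀ v < n,
      τ.ints 4 v = ((Finset.range i).filter (Anc r par v)).card ∧
      (v < i → τ.ints 5 v = dep v ∧ τ.reals 1 v = climbSum par dep pw v)) (6 * n + 9) ?_ (by omega)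
      ?_ (by decide) ?_ ?_) (le_refl _)
    · intro i _ τ _ hF
      exact ⟨trivial, (hF.i 0 (by decide)).trans e0⟩
    · intro v hv
      simpa using h4 v hv
    · intro i hi τ hI hx hF
      have f2 := (hF.i 2 (by decide)).trans e2
      have q2 := (hF.ai 2 (by decide)).trans p2
      have q5 := (hF.ar 5 (by decide)).trans p5
      have hcard : ∀ v, ((Finset.range i).filter (Anc r par v)).card ≤ n := fun v =>
        (Finset.card_filter_le _ _).trans (by simpa using hi.le)
      refine HRun.le (HRun.seq (b₁ := 4) (b₂ := 5 * dep i + 1 + 2) (R := fun τ' =>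
          (∀ v < n, τ'.ints 4 v = ((Finset.range i).filter (Anc r par v)).card +
            if v = i then 1 else 0) ∧
          τ'.ivar 26 = i ∧ τ'.ivar 27 = 0 ∧ τ'.rvar 3 = 0 ∧
          Frame [(0, 26), (0, 27), (1, 3), (2, 4)] τ τ')
        (HRun.imp (HRun.frame (HRun.of_wp (Q := fun τ' =>
          (∀ v < n, τ'.ints 4 v = ((Finset.range i).filter (Anc r par v)).card +
            if v = i then 1 else 0) ∧
          τ'.ivar 26 = i ∧ τ'.ivar 27 = 0 ∧ τ'.rvar 3 = 0) ?_))
          fun τ' h => ⟨h.1.1, h.1.2.1, h.1.2.2.1, h.1.2.2.2, h.2.mono (by decide)⟩) ?_)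
        (by have := H.dep_lt hi; omega)
      · have h1 := (hI i hi).1
        have h2 := hcard i
        simp [hx]
        refine ⟨by omega, by omega, ?_⟩
        intro v hv
        have h3 := (hI v hv).1
        grind [Function.update_apply]
      rintro τ₁ ⟨h41, hx1, hc1, ha1, hF1⟩
      have g2 := (hF1.i 2 (by decide)).trans f2
      have g2' := (hF1.ai 2 (by decide)).trans q2
      have g5 := (hF1.ar 5 (by decide)).trans q5
      have g30 := (hF1.i 30 (by decide)).trans hx
      have g5' := hF1.ai 5 (by decide)
      have g1' := hF1.ar 1 (by decide)
      refine HRun.seq (R := fun τ' =>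
          (∀ v < n, τ'.ints 4 v = ((Finset.range i).filter (Anc r par v)).card +
            if Anc r par v i then 1 else 0) ∧
          τ'.ivar 27 = dep i ∧ τ'.rvar 3 = climbSum par dep pw i ∧ τ'.ivar 30 = i ∧
          τ'.ints 5 = τ.ints 5 ∧ τ'.reals 1 = τ.reals 1) ?_ ?_
      -- With the climb at `x`, what has been accumulated and what remains above `x` add up to the
      -- final depth and distance; the counters of the vertices between `i` and `x` have been
      -- increased. The budget is linear in the remaining depth.
      · refine HRun.while' (fun b τ' => ∃ x, τ'.ivar 26 = x ∧ Anc r par x i ∧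
          τ'.ivar 27 + dep x = dep i ∧ τ'.rvar 3 + climbSum par dep pw x = climbSum par dep pw i ∧
          (∀ v < n, τ'.ints 4 v = ((Finset.range i).filter (Anc r par v)).card +
            if Anc r par x v ∧ Anc r par v i then 1 else 0) ∧ b = 5 * dep x + 1) ?_ ?_ ?_ ?_
        · refine ⟨i, hx1, anc_refl _, by omega, by rw [ha1, zero_add], fun v hv => ?_, rfl⟩
          rw [h41 v hv]
          congr 1
          refine if_congr ?_ rfl rfl
          constructor
          · rintro rfl; exact ⟨anc_refl _, anc_refl _⟩
          · rintro ⟨h1, h2⟩; exact H.anc_antisymm hi h2 h1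
        · intro b τ' _ _
          exact ⟨trivial, trivial⟩
        · rintro b τ' ⟨x, h26, hxi, h27, h3, h4', rfl⟩ hF' hc
          have k2 := (hF'.i 2 (by decide)).trans g2
          have k2' := (hF'.ai 2 (by decide)).trans g2'
          have k5 := (hF'.ar 5 (by decide)).trans g5
          simp only [Cd.holds, Ex.eval, h26, k2] at hc
          have hxn := H.anc_lt hxi hi
          have hd := H.dep_par x hxn hc
          have hcs := H.climbSum_par pw hxn hc
          have hpn := H.par_lt x hxn
          have hdi := H.dep_lt hi
          have hw := hpw x hxn hc
          refine ⟨4, 5 * dep (par x) + 1, by omega, (HRun.of_wp ?_).le (show _ ≤ 4 by decide)⟩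
          have h1 := h4' (par x) hpn
          have h2 := hcard (par x)
          have h5 : (if Anc r par x (par x) ∧ Anc r par (par x) i then 1 else 0) = 0 := by
            rw [if_neg]; rintro ⟨h, -⟩; exact H.not_anc_par hxn hc h
          rw [h5] at h1
          simp [h26, k2', k5]
          refine ⟨by omega, by omega, (anc_par hc).trans hxi, by omega, ?_, ?_⟩
          · rw [hw]; linarith
          · intro v hv
            have h6 := h4' v hv
            have h7 := H.anc_between (a := v) hi hxi hc
            grind [Function.update_apply]
        · rintro b τ' ⟨x, h26, hxi, h27, h3, h4', rfl⟩ hF' hc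
          have k2 := (hF'.i 2 (by decide)).trans g2
          simp only [Cd.holds, Ex.eval, h26, k2, not_not] at hc
          subst hc
          rw [H.dep_r] at h27
          rw [H.climbSum_r] at h3
          refine ⟨by omega, fun v hv => ?_, by omega, by linarith, (hF'.i 30 (by decide)).trans g30,
            (hF'.ai 5 (by decide)).trans g5', (hF'.ar 1 (by decide)).trans g1'⟩
          rw [h4' v hv]
          simp [H.anc_r v hv]
      · rintro τ₂ ⟨h1, h2, h3, h4', h5, h6⟩
        refine HRun.of_wp ?_
        simp [h2, h3, h4']
        intro v hv
        have := hI v hv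
        rw [h1 v hv, RTree.card_anc_succ, h5, h6]
        grind [Function.update_apply]
    · intro τ hI _ v hv
      exact ⟨((hI v hv).2 hv).1, ((hI v hv).2 hv).2, by rw [(hI v hv).1, sz, subtree]⟩
  · nlinarith

/-- Unlike `preOff_add_le` this covers the root as well, whose parent entry is arbitrary. The
program computes an offset for it too and must not overflow. -/
theorem preOff_le {n r : ℕ} {par dep : ℕ → ℕ} (H : RTree n r par dep) {v : ℕ} (hv : v < n) :
    preOff n r par v ≤ n + 1 := by
  have h1 : ((olderSiblings r par v).biUnion (subtree n r par)).card =
      ∑ a ∈ olderSiblings r par v, sz n r par a := by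
    refine Finset.card_biUnion fun a ha b hb hab => RTree.disjoint_subtree ?_ ?_
    all_goals
      have ha' := Finset.mem_filter.1 (Finset.mem_coe.1 ha)
      have hb' := Finset.mem_filter.1 (Finset.mem_coe.1 hb)
      have ha2 := Finset.mem_range.1 ha'.1
      have hb2 := Finset.mem_range.1 hb'.1
    · exact H.not_anc_sibling (by omega) hb'.2.1 (by omega) ha'.2.1
        (ha'.2.2.trans hb'.2.2.symm) hab
    · exact H.not_anc_sibling (by omega) ha'.2.1 (by omega) hb'.2.1
        (hb'.2.2.trans ha'.2.2.symm) hab.symm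
  have h2 : ((olderSiblings r par v).biUnion (subtree n r par)) ⊆ Finset.range n := by
    intro x hx
    obtain ⟨a, -, h⟩ := Finset.mem_biUnion.1 hx
    exact Finset.mem_range.2 (mem_subtree.1 h).1
  have h3 := Finset.card_le_card h2
  rw [Finset.card_range, h1] at h3
  rw [preOff]
  omega

theorem cmOff_run {B n m r : ℕ} {par dep : ℕ → ℕ} (H : RTree n r par dep)
    {σ : MState} (hB : BigWord B n m)
    (hn : σ.ivar 0 = n) (hr : σ.ivar 2 = r) (hpar : σ.ints 2 = par)
    (hsz : ∀ v < n, σ.ints 4 v = sz n r par v) :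
    HRun B cmOff σ (4 * (n * n) + 10 * n + 10) fun τ => ∀ v < n, τ.ints 14 v = preOff n r par v := by
  unfold BigWord at hB
  refine HRun.le (HRun.for' (N := n) (fun i τ => ∀ v < i, τ.ints 14 v = preOff n r par v)
    (4 * n + 4) ?_ (by omega) (by simp) (by decide) ?_ fun τ h _ => h) (by nlinarith)
  · intro i _ τ _ hF
    exact ⟨trivial, (hF.i 0 (by decide)).trans hn⟩
  · intro i hi τ hI hx hF
    have f2 := (hF.i 2 (by decide)).trans hr
    have q2 := (hF.ai 2 (by decide)).trans hpar
    have q4 := hF.ai 4 (by decide)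
    refine HRun.le (HRun.seq (b₁ := 1) (b₂ := i * 4 + 2 + 1) (R := fun τ' => τ' = τ.setI 28 1)
      (HRun.of_wp ?_) ?_) (by omega)
    · simp; omega
    rintro _ rfl
    refine HRun.seq (R := fun τ' => τ'.ivar 28 = preOff n r par i ∧ τ'.ivar 30 = i ∧
      τ'.ints 14 = τ.ints 14) ?_ ?_
    -- `g j` is the offset summed only over the older siblings below `j`, which is the content of
    -- the accumulator before pass `j`.
    · obtain ⟨g, hg⟩ : ∃ g : ℕ → ℕ,
          ∀ j, g j = 1 + ∑ u ∈ (olderSiblings r par i).filter (· < j), sz n r par u :=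
        ⟨_, fun _ => rfl⟩
      have hpart : ∀ j ≤ i, g j ≤ preOff n r par i := by
        intro j hj
        rw [hg, preOff]
        have := Finset.sum_le_sum_of_subset (f := sz n r par)
          (Finset.filter_subset (· < j) (olderSiblings r par i))
        omega
      have hle := preOff_le H hi
      refine HRun.for' (N := i) (fun j τ' => τ'.ivar 28 = g j) 2 ?_ (by omega) ?_
        (by decide) ?_ ?_
      · intro j _ τ' _ hF'
        exact ⟨trivial, (hF'.i 30 (by decide)).trans (by simpa using hx)⟩
      · simp [hg]
      · intro j hj τ' hI' hx' hF'
        have k2 := (hF'.i 2 (by decide)).trans f2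
        have k30 := (hF'.i 30 (by decide)).trans hx
        have k2' := (hF'.ai 2 (by decide)).trans q2
        have k4 := ((hF'.ai 4 (by decide)).trans q4)
        have hs : g (j + 1) = if j ≠ r ∧ par j = par i then g j + sz n r par j else g j := by
          rw [hg, hg]
          split_ifs with h
          · have : (olderSiblings r par i).filter (· < j + 1) =
                insert j ((olderSiblings r par i).filter (· < j)) := by
              ext u
              simp only [olderSiblings, Finset.mem_filter, Finset.mem_range, Finset.mem_insert]
              grind
            rw [this, Finset.sum_insert (by simp)]
            omega
          · congr 2
            ext u
            simp only [olderSiblings, Finset.mem_filter, Finset.mem_range]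
            grind
        have h1 := hpart (j + 1) hj
        refine (HRun.of_wp ?_).le (show _ ≤ 2 by decide)
        simp [hx', k2, k30, k2', k4, hI', hsz j (by omega)]
        split_ifs at hs with h
        · exact ⟨fun _ _ => ⟨by omega, by omega⟩, fun h' => absurd h.2 (h' h.1)⟩
        · exact ⟨fun h1 h2 => absurd ⟨h1, h2⟩ h, fun _ => hs.symm⟩
      · intro τ' hI' hF'
        refine ⟨?_, (hF'.i 30 (by decide)).trans (by simpa using hx), hF'.ai 14 (by decide)⟩
        rw [hI', hg, preOff]
        congr 2
        refine Finset.filter_true_of_mem fun u hu => ?_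
        simp only [olderSiblings, Finset.mem_filter, Finset.mem_range] at hu
        exact hu.1
    · rintro τ' ⟨h1, h2, h3⟩
      refine HRun.of_wp ?_
      simp [h1, h2, h3]
      grind [Function.update_apply]

theorem cmPre_run {B n m r : ℕ} {par dep : ℕ → ℕ} (H : RTree n r par dep)
    {σ : MState} (hB : BigWord B n m)
    (hn : σ.ivar 0 = n) (hr : σ.ivar 2 = r) (hpar : σ.ints 2 = par)
    (hsz : ∀ v < n, σ.ints 4 v = sz n r par v)
    (hoff : ∀ v < n, σ.ints 14 v = preOff n r par v) :
    HRun B cmPre σ (5 * (n * n) + 20 * n + 10) fun τ => ∀ v < n,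
      τ.ints 3 v = preNum n r par dep v ∧ τ.ints 6 v = rowKey n r par dep v * n := by
  unfold BigWord at hB
  refine HRun.le (HRun.for' (N := n) (fun i τ => ∀ v < i, τ.ints 3 v = preNum n r par dep v ∧
    τ.ints 6 v = rowKey n r par dep v * n) (5 * n + 10) ?_ (by omega) (by simp) (by decide) ?_
    fun τ h _ => h) (by nlinarith)
  · intro i _ τ _ hF
    exact ⟨trivial, (hF.i 0 (by decide)).trans hn⟩
  · intro i hi τ hI hx hF
    have f0 := (hF.i 0 (by decide)).trans hn
    have f2 := (hF.i 2 (by decide)).trans hr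
    have q2 := (hF.ai 2 (by decide)).trans hpar
    have q4 := hF.ai 4 (by decide)
    have q14 := hF.ai 14 (by decide)
    have hdi := H.dep_lt hi
    refine HRun.le (HRun.seq (b₁ := 3) (b₂ := 5 * dep i + 1 + 3)
      (R := fun τ' => τ' = ((τ.setI 26 i).setI 27 0).setI 28 0) (HRun.of_wp ?_) ?_) (by omega)
    · simp [hx]; omega
    rintro _ rfl
    refine HRun.seq (R := fun τ' => τ'.ivar 28 = preNum n r par dep i ∧
      τ'.ivar 27 = lightCount n r par dep i ∧ τ'.ivar 30 = i ∧ τ'.ivar 0 = n ∧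
      τ'.ints 3 = τ.ints 3 ∧ τ'.ints 6 = τ.ints 6 ∧ τ'.ints 2 = par ∧ τ'.ints 4 = σ.ints 4) ?_ ?_
    · refine HRun.while' (fun b τ' => ∃ x, τ'.ivar 26 = x ∧ Anc r par x i ∧
        τ'.ivar 28 + preNum n r par dep x = preNum n r par dep i ∧
        τ'.ivar 27 + lightCount n r par dep x = lightCount n r par dep i ∧
        b = 5 * dep x + 1) ?_ ?_ ?_ ?_
      · exact ⟨i, by simp, anc_refl _, by simp, by simp, rfl⟩
      · intro b τ' _ _
        exact ⟨trivial, trivial⟩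
      · rintro b τ' ⟨x, h26, hxi, h28, h27, rfl⟩ hF' hc
        have k2 := (hF'.i 2 (by decide)).trans (by simpa using f2)
        have k2' := (hF'.ai 2 (by decide)).trans q2
        have k4 := (hF'.ai 4 (by decide)).trans q4
        have k14 := (hF'.ai 14 (by decide)).trans q14
        simp only [Cd.holds, Ex.eval, h26, k2] at hc
        have hxn := H.anc_lt hxi hi
        have hd := H.dep_par x hxn hc
        have hcs := H.lightCount_par hxn hc
        have hp := H.preNum_par hxn hc
        have hpn := H.par_lt x hxn
        have s1 := hsz x hxn
        have s2 := hsz _ hpn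
        have s3 := hoff x hxn
        have s4 := RTree.sz_le (n := n) (r := r) (par := par) x
        have s5 := H.preNum_lt hi
        have s6 := H.lightCount_le hi
        have s7 := Nat.log_le_self 2 n
        refine ⟨4, 5 * dep (par x) + 1, by omega, (HRun.of_wp ?_).le (show _ ≤ 4 by decide)⟩
        simp [h26, k2', k4, k14, s1, s2, s3]
        have s8 : Anc r par (par x) i := (anc_par hc).trans hxi
        refine ⟨by omega, by omega, fun h => ⟨s8, by omega, ?_⟩, fun h =>
          ⟨by omega, s8, by omega, ?_⟩⟩
        · rw [if_neg (by unfold Light; omega)] at hcs; omega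
        · rw [if_pos (by unfold Light; omega)] at hcs; omega
      · rintro b τ' ⟨x, h26, hxi, h28, h27, rfl⟩ hF' hc
        have k2 := (hF'.i 2 (by decide)).trans (by simpa using f2)
        simp only [Cd.holds, Ex.eval, h26, k2, not_not] at hc
        subst hc
        rw [H.preNum_r] at h28
        rw [lightCount, H.climbSum_r] at h27
        exact ⟨by omega, by omega, by omega, (hF'.i 30 (by decide)).trans (by simpa using hx),
          (hF'.i 0 (by decide)).trans (by simpa using f0), hF'.ai 3 (by decide),
          hF'.ai 6 (by decide), (hF'.ai 2 (by decide)).trans q2,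
          (hF'.ai 4 (by decide)).trans q4⟩
    · rintro τ' ⟨h1, h2, h3, h4, h5, h6, h7, h8⟩
      have s1 := hsz i hi
      have s2 := hsz _ (H.par_lt i hi)
      have s4 := RTree.sz_le (n := n) (r := r) (par := par) i
      have s6 := H.lightCount_le hi
      have s7 := Nat.log_le_self 2 n
      have s8 : (lightCount n r par dep i + lightCount n r par dep i + 1) * n ≤
          (2 * n + 1) * n := Nat.mul_le_mul (by omega) le_rfl
      have s9 : (lightCount n r par dep i + lightCount n r par dep i) * n ≤
          (2 * n + 1) * n := Nat.mul_le_mul (by omega) le_rfl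
      have s10 : (2 * n + 1) * n = 2 * (n * n) + n := by ring
      refine (HRun.of_wp ?_).le (show _ ≤ 3 by decide)
      simp [h1, h2, h3, h4, h5, h6, h7, h8, s1, s2]
      refine ⟨by omega, fun h => ⟨by omega, ?_⟩, fun h => ⟨by omega, ?_⟩⟩
      · have hk : rowKey n r par dep i = lightCount n r par dep i + lightCount n r par dep i + 1 := by
          rw [rowKey, if_neg (by unfold Light; omega)]; omega
        rw [← hk]
        grind [Function.update_apply]
      · have hk : rowKey n r par dep i = lightCount n r par dep i + lightCount n r par dep i := by
          rw [rowKey, if_pos (by unfold Light; omega)]; omega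
        rw [← hk]
        grind [Function.update_apply]

/-- The tables about the tree that are part of the oracle. -/
structure TreeTables (n r : ℕ) (par dep : ℕ → ℕ) (pw : ℕ → ℝ) (σ : MState) : Prop where
  parent : ∀ v < n, σ.ints 2 v = par v
  pre : ∀ v < n, σ.ints 3 v = preNum n r par dep v
  size : ∀ v < n, σ.ints 4 v = sz n r par v
  depth : ∀ v < n, σ.ints 5 v = dep v
  row : ∀ v < n, σ.ints 6 v = rowKey n r par dep v * n
  count : σ.ints 10 0 = n
  dist : ∀ v < n, σ.reals 1 v = climbSum par dep pw v

/-- The memory after the preprocessing of the tree. -/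
structure Prepared (n m r : ℕ) (par dep : ℕ → ℕ) (pw : ℕ → ℝ) (aS aD : ℕ → ℕ) (aW : ℕ → ℝ)
    (σ : MState) : Prop extends TreeTables n r par dep pw σ where
  i0 : σ.ivar 0 = n
  i1 : σ.ivar 1 = m
  i2 : σ.ivar 2 = r
  i3 : σ.ivar 3 = 2 * m
  src : ∀ q < 2 * m, σ.ints 11 q = aS q
  dst : ∀ q < 2 * m, σ.ints 12 q = aD q
  child : ∀ q < 2 * m, σ.ints 13 q = arcChild n r par (aS q) (aD q)
  wt : ∀ q < 2 * m, σ.reals 4 q = aW q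

/-- Where the tables about the tree are. -/
def treeCells : List (ℕ × ℕ) := [(2, 2), (2, 3), (2, 4), (2, 5), (2, 6), (2, 10), (3, 1)]

/-- Where the results of the preprocessing are. -/
def prepCells : List (ℕ × ℕ) :=
  treeCells ++ [(0, 0), (0, 1), (0, 2), (0, 3), (2, 11), (2, 12), (2, 13), (3, 4)]

theorem TreeTables.frame {n r : ℕ} {par dep : ℕ → ℕ} {pw : ℕ → ℝ} {σ τ : MState}
    (h : TreeTables n r par dep pw σ) {W : List (ℕ × ℕ)} (hF : Frame W σ τ)
    (hW : ∀ x ∈ treeCells, x ∉ W) : TreeTables n r par dep pw τ := by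
  have h2 := hF.ai 2 (hW _ (by decide))
  have h3 := hF.ai 3 (hW _ (by decide))
  have h4 := hF.ai 4 (hW _ (by decide))
  have h5 := hF.ai 5 (hW _ (by decide))
  have h6 := hF.ai 6 (hW _ (by decide))
  have h10 := hF.ai 10 (hW _ (by decide))
  have h1 := hF.ar 1 (hW _ (by decide))
  constructor
  · rw [h2]; exact h.parent
  · rw [h3]; exact h.pre
  · rw [h4]; exact h.size
  · rw [h5]; exact h.depth
  · rw [h6]; exact h.row
  · rw [h10]; exact h.count
  · rw [h1]; exact h.dist

theorem Prepared.frame {n m r : ℕ} {par dep : ℕ → ℕ} {pw : ℕ → ℝ} {aS aD : ℕ → ℕ} {aW : ℕ → ℝ}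
    {σ τ : MState} (h : Prepared n m r par dep pw aS aD aW σ) {W : List (ℕ × ℕ)}
    (hF : Frame W σ τ) (hW : ∀ x ∈ prepCells, x ∉ W) :
    Prepared n m r par dep pw aS aD aW τ := by
  have h0 := hF.i 0 (hW _ (by decide))
  have h1 := hF.i 1 (hW _ (by decide))
  have h2 := hF.i 2 (hW _ (by decide))
  have h3 := hF.i 3 (hW _ (by decide))
  have h11 := hF.ai 11 (hW _ (by decide))
  have h12 := hF.ai 12 (hW _ (by decide))
  have h13 := hF.ai 13 (hW _ (by decide))
  have h4 := hF.ar 4 (hW _ (by decide))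
  refine ⟨h.toTreeTables.frame hF fun x hx => hW x (List.mem_append_left _ hx), h0.trans h.i0,
    h1.trans h.i1, h2.trans h.i2, h3.trans h.i3, ?_, ?_, ?_, ?_⟩
  · rw [h11]; exact h.src
  · rw [h12]; exact h.dst
  · rw [h13]; exact h.child
  · rw [h4]; exact h.wt

/-- The preprocessing of the tree. -/
def cmPrep : Cm := cmArcs ;; cmChild ;; cmClimb ;; cmOff ;; cmPre ;; .st 10 (.c 0) (.v 0)

theorem cmPrep_run {B n m r : ℕ} {par dep : ℕ → ℕ} {pw : ℕ → ℝ} {ea eb : ℕ → ℕ} {ew : ℕ → ℝ}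
    (N : Net n (2 * m) r par dep pw (twoWay m ea eb) (twoWay m eb ea) (twoWay m ew ew))
    {σ : MState} (hB : BigWord B n m) (hn : σ.ivar 0 = n) (hm : σ.ivar 1 = m) (hr : σ.ivar 2 = r)
    (hea : σ.ints 0 = ea) (heb : σ.ints 1 = eb) (hew : σ.reals 0 = ew) (hpar : σ.ints 2 = par) :
    HRun B cmPrep σ (15 * (n * n) + 50 * n + 28 * m + 50)
      (Prepared n m r par dep pw (twoWay m ea eb) (twoWay m eb ea) (twoWay m ew ew)) := by
  have hB' : BigWord B 0 m := by unfold BigWord at *; omega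
  have hB'' := hB
  unfold BigWord at hB''
  refine HRun.le (HRun.seq (cmArcs_run hB' hm).frame fun σ₁ h₁ => HRun.seq
    (cmChild_run N hB ((h₁.2.i 0 (by decide)).trans hn) ((h₁.2.i 1 (by decide)).trans hm)
      ((h₁.2.i 2 (by decide)).trans hr) ((h₁.2.ai 2 (by decide)).trans hpar)
      (fun q hq => by rw [(h₁.1 q hq).1, hea, heb]) (fun q hq => by rw [(h₁.1 q hq).2.1, hea, heb])
      (fun q hq => by rw [(h₁.1 q hq).2.2, hew])).frame fun σ₂ h₂ => ?_) (b₁ := m * 8 + 2 +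
      ((m * 20 + 10) + ((6 * (n * n) + 20 * n + 10) + ((4 * (n * n) + 10 * n + 10) +
        ((5 * (n * n) + 20 * n + 10) + 1))))) (by omega)
  have a0 := (h₂.2.i 0 (by decide)).trans ((h₁.2.i 0 (by decide)).trans hn)
  have a1 := (h₂.2.i 1 (by decide)).trans ((h₁.2.i 1 (by decide)).trans hm)
  have a2 := (h₂.2.i 2 (by decide)).trans ((h₁.2.i 2 (by decide)).trans hr)
  have b2 := (h₂.2.ai 2 (by decide)).trans ((h₁.2.ai 2 (by decide)).trans hpar)
  refine HRun.seq (cmClimb_run N.tree hB a0 a2 b2 h₂.1.2.2).frame fun σ₃ h₃ => ?_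
  refine HRun.seq (cmOff_run N.tree hB ((h₃.2.i 0 (by decide)).trans a0)
    ((h₃.2.i 2 (by decide)).trans a2) ((h₃.2.ai 2 (by decide)).trans b2)
    (fun v hv => (h₃.1 v hv).2.2)).frame fun σ₄ h₄ => ?_
  have c0 := (h₄.2.i 0 (by decide)).trans ((h₃.2.i 0 (by decide)).trans a0)
  have c1 := (h₄.2.i 1 (by decide)).trans ((h₃.2.i 1 (by decide)).trans a1)
  have c2 := (h₄.2.i 2 (by decide)).trans ((h₃.2.i 2 (by decide)).trans a2)
  have c3 := (h₄.2.i 3 (by decide)).trans ((h₃.2.i 3 (by decide)).trans h₂.1.1)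
  have d2 := (h₄.2.ai 2 (by decide)).trans ((h₃.2.ai 2 (by decide)).trans b2)
  have d4 := h₄.2.ai 4 (by decide)
  refine HRun.seq (cmPre_run N.tree hB c0 c2 d2 (fun v hv => by rw [d4]; exact (h₃.1 v hv).2.2)
    h₄.1).frame fun σ₅ h₅ => ?_
  have e2 := (h₅.2.ai 2 (by decide)).trans d2
  have e4 := (h₅.2.ai 4 (by decide)).trans d4
  have e5 := (h₅.2.ai 5 (by decide)).trans (h₄.2.ai 5 (by decide))
  have e1 := (h₅.2.ar 1 (by decide)).trans (h₄.2.ar 1 (by decide))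
  have e11 := (h₅.2.ai 11 (by decide)).trans ((h₄.2.ai 11 (by decide)).trans
    ((h₃.2.ai 11 (by decide)).trans (h₂.2.ai 11 (by decide))))
  have e12 := (h₅.2.ai 12 (by decide)).trans ((h₄.2.ai 12 (by decide)).trans
    ((h₃.2.ai 12 (by decide)).trans (h₂.2.ai 12 (by decide))))
  have e13 := (h₅.2.ai 13 (by decide)).trans ((h₄.2.ai 13 (by decide)).trans
    (h₃.2.ai 13 (by decide)))
  have er4 := (h₅.2.ar 4 (by decide)).trans ((h₄.2.ar 4 (by decide)).trans
    ((h₃.2.ar 4 (by decide)).trans (h₂.2.ar 4 (by decide))))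
  have f0 := (h₅.2.i 0 (by decide)).trans c0
  refine HRun.of_wp ⟨by simp only [Ex.fits]; omega, trivial, ?_⟩
  refine ⟨⟨?_, ?_, ?_, ?_, ?_, ?_, ?_⟩, f0, (h₅.2.i 1 (by decide)).trans c1,
    (h₅.2.i 2 (by decide)).trans c2, (h₅.2.i 3 (by decide)).trans c3, ?_, ?_, ?_, ?_⟩
  all_goals simp [e2, e4, e5, e1, e11, e12, e13, er4, f0]
  · exact fun v hv => (h₅.1 v hv).1
  · exact fun v hv => (h₃.1 v hv).2.2
  · exact fun v hv => (h₃.1 v hv).1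
  · exact fun v hv => (h₅.1 v hv).2
  · exact fun v hv => (h₃.1 v hv).2.1
  · exact fun q hq => by rw [(h₁.1 q hq).1, hea, heb]
  · exact fun q hq => by rw [(h₁.1 q hq).2.1, hea, heb]
  · exact h₂.1.2.1
  · exact fun q hq => by rw [(h₁.1 q hq).2.2, hew]

/-! ### Classification of the vertices -/

/-- Set variable `8` to the class of the vertex in variable `6`. -/
def cmClassify : Cm :=
  7 ≔ .ld 3 (.v 6) ;;
  .ite (.not (.v 7 <ₑ .v 14) &ₑ .v 7 <ₑ .v 14 +ₑ .v 15)
    (.ite (.not (.v 7 <ₑ .v 16) &ₑ .v 7 <ₑ .v 16 +ₑ .v 17)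
      (.ite (.v 12 =ₑ .c 1) (8 ≔ .c 1) (8 ≔ .c 2))
      (.ite (.v 12 =ₑ .c 1) (8 ≔ .c 2) (8 ≔ .c 1)))
    (8 ≔ .c 0)

/-- Load the data about the pair of vertices in variables `9` and `10`. -/
def cmLoad : Cm :=
  14 ≔ .ld 3 (.v 9) ;; 15 ≔ .ld 4 (.v 9) ;; 16 ≔ .ld 3 (.v 10) ;; 17 ≔ .ld 4 (.v 10) ;;
  11 ≔ .ld 6 (.v 10) ;;
  .ite (.v 15 <ₑ .v 17 +ₑ .v 17) (12 ≔ .c 0 ;; 13 ≔ .v 10) (12 ≔ .c 1 ;; 13 ≔ .v 9)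

/-- The variables describe the pair of failed edges. -/
structure PairVars (n r : ℕ) (par dep : ℕ → ℕ) (v₁ v₂ : ℕ) (σ : MState) : Prop where
  valid : ValidPair n r par v₁ v₂
  range : v₁ = n + 1 ∧ σ.ivar 14 = 0 ∧ σ.ivar 15 = 0 ∧ σ.ivar 16 = 0 ∧ σ.ivar 17 = 0 ∨
    v₁ < n ∧ σ.ivar 14 = preNum n r par dep v₁ ∧ σ.ivar 15 = sz n r par v₁ ∧
      σ.ivar 16 = preNum n r par dep v₂ ∧ σ.ivar 17 = sz n r par v₂ ∧
      (σ.ivar 12 = 1 ↔ LowSmall n r par v₁ v₂) ∧ σ.ivar 13 = cfgTop n r par v₁ v₂ ∧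
      σ.ivar 11 = rowKey n r par dep v₂ * n

/-- The variables that describe the pair of failed edges. -/
def pairCells : List (ℕ × ℕ) := [(0, 11), (0, 12), (0, 13), (0, 14), (0, 15), (0, 16), (0, 17)]

section
variable {n r : ℕ} {par dep : ℕ → ℕ} {pw : ℕ → ℝ} {v₁ v₂ : ℕ} {σ τ : MState}

theorem PairVars.frame (h : PairVars n r par dep v₁ v₂ σ) {W : List (ℕ × ℕ)} (hF : Frame W σ τ)
    (hW : ∀ x ∈ pairCells, x ∉ W) : PairVars n r par dep v₁ v₂ τ := by
  refine ⟨h.valid, ?_⟩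
  rw [hF.i 11 (hW _ (by decide)), hF.i 12 (hW _ (by decide)), hF.i 13 (hW _ (by decide)),
    hF.i 14 (hW _ (by decide)), hF.i 15 (hW _ (by decide)), hF.i 16 (hW _ (by decide)),
    hF.i 17 (hW _ (by decide))]
  exact h.range

/-- By `RTree.anc_iff_preNum` two interval tests on preorder numbers decide on which sides of the
failed edges a vertex lies. For the empty failure all interval lengths are `0`, so everything
belongs to the part of the root. -/
theorem cmClassify_wp {B m : ℕ} (H : RTree n r par dep) (hB : BigWord B n m)
    (hT : TreeTables n r par dep pw σ) (hP : PairVars n r par dep v₁ v₂ σ) {y : ℕ} (hy : y < n)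
    (h6 : σ.ivar 6 = y) {Q : MState → Prop}
    (hQ : Q ((σ.setI 7 (preNum n r par dep y)).setI 8 (cfgCls n r par v₁ v₂ y))) :
    wp B cmClassify Q σ := by
  unfold BigWord at hB
  have hpre := hT.pre y hy
  rcases hP.range with ⟨h1, h14, h15, h16, h17⟩ | ⟨h1, h14, h15, h16, h17, h12, -, -⟩
  · have hc : cfgCls n r par v₁ v₂ y = 0 := by
      rw [cfgCls_eq_zero]
      intro h
      have := H.anc_lt h hy
      omega
    rw [hc] at hQ
    simp [cmClassify, h6, hpre, h14, h15, h16, h17]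
    exact ⟨by omega, hQ⟩
  · have h2 : v₂ < n := by rcases hP.valid with h | h <;> omega
    have e1 := H.anc_iff_preNum h1 hy
    have e2 := H.anc_iff_preNum h2 hy
    have e3 := H.preNum_lt h1
    have e4 := H.preNum_lt h2
    have e5 := RTree.sz_le (n := n) (r := r) (par := par) v₁
    have e6 := RTree.sz_le (n := n) (r := r) (par := par) v₂
    simp only [cmClassify, wp, Ex.fits, Ex.eval, Cd.holds, Cd.fits, MState.setI_ivar,
      h6, hpre, h14, h15, h16, h17, h12, reduceIte, Nat.reduceEqDiff, not_lt,
      ← e1, ← e2, true_and]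
    have f1 : 0 < B := by omega
    have f2 : 1 < B := by omega
    have f3 : 2 < B := by omega
    have f4 : preNum n r par dep v₁ + sz n r par v₁ < B := by omega
    have f5 : preNum n r par dep v₂ + sz n r par v₂ < B := by omega
    refine ⟨f4, fun h => ⟨f5, fun h' => ⟨f2, fun h'' => ⟨f2, ?_⟩, fun h'' => ⟨f3, ?_⟩⟩, fun h' =>
      ⟨f2, fun h'' => ⟨f3, ?_⟩, fun h'' => ⟨f2, ?_⟩⟩⟩, fun h => ⟨f1, ?_⟩⟩ <;> clear e1 e2 <;>
      simpa [cfgCls, h, *] using hQ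

theorem cmLoad_wp {B m : ℕ} (hB : BigWord B n m)
    (hT : TreeTables n r par dep pw σ) (hV : ValidPair n r par v₁ v₂) (h1 : v₁ < n)
    (h9 : σ.ivar 9 = v₁) (h10 : σ.ivar 10 = v₂) :
    wp B cmLoad (PairVars n r par dep v₁ v₂) σ := by
  unfold BigWord at hB
  have h2 : v₂ < n := by rcases hV with h | h <;> omega
  have e6 := RTree.sz_le (n := n) (r := r) (par := par) v₂
  simp [cmLoad, h9, h10, hT.pre v₁ h1, hT.pre v₂ h2, hT.size v₁ h1, hT.size v₂ h2, hT.row v₂ h2]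
  refine ⟨by omega, fun h => ⟨by omega, hV, .inr ?_⟩, fun h => ⟨by omega, hV, .inr ?_⟩⟩
  · have : ¬ LowSmall n r par v₁ v₂ := by unfold LowSmall; omega
    simp [h1, this, cfgTop]
  · have : LowSmall n r par v₁ v₂ := by unfold LowSmall; omega
    simp [h1, this, cfgTop]

end

/-! ### The construction for one failure -/

/-- Everything that is known about the memory while one failure is treated, whose entry arc is
stored at index `f`. -/
structure CfgEnv (n m r : ℕ) (par dep : ℕ → ℕ) (pw : ℕ → ℝ) (aS aD : ℕ → ℕ) (aW : ℕ → ℝ)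
    (v₁ v₂ f : ℕ) (σ : MState) : Prop extends Prepared n m r par dep pw aS aD aW σ,
    PairVars n r par dep v₁ v₂ σ where
  v1_lt : v₁ < n
  i4 : σ.ivar 4 = f
  i9 : σ.ivar 9 = v₁
  i10 : σ.ivar 10 = v₂

/-- Where the facts of `CfgEnv` are. -/
def envCells : List (ℕ × ℕ) := prepCells ++ pairCells ++ [(0, 4), (0, 9), (0, 10)]

/-- The class array is correct. -/
def ClassArray (n r : ℕ) (par : ℕ → ℕ) (v₁ v₂ : ℕ) (σ : MState) : Prop :=
  ∀ y < n, σ.ints 15 y = cfgCls n r par v₁ v₂ y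

/-- The memory holds the state of the construction for the failure; `kb` is the start of the
table row. -/
structure CfgMem (n r : ℕ) (par dep : ℕ → ℕ) (d : ℕ → ℝ) (E : ℕ → ℕ → ℝ → Prop) (cls : ℕ → ℕ)
    (τ kb f : ℕ) (σ : MState) : Prop where
  inv : CfgInv n r par dep d E cls τ (fun y => σ.ints 7 (kb + y)) (fun y => σ.reals 2 (kb + y))
    (σ.ints 8 f) (σ.ints 9 f) (σ.reals 3 f)
  flag : ∀ y < n, (σ.ints 16 y = 1 ↔ Settled cls (fun y => σ.ints 7 (kb + y)) (σ.ints 8 f) y)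
  val : ∀ y < n, σ.ints 16 y = 1 → σ.reals 6 y =
    settledVal d cls τ (fun y => σ.reals 2 (kb + y)) (σ.ints 8 f) (σ.reals 3 f) y

/-- What belongs to other failures is unchanged. -/
def Untouched (n kb : ℕ) (cls : ℕ → ℕ) (f : ℕ) (σ τ : MState) : Prop :=
  (∀ j, (∀ y < n, cls y = 1 → j ≠ kb + y) →
    τ.ints 7 j = σ.ints 7 j ∧ τ.reals 2 j = σ.reals 2 j) ∧
  ∀ j ≠ f, τ.ints 8 j = σ.ints 8 j ∧ τ.ints 9 j = σ.ints 9 j ∧ τ.reals 3 j = σ.reals 3 j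

theorem Untouched.trans {n kb : ℕ} {cls : ℕ → ℕ} {f : ℕ} {σ τ υ : MState}
    (h : Untouched n kb cls f σ τ) (h' : Untouched n kb cls f τ υ) : Untouched n kb cls f σ υ :=
  ⟨fun j hj => ⟨(h'.1 j hj).1.trans (h.1 j hj).1, (h'.1 j hj).2.trans (h.1 j hj).2⟩,
    fun j hj => ⟨(h'.2 j hj).1.trans (h.2 j hj).1, (h'.2 j hj).2.1.trans (h.2 j hj).2.1,
      (h'.2 j hj).2.2.trans (h.2 j hj).2.2⟩⟩

/-- Where the results for the failures are. -/
def storeCells : List (ℕ × ℕ) := [(2, 7), (2, 8), (2, 9), (3, 2), (3, 3)]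

theorem Untouched.of_frame {n kb : ℕ} {cls : ℕ → ℕ} {f : ℕ} {σ τ : MState} {W : List (ℕ × ℕ)}
    (hF : Frame W σ τ) (hW : ∀ x ∈ storeCells, x ∉ W) : Untouched n kb cls f σ τ := by
  refine ⟨fun j _ => ?_, fun j _ => ?_⟩
  · rw [hF.ai 7 (hW _ (by decide)), hF.ar 2 (hW _ (by decide))]; exact ⟨rfl, rfl⟩
  · rw [hF.ai 8 (hW _ (by decide)), hF.ai 9 (hW _ (by decide)), hF.ar 3 (hW _ (by decide))]
    exact ⟨rfl, rfl, rfl⟩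

/-- The arc does not fail. -/
def LiveIdx (n r : ℕ) (par aS aD : ℕ → ℕ) (v₁ v₂ q : ℕ) : Prop :=
  arcChild n r par (aS q) (aD q) ≠ v₁ ∧ arcChild n r par (aS q) (aD q) ≠ v₂

/-- The arc touches the small part. -/
def TouchIdx (cls aS aD : ℕ → ℕ) (q : ℕ) : Prop := cls (aS q) = 1 ∨ cls (aD q) = 1

/-- The arc leads from the part of the root to the large part. -/
def CrossIdx (cls aS aD : ℕ → ℕ) (q : ℕ) : Prop := cls (aS q) = 0 ∧ cls (aD q) = 2

open Classical in
/-- The arcs that touch the small part. -/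
noncomputable def touchArcs (m : ℕ) (cls aS aD : ℕ → ℕ) : Finset ℕ :=
  (Finset.range (2 * m)).filter (TouchIdx cls aS aD)

/-- The list of arcs is complete and short. -/
structure ArcList (n m r : ℕ) (par aS aD : ℕ → ℕ) (aW : ℕ → ℝ) (d : ℕ → ℝ) (v₁ v₂ : ℕ)
    (cls : ℕ → ℕ) (k : ℕ) (l : ℕ → ℕ) : Prop where
  sound : ∀ i < k, l i < 2 * m ∧ LiveIdx n r par aS aD v₁ v₂ (l i)
  touch : ∀ q < 2 * m, LiveIdx n r par aS aD v₁ v₂ q → TouchIdx cls aS aD q → ∃ i < k, l i = q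
  cross : ∀ q < 2 * m, LiveIdx n r par aS aD v₁ v₂ q → CrossIdx cls aS aD q →
    ∃ i < k, CrossIdx cls aS aD (l i) ∧ d (aS (l i)) + aW (l i) ≤ d (aS q) + aW q
  short : k ≤ (touchArcs m cls aS aD).card + 1

/-- Classify all vertices and give values to those that are still reached by the tree. -/
def cmInit : Cm :=
  .for 6 (.v 0) (cmClassify ;; .st 15 (.v 6) (.v 8) ;;
    .ite (.v 8 =ₑ .c 0) (.st 16 (.v 6) (.c 1) ;; .rst 6 (.v 6) (.ld 1 (.v 6)))
      (.st 16 (.v 6) (.c 0) ;;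
        .ite (.v 8 =ₑ .c 1) (.st 7 (.v 11 +ₑ .v 6) (.c 0)) .skip)) ;;
  .st 8 (.v 4) (.c 0)

/-- Select the arcs that touch the small part, and the best arc into the large part. -/
def cmFilter : Cm :=
  (18 ≔ .c 0 ;; 19 ≔ .c 0) ;;
  .for 5 (.v 3)
    (27 ≔ .ld 13 (.v 5) ;; 21 ≔ .ld 11 (.v 5) ;; 22 ≔ .ld 12 (.v 5) ;;
     .ite (.not (.v 27 =ₑ .v 9) &ₑ .not (.v 27 =ₑ .v 10))
      (.ite (.or (.ld 15 (.v 21) =ₑ .c 1) (.ld 15 (.v 22) =ₑ .c 1))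
        (.st 17 (.v 18) (.v 5) ;; 18 ≔ .v 18 +ₑ .c 1)
        (.ite (.ld 15 (.v 21) =ₑ .c 0 &ₑ .ld 15 (.v 22) =ₑ .c 2)
          (2 ≔ᵣ .ld 1 (.v 21) +ᵣ .ld 4 (.v 5) ;;
           .ite (.or (.v 19 =ₑ .c 0) (.v 2 <ᵣ .v 1)) (19 ≔ .c 1 ;; 20 ≔ .v 5 ;; 1 ≔ᵣ .v 2) .skip)
          .skip))
      .skip) ;;
  .ite (.v 19 =ₑ .c 1) (.st 17 (.v 18) (.v 20) ;; 18 ≔ .v 18 +ₑ .c 1) .skip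

/-- Find the best arc from a vertex with a value to a vertex without a value. -/
def cmScan : Cm :=
  19 ≔ .c 0 ;;
  .for 25 (.v 18)
    (27 ≔ .ld 17 (.v 25) ;; 21 ≔ .ld 11 (.v 27) ;; 22 ≔ .ld 12 (.v 27) ;;
     .ite (.ld 16 (.v 21) =ₑ .c 1 &ₑ .not (.ld 16 (.v 22) =ₑ .c 1))
      (2 ≔ᵣ .ld 6 (.v 21) +ᵣ .ld 4 (.v 27) ;;
       .ite (.or (.v 19 =ₑ .c 0) (.v 2 <ᵣ .v 1))
        (19 ≔ .c 1 ;; 23 ≔ .v 21 ;; 24 ≔ .v 22 ;; 1 ≔ᵣ .v 2) .skip)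
      .skip)

/-- Use the arc that was found. -/
def cmSettle : Cm :=
  .ite (.ld 15 (.v 24) =ₑ .c 1)
    (.st 16 (.v 24) (.c 1) ;; .rst 6 (.v 24) (.v 1) ;;
     .st 7 (.v 11 +ₑ .v 24) (.v 23 +ₑ .c 1) ;; .rst 2 (.v 11 +ₑ .v 24) (.v 1))
    ((.st 8 (.v 4) (.v 24 +ₑ .c 1) ;; .st 9 (.v 4) (.v 23) ;; .rst 3 (.v 4) (.v 1)) ;;
     .for 6 (.v 0)
      (.ite (.ld 15 (.v 6) =ₑ .c 2)
        (.st 16 (.v 6) (.c 1) ;;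
         .rst 6 (.v 6)
          (.v 1 +ᵣ (.ld 1 (.v 24) -ᵣ .ld 1 (.v 13)) +ᵣ (.ld 1 (.v 6) -ᵣ .ld 1 (.v 13))))
        .skip))

/-- The construction for one failure. -/
def cmConfig : Cm :=
  cmInit ;; cmFilter ;; 19 ≔ .c 1 ;;
  .while (.v 19 =ₑ .c 1) (cmScan ;; .ite (.v 19 =ₑ .c 1) cmSettle .skip)

/-! ### Initialization and selection of arcs -/

section
variable {B n m r : ℕ} {par dep : ℕ → ℕ} {pw : ℕ → ℝ} {aS aD : ℕ → ℕ} {aW : ℕ → ℝ}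
  {v₁ v₂ f : ℕ} {σ τ : MState}

open Classical in
theorem card_touchArcs_le (m : ℕ) (cls aS aD : ℕ → ℕ) : (touchArcs m cls aS aD).card ≤ 2 * m := by
  rw [touchArcs]
  refine le_trans ?_ (Finset.card_range (2 * m)).le
  exact Finset.card_le_card (Finset.filter_subset _ _)

theorem CfgEnv.frame (h : CfgEnv n m r par dep pw aS aD aW v₁ v₂ f σ) {W : List (ℕ × ℕ)}
    (hF : Frame W σ τ) (hW : ∀ x ∈ envCells, x ∉ W) :
    CfgEnv n m r par dep pw aS aD aW v₁ v₂ f τ := by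
  refine ⟨h.toPrepared.frame hF fun x hx => hW x ?_, h.toPairVars.frame hF fun x hx => hW x ?_,
    h.v1_lt, (hF.i 4 (hW _ (by decide))).trans h.i4, (hF.i 9 (hW _ (by decide))).trans h.i9,
    (hF.i 10 (hW _ (by decide))).trans h.i10⟩ <;> simp [envCells, hx]

theorem CfgEnv.v2_lt (h : CfgEnv n m r par dep pw aS aD aW v₁ v₂ f σ) : v₂ < n := by
  have := h.v1_lt
  rcases h.valid with h | h <;> omega

theorem CfgEnv.i13 (h : CfgEnv n m r par dep pw aS aD aW v₁ v₂ f σ) :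
    σ.ivar 13 = cfgTop n r par v₁ v₂ := by
  have := h.v1_lt
  rcases h.range with h | h
  · omega
  · exact h.2.2.2.2.2.2.1

theorem CfgEnv.i11 (h : CfgEnv n m r par dep pw aS aD aW v₁ v₂ f σ) :
    σ.ivar 11 = rowKey n r par dep v₂ * n := by
  have := h.v1_lt
  rcases h.range with h | h
  · omega
  · exact h.2.2.2.2.2.2.2

theorem RTree.row_le (H : RTree n r par dep) {v : ℕ} (hv : v < n) :
    rowKey n r par dep v * n ≤ 2 * (n * n) + n := by
  have h1 := H.rowKey_lt hv
  have h2 := Nat.log_le_self 2 n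
  calc rowKey n r par dep v * n ≤ (2 * n + 1) * n := Nat.mul_le_mul_right _ (by omega)
    _ = _ := by ring

/-- Only the cells of the small part are cleared in the row, since the other cells of that row may
hold results of other failures. -/
theorem cmInit_run (N : Net n (2 * m) r par dep pw aS aD aW) (hB : BigWord B n m)
    (hE : CfgEnv n m r par dep pw aS aD aW v₁ v₂ f σ) :
    HRun B cmInit σ (n * 14 + 3) fun τ => ClassArray n r par v₁ v₂ τ ∧
      CfgMem n r par dep (climbSum par dep pw) (LiveArc n (2 * m) r par aS aD aW v₁ v₂)
        (cfgCls n r par v₁ v₂) (cfgTop n r par v₁ v₂) (rowKey n r par dep v₂ * n) f τ ∧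
      Untouched n (rowKey n r par dep v₂ * n) (cfgCls n r par v₁ v₂) f σ τ := by
  have hB' := hB
  unfold BigWord at hB'
  have hkb := N.tree.row_le (dep := dep) hE.v2_lt
  set kb := rowKey n r par dep v₂ * n with hkb'
  set cls := cfgCls n r par v₁ v₂ with hcls
  refine HRun.seq (b₁ := n * 14 + 2) (b₂ := 1) (R := fun τ => (∀ y < n, τ.ints 15 y = cls y ∧
      (cls y = 0 → τ.ints 16 y = 1 ∧ τ.reals 6 y = climbSum par dep pw y) ∧
      (cls y ≠ 0 → τ.ints 16 y = 0) ∧ (cls y = 1 → τ.ints 7 (kb + y) = 0)) ∧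
      (∀ j, (∀ y < n, cls y = 1 → j ≠ kb + y) → τ.ints 7 j = σ.ints 7 j) ∧ τ.ivar 4 = f ∧
      Frame [(0, 6), (0, 7), (0, 8), (2, 15), (2, 16), (2, 7), (3, 6)] σ τ) ?_ ?_
  · refine HRun.for' (N := n) (fun i τ => (∀ y < i, τ.ints 15 y = cls y ∧
      (cls y = 0 → τ.ints 16 y = 1 ∧ τ.reals 6 y = climbSum par dep pw y) ∧
      (cls y ≠ 0 → τ.ints 16 y = 0) ∧ (cls y = 1 → τ.ints 7 (kb + y) = 0)) ∧
      ∀ j, (∀ y < n, cls y = 1 → j ≠ kb + y) → τ.ints 7 j = σ.ints 7 j) 12 ?_ (by omega) ?_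
      (by decide) ?_ ?_
    · intro i _ τ _ hF
      exact ⟨trivial, (hE.frame hF (by decide)).i0⟩
    · exact ⟨fun j hj => by omega, fun _ _ => rfl⟩
    · rintro i hi τ ⟨hI, hU⟩ hx hF
      have e := hE.frame hF (by decide)
      have e1 := e.i11
      rw [← hkb'] at e1
      have e2 := e.dist i hi
      refine (HRun.of_wp ?_).le (show _ ≤ 12 by decide)
      refine cmClassify_wp N.tree hB e.toTreeTables e.toPairVars hi hx ?_
      rw [← hcls]
      simp [hx, e1, e2]
      refine ⟨by omega, fun h1 => ⟨by omega, ?_⟩, fun h1 => ⟨by omega, by omega, fun h2 => ⟨by omega, by omega, ?_⟩,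
        fun h2 => ?_⟩⟩ <;> grind [Function.update_apply]
    · intro τ hI hF
      exact ⟨hI.1, hI.2, (hE.frame hF (by decide)).i4, hF.mono (by decide)⟩
  · rintro τ ⟨h1, hU, h2, hF⟩
    refine HRun.of_wp ?_
    simp [h2]
    refine ⟨by omega, fun y hy => by simpa using (h1 y hy).1, ⟨?_, ?_, ?_⟩, ?_⟩
    · simp
      exact (N.cfg hE.valid).init fun y hy hc => (h1 y hy).2.2.2 hc
    · intro y hy
      obtain ⟨g1, g2, g3, g4⟩ := h1 y hy
      simp [Settled]
      by_cases hc : cls y = 0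
      · simp [hc, g2 hc]
      · simp [hc, g3 hc]
        exact fun h => by simpa using g4 h
    · intro y hy
      obtain ⟨g1, g2, g3, g4⟩ := h1 y hy
      simp
      intro h
      have hc : cls y = 0 := by
        by_contra hc
        have := g3 hc
        omega
      rw [settledVal, if_pos hc, (g2 hc).2]
    · refine ⟨fun j hj => ⟨by simpa using hU j hj, ?_⟩, fun j hj => ?_⟩
      · simp [hF.ar 2 (by decide)]
      · simp [hF.ai 8 (by decide), hF.ai 9 (by decide), hF.ar 3 (by decide), hj]

/-- The order of the arcs from the part of the root to the large part never changes, since the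
values of their sources are the tree distances. One best arc therefore represents all of them, and
the list is longer than the number of touching arcs by at most one. -/
theorem cmFilter_run (N : Net n (2 * m) r par dep pw aS aD aW) (hB : BigWord B n m)
    (hE : CfgEnv n m r par dep pw aS aD aW v₁ v₂ f σ) (hC : ClassArray n r par v₁ v₂ σ) :
    HRun B cmFilter σ (m * 28 + 10) fun τ => ArcList n m r par aS aD aW (climbSum par dep pw) v₁ v₂
      (cfgCls n r par v₁ v₂) (τ.ivar 18) (τ.ints 17) := by
  classical
  unfold BigWord at hB
  unfold ClassArray at hC
  set cls := cfgCls n r par v₁ v₂ with hcls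
  set d := climbSum par dep pw with hd
  refine HRun.le (HRun.seq (b₁ := 2) (b₂ := 2 * m * 14 + 2 + 3) (R := fun τ =>
    (τ.ivar 18 = 0 ∧ τ.ivar 19 = 0) ∧ Frame [(0, 18), (0, 19)] σ τ)
      (HRun.frame (HRun.of_wp (c := 18 ≔ .c 0 ;; 19 ≔ .c 0)  ?_)) ?_) (by omega)
  · simp; omega
  rintro σ₁ ⟨⟨k1, k2⟩, hF₁⟩
  replace hE := hE.frame hF₁ (by decide)
  rw [← hF₁.ai 15 (by decide)] at hC
  refine HRun.seq (R := fun τ =>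
      (∀ j < τ.ivar 18, τ.ints 17 j < 2 * m ∧ LiveIdx n r par aS aD v₁ v₂ (τ.ints 17 j)) ∧
      (∀ q < 2 * m, LiveIdx n r par aS aD v₁ v₂ q → TouchIdx cls aS aD q →
        ∃ j < τ.ivar 18, τ.ints 17 j = q) ∧ τ.ivar 18 ≤ (touchArcs m cls aS aD).card ∧
      (τ.ivar 19 ≠ 1 → ∀ q < 2 * m, LiveIdx n r par aS aD v₁ v₂ q → ¬ CrossIdx cls aS aD q) ∧
      (τ.ivar 19 = 1 → τ.ivar 20 < 2 * m ∧ LiveIdx n r par aS aD v₁ v₂ (τ.ivar 20) ∧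
        CrossIdx cls aS aD (τ.ivar 20) ∧ 
        ∀ q < 2 * m, LiveIdx n r par aS aD v₁ v₂ q → CrossIdx cls aS aD q →
          d (aS (τ.ivar 20)) + aW (τ.ivar 20) ≤ d (aS q) + aW q)) ?_ ?_
  · refine HRun.for' (N := 2 * m) (fun i τ =>
      (∀ j < τ.ivar 18, τ.ints 17 j < i ∧ LiveIdx n r par aS aD v₁ v₂ (τ.ints 17 j)) ∧
      (∀ q < i, LiveIdx n r par aS aD v₁ v₂ q → TouchIdx cls aS aD q →
        ∃ j < τ.ivar 18, τ.ints 17 j = q) ∧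
      τ.ivar 18 ≤ ((Finset.range i).filter (TouchIdx cls aS aD)).card ∧
      (τ.ivar 19 = 0 ∧ (∀ q < i, LiveIdx n r par aS aD v₁ v₂ q → ¬ CrossIdx cls aS aD q) ∨
      τ.ivar 19 = 1 ∧ τ.ivar 20 < i ∧ LiveIdx n r par aS aD v₁ v₂ (τ.ivar 20) ∧
        CrossIdx cls aS aD (τ.ivar 20) ∧ τ.rvar 1 = d (aS (τ.ivar 20)) + aW (τ.ivar 20) ∧
        ∀ q < i, LiveIdx n r par aS aD v₁ v₂ q → CrossIdx cls aS aD q →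
          τ.rvar 1 ≤ d (aS q) + aW q)) 12 ?_ (by omega) ?_ (by decide) ?_ ?_
    · intro i _ τ _ hF
      exact ⟨trivial, (hF.i 3 (by decide)).trans hE.i3⟩
    · simp [k1, k2]
    · rintro i hi τ ⟨h1, h2, h3, h4⟩ hx hF
      have e := hE.frame hF (by decide)
      have e15 := hF.ai 15 (by decide)
      have c1 := hC _ (N.src_lt i hi)
      have c2 := hC _ (N.dst_lt i hi)
      rw [← e15] at c1 c2
      have b1 := e.src i hi
      have b2 := e.dst i hi
      have b3 := e.child i hi
      have b4 := e.wt i hi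
      have b5 := e.dist _ (N.src_lt i hi)
      have b9 := e.i9
      have b10 := e.i10
      have hk := h3.trans (Finset.card_filter_le _ _)
      rw [Finset.card_range] at hk
      have hcard : ((Finset.range (i + 1)).filter (TouchIdx cls aS aD)).card =
          ((Finset.range i).filter (TouchIdx cls aS aD)).card +
            if TouchIdx cls aS aD i then 1 else 0 := by
        rw [Finset.range_add_one, Finset.filter_insert]
        split_ifs with h
        · rw [Finset.card_insert_of_notMem (by simp)]
        · rfl
      refine (HRun.of_wp ?_).le (show _ ≤ 12 by decide)
      simp [hx, b1, b2, b3, b4, b5, b9, b10, c1, c2]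
      rw [← hd]
      have hL : LiveIdx n r par aS aD v₁ v₂ i ↔ ¬ arcChild n r par (aS i) (aD i) = v₁ ∧
        ¬ arcChild n r par (aS i) (aD i) = v₂ := Iff.rfl
      have hT : TouchIdx cls aS aD i ↔ cls (aS i) = 1 ∨ cls (aD i) = 1 := Iff.rfl
      have hX : CrossIdx cls aS aD i ↔ cls (aS i) = 0 ∧ cls (aD i) = 2 := Iff.rfl
      refine ⟨fun l1 l2 => ⟨by omega, fun ht => ⟨by omega, ?_⟩, fun t1 t2 => ⟨by omega, fun x1 x2 =>
        ⟨by omega, fun hb => ⟨by omega, ?_⟩, fun z hb => ?_⟩, fun hx => ?_⟩⟩, fun hl => ?_⟩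
      · refine ⟨by grind [Function.update_apply], fun q hq g1 g2 => ?_, by grind, by grind⟩
        rcases eq_or_lt_of_le hq with rfl | hq
        · exact ⟨_, le_rfl, by simp⟩
        · obtain ⟨j, hj, hj'⟩ := h2 q hq g1 g2
          exact ⟨j, hj.le, by rw [Function.update_of_ne hj.ne, hj']⟩
      · refine ⟨?_, ?_, ?_, ?_⟩ <;> grind
      · refine ⟨?_, ?_, ?_, ?_⟩ <;> grind
      · refine ⟨?_, ?_, ?_, ?_⟩ <;> grind
      · refine ⟨?_, ?_, ?_, ?_⟩ <;> grind
    · rintro τ ⟨h1, h2, h3, h4⟩ hF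
      refine ⟨h1, h2, h3, ?_, ?_⟩
      · rcases h4 with ⟨h, h'⟩ | ⟨h, -⟩
        · exact fun _ => h'
        · exact fun h' => absurd h h'
      · rcases h4 with ⟨h, h'⟩ | ⟨h, g1, g2, g3, g4, g5⟩
        · intro h'; omega
        · rw [g4] at g5
          exact fun _ => ⟨g1, g2, g3, g5⟩
  · rintro τ ⟨h1, h2, h3, h4, h5⟩
    refine (HRun.of_wp ?_).le (show _ ≤ 3 by decide)
    simp
    have hk := card_touchArcs_le m cls aS aD
    refine ⟨by omega, fun h => ⟨by omega, ?_, ?_, ?_, by omega⟩, fun h => ⟨h1, h2, ?_, by omega⟩⟩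
    · intro i hi
      have := h5 h
      by_cases hik : i = τ.ivar 18
      · subst hik
        simpa using ⟨this.1, this.2.1⟩
      · rw [Function.update_of_ne hik]
        exact h1 i (by omega)
    · intro q hq hl ht
      obtain ⟨j, hj, hj'⟩ := h2 q hq hl ht
      exact ⟨j, by omega, by rw [Function.update_of_ne hj.ne, hj']⟩
    · intro q hq hl hx
      obtain ⟨g1, g2, g3, g4⟩ := h5 h
      exact ⟨_, Nat.lt_succ_self _, by simpa using g3, by simpa using g4 q hq hl hx⟩
    · exact fun q hq hl hx => absurd hx (h4 h q hq hl)

end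

/-! ### Finding and using the best arc -/

section
variable {B n m r : ℕ} {par dep : ℕ → ℕ} {pw : ℕ → ℝ} {aS aD : ℕ → ℕ} {aW : ℕ → ℝ}
  {v₁ v₂ f : ℕ} {σ τ : MState}

theorem LiveIdx.liveArc {q : ℕ} (hq : q < 2 * m) (h : LiveIdx n r par aS aD v₁ v₂ q) :
    LiveArc n (2 * m) r par aS aD aW v₁ v₂ (aS q) (aD q) (aW q) :=
  ⟨q, hq, rfl, rfl, rfl, h.1, h.2⟩

/-- The best arc to a vertex without value is represented in the list. -/
theorem ArcList.exists_cross {d : ℕ → ℝ} {cls : ℕ → ℕ} {k : ℕ} {l : ℕ → ℕ}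
    (hA : ArcList n m r par aS aD aW d v₁ v₂ cls k l) {sp : ℕ → ℕ} {sv : ℕ → ℝ} {xs t : ℕ}
    {lam : ℝ} {q : ℕ} (hS : cls (aS q) ≤ 2) (hD : cls (aD q) ≤ 2) (hq : q < 2 * m)
    (hl : LiveIdx n r par aS aD v₁ v₂ q) (ha : Settled cls sp xs (aS q))
    (hb : ¬ Settled cls sp xs (aD q)) :
    ∃ i < k, Settled cls sp xs (aS (l i)) ∧ ¬ Settled cls sp xs (aD (l i)) ∧
      settledVal d cls t sv xs lam (aS (l i)) + aW (l i) ≤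
        settledVal d cls t sv xs lam (aS q) + aW q := by
  by_cases hT : TouchIdx cls aS aD q
  · obtain ⟨i, hi, rfl⟩ := hA.touch q hq hl hT
    exact ⟨i, hi, ha, hb, le_rfl⟩
  -- Outside the small part an unsettled target must be in the large part. That part is settled as a
  -- whole, so it has not been entered yet, and the source is in the part of the root.
  · have hX : CrossIdx cls aS aD q ∧ xs = 0 := by
      unfold TouchIdx at hT
      unfold CrossIdx
      unfold Settled at ha hb
      push Not at hT hb
      have h0 := hb.1
      have h2 : cls (aD q) = 2 := by omega
      have hx := hb.2.2 h2
      omega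
    obtain ⟨hX, rfl⟩ := hX
    obtain ⟨i, hi, h1, h2⟩ := hA.cross q hq hl hX
    refine ⟨i, hi, .inl h1.1, ?_, ?_⟩
    · simp [Settled, h1.2]
    · simpa [settledVal, h1.1, hX.1] using h2

/-- No arc leads from a vertex with a value to a vertex without a value. -/
def Closed (E : ℕ → ℕ → ℝ → Prop) (cls sp : ℕ → ℕ) (xs : ℕ) : Prop :=
  ∀ a b c, E a b c → Settled cls sp xs a → Settled cls sp xs b

/-- The arc from `a` to `b` of weight `c` is the best one from a vertex with a value to a vertex
without a value. -/
structure BestArc (E : ℕ → ℕ → ℝ → Prop) (cls sp : ℕ → ℕ) (xs : ℕ) (V : ℕ → ℝ) (a b : ℕ) (c : ℝ) :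
    Prop where
  arc : E a b c
  src : Settled cls sp xs a
  dst : ¬ Settled cls sp xs b
  min : ∀ a' b' c', E a' b' c' → Settled cls sp xs a' → ¬ Settled cls sp xs b' → V a + c ≤ V a' + c'

/-- The minimum over the short list is the minimum over all surviving arcs that leave the settled
set, by `ArcList.exists_cross`. If the list contains no such arc, then none exists. -/
theorem cmScan_run {kb : ℕ} (N : Net n (2 * m) r par dep pw aS aD aW) (hB : BigWord B n m)
    (hE : CfgEnv n m r par dep pw aS aD aW v₁ v₂ f σ)
    (hM : CfgMem n r par dep (climbSum par dep pw) (LiveArc n (2 * m) r par aS aD aW v₁ v₂)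
      (cfgCls n r par v₁ v₂) (cfgTop n r par v₁ v₂) kb f σ)
    (hA : ArcList n m r par aS aD aW (climbSum par dep pw) v₁ v₂ (cfgCls n r par v₁ v₂)
      (σ.ivar 18) (σ.ints 17)) :
    HRun B cmScan σ (σ.ivar 18 * 12 + 3) fun τ =>
      τ.ivar 19 = 0 ∧ Closed (LiveArc n (2 * m) r par aS aD aW v₁ v₂) (cfgCls n r par v₁ v₂)
          (fun y => σ.ints 7 (kb + y)) (σ.ints 8 f) ∨
      τ.ivar 19 = 1 ∧ ∃ a b c, BestArc (LiveArc n (2 * m) r par aS aD aW v₁ v₂)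
          (cfgCls n r par v₁ v₂) (fun y => σ.ints 7 (kb + y)) (σ.ints 8 f)
          (settledVal (climbSum par dep pw) (cfgCls n r par v₁ v₂) (cfgTop n r par v₁ v₂)
            (fun y => σ.reals 2 (kb + y)) (σ.ints 8 f) (σ.reals 3 f)) a b c ∧
        τ.ivar 23 = a ∧ τ.ivar 24 = b ∧
        τ.rvar 1 = settledVal (climbSum par dep pw) (cfgCls n r par v₁ v₂) (cfgTop n r par v₁ v₂)
            (fun y => σ.reals 2 (kb + y)) (σ.ints 8 f) (σ.reals 3 f) a + c := by
  unfold BigWord at hB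
  have hC := N.cfg hE.valid
  have hk := hA.short.trans (Nat.add_le_add_right (card_touchArcs_le _ _ _ _) 1)
  set cls := cfgCls n r par v₁ v₂ with hcls
  set V := settledVal (climbSum par dep pw) cls (cfgTop n r par v₁ v₂)
            (fun y => σ.reals 2 (kb + y)) (σ.ints 8 f) (σ.reals 3 f) with hV
  have hcomp := fun q (hq : q < 2 * m) => hA.exists_cross (sp := fun y => σ.ints 7 (kb + y))
    (sv := fun y => σ.reals 2 (kb + y)) (xs := σ.ints 8 f) (t := cfgTop n r par v₁ v₂)
    (lam := σ.reals 3 f) (hC.cls_le _ (N.src_lt q hq)) (hC.cls_le _ (N.dst_lt q hq)) hq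
  refine HRun.le (HRun.seq (b₁ := 1) (b₂ := σ.ivar 18 * 12 + 2) (R := fun τ =>
    τ.ivar 19 = 0 ∧ Frame [(0, 19)] σ τ)
      (HRun.frame (HRun.of_wp (c := 19 ≔ .c 0) ?_)) ?_) (by omega)
  · simp; omega
  rintro σ₁ ⟨k1, hF₁⟩
  replace hE := hE.frame hF₁ (by decide)
  have e17 := hF₁.ai 17 (by decide)
  have e16 := hF₁.ai 16 (by decide)
  have e6 := hF₁.ar 6 (by decide)
  have e18 := hF₁.i 18 (by decide)
  set l := σ.ints 17 with hl
  set k := σ.ivar 18 with hk'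
  let X : ℕ → Prop := fun q => σ.ints 16 (aS q) = 1 ∧ ¬ σ.ints 16 (aD q) = 1
  refine HRun.for' (N := k) (fun i τ =>
    τ.ivar 19 = 0 ∧ (∀ j < i, ¬ X (l j)) ∨
    τ.ivar 19 = 1 ∧ ∃ j < i, X (l j) ∧ τ.ivar 23 = aS (l j) ∧ τ.ivar 24 = aD (l j) ∧
      τ.rvar 1 = σ.reals 6 (aS (l j)) + aW (l j) ∧
      ∀ j < i, X (l j) → τ.rvar 1 ≤ σ.reals 6 (aS (l j)) + aW (l j)) 10 ?_ (by omega) ?_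
      (by decide) ?_ ?_
  · intro i _ τ _ hF
    exact ⟨trivial, (hF.i 18 (by decide)).trans e18⟩
  · simp [k1]
  · rintro i hi τ hI hx hF
    have e := hE.frame hF (by decide)
    have g17 := (hF.ai 17 (by decide)).trans e17
    have g16 := (hF.ai 16 (by decide)).trans e16
    have g6 := (hF.ar 6 (by decide)).trans e6
    have hq := (hA.sound i hi).1
    have b1 := e.src _ hq
    have b2 := e.dst _ hq
    have b4 := e.wt _ hq
    have hX : X (l i) ↔ σ.ints 16 (aS (l i)) = 1 ∧ ¬ σ.ints 16 (aD (l i)) = 1 := Iff.rfl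
    refine (HRun.of_wp ?_).le (show _ ≤ 10 by decide)
    clear_value X
    simp [hx, g17, g16, g6, b1, b2, b4]
    refine ⟨by omega, fun h1 h2 => ⟨by omega, fun hb => ⟨by omega, ?_⟩, fun h3 h4 => ?_⟩,
      fun h => ?_⟩
    · refine ⟨i, le_rfl, by grind, rfl, rfl, rfl, ?_⟩
      grind
    · rcases hI with ⟨h, -⟩ | ⟨h, j, hj, f1, f2, f3, f4, f5⟩
      · exact absurd h h3
      · exact .inr ⟨h, j, hj.le, f1, f2, f3, f4, by grind⟩
    · rcases hI with ⟨h, h'⟩ | ⟨h, j, hj, f1, f2, f3, f4, f5⟩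
      · exact .inl ⟨h, by grind⟩
      · exact .inr ⟨h, j, hj.le, f1, f2, f3, f4, by grind⟩
  · rintro τ hI -
    have hXS : ∀ j < k, X (l j) ↔ Settled cls (fun y => σ.ints 7 (kb + y)) (σ.ints 8 f) (aS (l j)) ∧
        ¬ Settled cls (fun y => σ.ints 7 (kb + y)) (σ.ints 8 f) (aD (l j)) := fun j hj => by
      have hq := (hA.sound j hj).1
      rw [← hM.flag _ (N.src_lt _ hq), ← hM.flag _ (N.dst_lt _ hq)]
    rcases hI with ⟨h, h'⟩ | ⟨h, j, hj, f1, f2, f3, f4, f5⟩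
    · refine .inl ⟨h, ?_⟩
      rintro a b c ⟨q, hq, rfl, rfl, rfl, hl1⟩ ha
      by_contra hb
      obtain ⟨i, hi, g1, g2, -⟩ := hcomp q hq hl1 ha hb
      exact h' i hi ((hXS i hi).2 ⟨g1, g2⟩)
    · refine .inr ⟨h, aS (l j), aD (l j), aW (l j), ⟨?_, ((hXS j hj).1 f1).1, ((hXS j hj).1 f1).2,
        ?_⟩, f2, f3, ?_⟩
      · exact (hA.sound j hj).2.liveArc (hA.sound j hj).1
      · rintro a b c ⟨q, hq, rfl, rfl, rfl, hl1⟩ ha hb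
        obtain ⟨i, hi, g1, g2, g3⟩ := hcomp q hq hl1 ha hb
        have hXi := (hXS i hi).2 ⟨g1, g2⟩
        have g4 := f5 i hi hXi
        rw [f4, hM.val _ (N.src_lt _ (hA.sound i hi).1) hXi.1,
          hM.val _ (N.src_lt _ (hA.sound j hj).1) f1.1] at g4
        exact g4.trans g3
      · rw [f4, hM.val _ (N.src_lt _ (hA.sound j hj).1) f1.1]

theorem cmSettle_small_run (N : Net n (2 * m) r par dep pw aS aD aW) (hB : BigWord B n m)
    (hE : CfgEnv n m r par dep pw aS aD aW v₁ v₂ f σ) (hC : ClassArray n r par v₁ v₂ σ)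
    {kb : ℕ} (hkb : kb = rowKey n r par dep v₂ * n)
    (hM : CfgMem n r par dep (climbSum par dep pw) (LiveArc n (2 * m) r par aS aD aW v₁ v₂)
      (cfgCls n r par v₁ v₂) (cfgTop n r par v₁ v₂) kb f σ) {a b : ℕ} {c : ℝ}
    (hb : BestArc (LiveArc n (2 * m) r par aS aD aW v₁ v₂)
          (cfgCls n r par v₁ v₂) (fun y => σ.ints 7 (kb + y)) (σ.ints 8 f)
          (settledVal (climbSum par dep pw) (cfgCls n r par v₁ v₂) (cfgTop n r par v₁ v₂)
            (fun y => σ.reals 2 (kb + y)) (σ.ints 8 f) (σ.reals 3 f)) a b c)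
    (h23 : σ.ivar 23 = a) (h24 : σ.ivar 24 = b)
    (h1 : σ.rvar 1 = settledVal (climbSum par dep pw) (cfgCls n r par v₁ v₂) (cfgTop n r par v₁ v₂)
            (fun y => σ.reals 2 (kb + y)) (σ.ints 8 f) (σ.reals 3 f) a + c)
    (hcb : cfgCls n r par v₁ v₂ b = 1) :
    HRun B cmSettle σ 5 fun τ =>
      CfgMem n r par dep (climbSum par dep pw) (LiveArc n (2 * m) r par aS aD aW v₁ v₂)
        (cfgCls n r par v₁ v₂) (cfgTop n r par v₁ v₂) kb f τ ∧
      (fun y => τ.ints 7 (kb + y)) = Function.update (fun y => σ.ints 7 (kb + y)) b (a + 1) ∧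
      τ.ints 8 f = σ.ints 8 f ∧ Untouched n kb (cfgCls n r par v₁ v₂) f σ τ := by
  unfold BigWord at hB
  have hcfg := N.cfg hE.valid
  obtain ⟨han, hbn⟩ := hcfg.lt _ _ _ hb.arc
  have hrow := N.tree.row_le (dep := dep) hE.v2_lt
  have hI := hcfg.settle_small hM.inv hb.arc hb.src hb.dst hcb hb.min
  set cls := cfgCls n r par v₁ v₂ with hcls
  have e15 : σ.ints 15 b = 1 := (hC b hbn).trans hcb
  have e11 := hE.i11
  rw [← hkb] at e11
  have hsp : σ.ints 7 (kb + b) = 0 := by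
    by_contra h
    exact hb.dst (.inr (.inl ⟨hcb, h⟩))
  have key : ∀ (g : ℕ → ℕ) (v : ℕ), (fun y => Function.update g (kb + b) v (kb + y)) =
      Function.update (fun y => g (kb + y)) b v := by
    intro g v; ext y; simp [Function.update_apply]
  have key' : ∀ (g : ℕ → ℝ) (v : ℝ), (fun y => Function.update g (kb + b) v (kb + y)) =
      Function.update (fun y => g (kb + y)) b v := by
    intro g v; ext y; simp [Function.update_apply]
  refine HRun.ite (b := 4) ⟨trivial, ?_⟩ (fun _ => ?_) (fun h => ?_)
  · simp only [Ex.fits]; omega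
  · refine HRun.of_wp ?_
    simp [h23, h24, e11]
    refine ⟨by omega, by omega, by omega, by omega, ?_, key _ _, ?_⟩
    constructor
    · simp
      rw [key, key', h1]
      exact hI
    · intro y hy
      have h2 := hM.flag y hy
      simp [key]
      by_cases hyb : y = b
      · simp [hyb, Settled, hcb]
      · simp [hyb, h2, Settled]
    · intro y hy
      have h2 := hM.val y hy
      simp [key']
      by_cases hyb : y = b
      · simp [hyb, settledVal, hcb]
      · simp [hyb]
        intro h
        rw [h2 h]
        simp [settledVal, hyb]
    · refine ⟨fun j hj => ?_, fun j hj => ?_⟩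
      · have := hj b hbn hcb
        simp [this]
      · simp
  · simp [h24, e15] at h

/-- Entering the large part updates the value of each of its vertices in the scratch memory at
linear cost, which happens at most once per failure. The oracle receives just the entry, its
predecessor and the length. -/
theorem cmSettle_large_run (N : Net n (2 * m) r par dep pw aS aD aW) (hB : BigWord B n m)
    (hE : CfgEnv n m r par dep pw aS aD aW v₁ v₂ f σ) (hC : ClassArray n r par v₁ v₂ σ)
    {kb : ℕ}
    (hM : CfgMem n r par dep (climbSum par dep pw) (LiveArc n (2 * m) r par aS aD aW v₁ v₂)
      (cfgCls n r par v₁ v₂) (cfgTop n r par v₁ v₂) kb f σ) {a b : ℕ} {c : ℝ}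
    (hb : BestArc (LiveArc n (2 * m) r par aS aD aW v₁ v₂)
          (cfgCls n r par v₁ v₂) (fun y => σ.ints 7 (kb + y)) (σ.ints 8 f)
          (settledVal (climbSum par dep pw) (cfgCls n r par v₁ v₂) (cfgTop n r par v₁ v₂)
            (fun y => σ.reals 2 (kb + y)) (σ.ints 8 f) (σ.reals 3 f)) a b c)
    (h23 : σ.ivar 23 = a) (h24 : σ.ivar 24 = b)
    (h1 : σ.rvar 1 = settledVal (climbSum par dep pw) (cfgCls n r par v₁ v₂) (cfgTop n r par v₁ v₂)
            (fun y => σ.reals 2 (kb + y)) (σ.ints 8 f) (σ.reals 3 f) a + c)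
    (hcb : cfgCls n r par v₁ v₂ b = 2) :
    HRun B cmSettle σ (n * 5 + 6) fun τ =>
      CfgMem n r par dep (climbSum par dep pw) (LiveArc n (2 * m) r par aS aD aW v₁ v₂)
        (cfgCls n r par v₁ v₂) (cfgTop n r par v₁ v₂) kb f τ ∧
      τ.ints 7 = σ.ints 7 ∧ τ.ints 8 f = b + 1 ∧
      Untouched n kb (cfgCls n r par v₁ v₂) f σ τ := by
  unfold BigWord at hB
  have hcfg := N.cfg hE.valid
  obtain ⟨han, hbn⟩ := hcfg.lt _ _ _ hb.arc
  have hv2 := hE.v2_lt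
  have htop : cfgTop n r par v₁ v₂ < n := by
    have := hE.v1_lt
    unfold cfgTop; split_ifs <;> omega
  have hI := hcfg.settle_large htop hM.inv hb.arc hb.src hb.dst hcb hb.min
  unfold ClassArray at hC
  set cls := cfgCls n r par v₁ v₂ with hcls
  have e15 : ¬ σ.ints 15 b = 1 := by rw [hC b hbn]; omega
  have hxs : σ.ints 8 f = 0 := by
    by_contra h
    exact hb.dst (.inr (.inr ⟨hcb, h⟩))
  refine HRun.le (HRun.ite (b := 3 + (n * 5 + 2)) ⟨trivial, ?_⟩ (fun h => ?_) (fun _ => ?_))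
    (by omega)
  · simp only [Ex.fits]; omega
  · simp [h24, e15] at h
  refine HRun.seq (R := fun τ => (τ.ints 8 f = b + 1 ∧ τ.ints 9 f = a ∧ τ.reals 3 f = σ.rvar 1 ∧
      ∀ j ≠ f, τ.ints 8 j = σ.ints 8 j ∧ τ.ints 9 j = σ.ints 9 j ∧ τ.reals 3 j = σ.reals 3 j) ∧
    Frame [(2, 8), (2, 9), (3, 3)] σ τ) (HRun.frame (HRun.of_wp ?_)) ?_
  · simp [h24, hE.i4, h23]
    exact ⟨by omega, fun j hj => by simp [hj]⟩
  rintro σ₁ ⟨⟨k8, k9, k3, kU⟩, hF₁⟩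
  have hE' := hE.frame hF₁ (W := [(2, 8), (2, 9), (3, 3)]) (by decide)
  have e23 := (hF₁.i 23 (by decide)).trans h23
  have e24 := (hF₁.i 24 (by decide)).trans h24
  have er1 := (hF₁.r 1 (by decide))
  have g15 := hF₁.ai 15 (by decide)
  have g16 := hF₁.ai 16 (by decide)
  have g7 := hF₁.ai 7 (by decide)
  have g2 := hF₁.ar 2 (by decide)
  have g6 := hF₁.ar 6 (by decide)
  refine HRun.for' (N := n) (fun i τ => ∀ y < n,
    (cls y = 2 ∧ y < i → τ.ints 16 y = 1 ∧ τ.reals 6 y = σ.rvar 1 +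
      (climbSum par dep pw b - climbSum par dep pw (cfgTop n r par v₁ v₂)) +
      (climbSum par dep pw y - climbSum par dep pw (cfgTop n r par v₁ v₂))) ∧
    (cls y ≠ 2 → τ.ints 16 y = σ.ints 16 y ∧ τ.reals 6 y = σ.reals 6 y)) 3 ?_ (by omega) ?_
      (by decide) ?_ ?_
  · intro i _ τ _ hF
    exact ⟨trivial, (hE'.frame hF (by decide)).i0⟩
  · simp [g16, g6]
  · intro i hi τ hI hx hF
    have e := hE'.frame hF (by decide)
    have e13 := e.i13
    have f24 := (hF.i 24 (by decide)).trans e24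
    have fr1 := (hF.r 1 (by decide)).trans er1
    have f15 := (hF.ai 15 (by decide)).trans g15
    have d1 := e.dist b hbn
    have d2 := e.dist _ htop
    have d3 := e.dist i hi
    have c1 := hC i hi
    refine (HRun.of_wp ?_).le (show _ ≤ 3 by decide)
    simp only [wp, Cd.fits, Cd.holds, Ex.fits, Ex.eval, RE.fits, RE.eval, hx, f15, c1, e13, f24, fr1,
      d1, d2, d3, MState.setI_ints, MState.stR_reals, MState.stI_ints, MState.setI_reals,
      MState.stI_ivar, MState.stI_reals, MState.stI_rvar, MState.stR_ints, reduceIte, true_and,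
      and_true]
    refine ⟨by omega, fun h => ⟨by omega, ?_⟩, fun h => ?_⟩ <;> grind [Function.update_apply]
  · intro τ hI' hF
    have f7 := (hF.ai 7 (by decide)).trans g7
    have f2 := (hF.ar 2 (by decide)).trans g2
    have f8 := congrFun (hF.ai 8 (by decide)) f
    have f9 := congrFun (hF.ai 9 (by decide)) f
    have f3 := congrFun (hF.ar 3 (by decide)) f
    rw [k8] at f8
    rw [k9] at f9
    rw [k3, h1] at f3
    refine ⟨⟨?_, ?_, ?_⟩, f7, f8, fun j _ => by rw [f7, f2]; exact ⟨rfl, rfl⟩, fun j hj => ?_⟩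
    · rw [f7, f2, f8, f9, f3]
      exact hI
    · intro y hy
      obtain ⟨i1, i2⟩ := hI' y hy
      rw [f7, f8]
      by_cases hc : cls y = 2
      · simp [i1 ⟨hc, hy⟩, Settled, hc]
      · rw [(i2 hc).1, hM.flag y hy]
        simp [Settled, hc]
    · intro y hy
      obtain ⟨i1, i2⟩ := hI' y hy
      rw [f2, f8, f3, ← h1]
      by_cases hc : cls y = 2
      · simp [i1 ⟨hc, hy⟩, settledVal, hc]
      · rw [(i2 hc).1, (i2 hc).2]
        intro h
        have := hcfg.cls_le y hy
        rw [hM.val y hy h]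
        rcases (by omega : cls y = 0 ∨ cls y = 1) with h | h <;> simp [settledVal, h]
    · rw [hF.ai 8 (by decide), hF.ai 9 (by decide), hF.ar 3 (by decide)]
      exact kU j hj

end

/-- The memory holds the result for the failure. -/
def CfgStored (n m r : ℕ) (par dep : ℕ → ℕ) (pw : ℕ → ℝ) (aS aD : ℕ → ℕ) (aW : ℕ → ℝ)
    (v₁ v₂ f : ℕ) (σ : MState) : Prop :=
  ∃ (sp : ℕ → ℕ) (sv : ℕ → ℝ),
    CfgInv n r par dep (climbSum par dep pw) (LiveArc n (2 * m) r par aS aD aW v₁ v₂)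
      (cfgCls n r par v₁ v₂) (cfgTop n r par v₁ v₂) sp sv (σ.ints 8 f) (σ.ints 9 f)
      (σ.reals 3 f) ∧
    Closed (LiveArc n (2 * m) r par aS aD aW v₁ v₂) (cfgCls n r par v₁ v₂) sp (σ.ints 8 f) ∧
    ∀ y < n, cfgCls n r par v₁ v₂ y = 1 → σ.ints 7 (rowKey n r par dep v₂ * n + y) = sp y ∧
      σ.reals 2 (rowKey n r par dep v₂ * n + y) = sv y

open Classical in
/-- The vertices of class `1`. -/
noncomputable def clsOne (n : ℕ) (cls : ℕ → ℕ) : Finset ℕ := (Finset.range n).filter (cls · = 1)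

section
variable {B n m r : ℕ} {par dep : ℕ → ℕ} {pw : ℕ → ℝ} {aS aD : ℕ → ℕ} {aW : ℕ → ℝ}
  {v₁ v₂ f : ℕ} {σ τ : MState}

theorem CfgMem.frame {d : ℕ → ℝ} {E : ℕ → ℕ → ℝ → Prop} {cls : ℕ → ℕ} {t kb : ℕ}
    (h : CfgMem n r par dep d E cls t kb f σ) {W : List (ℕ × ℕ)} (hF : Frame W σ τ)
    (hW : ∀ x ∈ (2, 16) :: (3, 6) :: storeCells, x ∉ W) :
    CfgMem n r par dep d E cls t kb f τ := by
  have e7 := hF.ai 7 (hW _ (by decide))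
  have e8 := hF.ai 8 (hW _ (by decide))
  have e9 := hF.ai 9 (hW _ (by decide))
  have e16 := hF.ai 16 (hW _ (by decide))
  have e2 := hF.ar 2 (hW _ (by decide))
  have e3 := hF.ar 3 (hW _ (by decide))
  have e6 := hF.ar 6 (hW _ (by decide))
  constructor
  · rw [e7, e8, e9, e2, e3]; exact h.inv
  · rw [e7, e8, e16]; exact h.flag
  · rw [e16, e6, e2, e8, e3]; exact h.val

/-- The number of small vertices without a predecessor is the potential that bounds the number of
scans. -/
theorem card_unset_update {n : ℕ} {cls sp : ℕ → ℕ} {b v : ℕ} (hb : b < n) (hc : cls b = 1)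
    (h0 : sp b = 0) (hv : v ≠ 0) :
    ((Finset.range n).filter fun y => cls y = 1 ∧ Function.update sp b v y = 0).card + 1 =
      ((Finset.range n).filter fun y => cls y = 1 ∧ sp y = 0).card := by
  rw [← Finset.card_insert_of_notMem (a := b) (by simp [hv])]
  congr 1
  ext y
  by_cases h : y = b
  · subst h; simp [hb, hc, h0]
  · simp [h]

/-- Every scan but the last settles a vertex of the small part or the whole large part, so there are
at most |small part| + 2 scans, each linear in the number of touching arcs plus one. -/
theorem cmConfig_run (N : Net n (2 * m) r par dep pw aS aD aW) (hB : BigWord B n m)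
    (hE : CfgEnv n m r par dep pw aS aD aW v₁ v₂ f σ) :
    HRun B cmConfig σ (12 * ((clsOne n (cfgCls n r par v₁ v₂)).card *
        (touchArcs m (cfgCls n r par v₁ v₂) aS aD).card) + 60 * n + 100 * m + 120) fun τ =>
      CfgStored n m r par dep pw aS aD aW v₁ v₂ f τ ∧
      Untouched n (rowKey n r par dep v₂ * n) (cfgCls n r par v₁ v₂) f σ τ := by
  have hB' := hB
  unfold BigWord at hB'
  have hcfg := N.cfg hE.valid
  set kb := rowKey n r par dep v₂ * n with hkb
  set cls := cfgCls n r par v₁ v₂ with hcls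
  set E := LiveArc n (2 * m) r par aS aD aW v₁ v₂ with hEE
  set e := (touchArcs m cls aS aD).card with he
  have hek : e ≤ 2 * m := card_touchArcs_le _ _ _ _
  set s := (clsOne n cls).card with hs
  have hsn : s ≤ n := by
    rw [hs, clsOne]
    exact (Finset.card_filter_le _ _).trans (by rw [Finset.card_range])
  let u : MState → ℕ := fun τ =>
    ((Finset.range n).filter fun y => cls y = 1 ∧ τ.ints 7 (kb + y) = 0).card
  have hus : ∀ τ, u τ ≤ s := fun τ => by
    rw [hs, clsOne]
    refine Finset.card_le_card fun y hy => ?_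
    simp only [Finset.mem_filter] at hy ⊢
    exact ⟨hy.1, hy.2.1⟩
  refine HRun.le (HRun.seq (cmInit_run N hB hE).frame fun σ₁ h₁ => ?_)
    (b₁ := n * 14 + 3 + (m * 28 + 10 + (1 + ((s + 1 + 1) * (12 * (e + 1) + 12) + (5 * n + 1) + 1))))
    (by nlinarith)
  obtain ⟨⟨hC₁, hM₁, hU₁⟩, hF₁⟩ := h₁
  have hE₁ := hE.frame hF₁ (by decide)
  refine HRun.seq (cmFilter_run N hB hE₁ hC₁).frame fun σ₂ h₂ => ?_
  obtain ⟨hA₂, hF₂⟩ := h₂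
  have hE₂ := hE₁.frame hF₂ (by decide)
  have hM₂ := hM₁.frame hF₂ (by decide)
  have hC₂ : ClassArray n r par v₁ v₂ σ₂ := by
    unfold ClassArray; rw [hF₂.ai 15 (by decide)]; exact hC₁
  have hU₂ := hU₁.trans (.of_frame hF₂ (by decide))
  have hks : σ₂.ivar 18 ≤ e + 1 := hA₂.short
  set k := σ₂.ivar 18 with hk
  set l := σ₂.ints 17 with hl
  refine HRun.seq (R := fun τ => τ.ivar 19 = 1 ∧ Frame [(0, 19)] σ₂ τ)
    (HRun.frame (HRun.of_wp (c := 19 ≔ .c 1) ?_)) fun σ₃ h₃ => ?_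
  · simp; omega
  obtain ⟨h19, hF₃⟩ := h₃
  have hE₃ := hE₂.frame hF₃ (by decide)
  have hC₃ : ClassArray n r par v₁ v₂ σ₃ := by
    unfold ClassArray; rw [hF₃.ai 15 (by decide)]; exact hC₂
  have hx1 : ∀ τ : MState, (if τ.ints 8 f = 0 then 1 else 0) ≤ 1 := fun τ => by split_ifs <;> omega
  -- The budget allows one scan for every unsettled small vertex, one if the large part is still to
  -- be entered, and one that finds nothing; the update of the large part is paid for only while
  -- `ints 8 f` is `0`.
  refine HRun.while' (fun b τ => CfgMem n r par dep (climbSum par dep pw) E cls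
      (cfgTop n r par v₁ v₂) kb f τ ∧ Untouched n kb cls f σ τ ∧
      (τ.ivar 19 = 1 ∧ (u τ + (if τ.ints 8 f = 0 then 1 else 0) + 1) * (12 * (e + 1) + 12) +
        (if τ.ints 8 f = 0 then 1 else 0) * (5 * n + 1) + 1 ≤ b ∨
       τ.ivar 19 = 0 ∧ Closed E cls (fun y => τ.ints 7 (kb + y)) (τ.ints 8 f) ∧ 1 ≤ b))
      ?_ ?_ ?_ ?_
  · refine ⟨hM₂.frame hF₃ (by decide), hU₂.trans (.of_frame hF₃ (by decide)), .inl ⟨h19, ?_⟩⟩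
    have h1 := hus σ₃
    have h2 := hx1 σ₃
    gcongr
    nlinarith
  · intro b τ _ _
    exact ⟨trivial, by simp only [Ex.fits]; omega⟩
  · rintro b τ ⟨hM, hU, hb⟩ hF hc
    simp only [Cd.holds, Ex.eval] at hc
    replace hb : (u τ + (if τ.ints 8 f = 0 then 1 else 0) + 1) * (12 * (e + 1) + 12) +
        (if τ.ints 8 f = 0 then 1 else 0) * (5 * n + 1) + 1 ≤ b := by
      rcases hb with h | h
      · exact h.2
      · omega
    have hEτ := hE₃.frame hF (by decide)
    have hCτ : ClassArray n r par v₁ v₂ τ := by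
      unfold ClassArray; rw [hF.ai 15 (by decide)]; exact hC₃
    have h18 : τ.ivar 18 = k := (hF.i 18 (by decide)).trans (hF₃.i 18 (by decide))
    have h17 : τ.ints 17 = l := (hF.ai 17 (by decide)).trans (hF₃.ai 17 (by decide))
    obtain ⟨k₁, τ₁, hex, hk₁, hpost, hF'⟩ := (cmScan_run N hB hEτ hM (by rwa [h18, h17])).frame
    have hU' := hU.trans (.of_frame hF' (by decide))
    have hM' := hM.frame hF' (by decide)
    have hE' := hEτ.frame hF' (by decide)
    have hC' : ClassArray n r par v₁ v₂ τ₁ := by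
      unfold ClassArray; rw [hF'.ai 15 (by decide)]; exact hCτ
    rw [← hF'.ai 7 (by decide), ← hF'.ai 8 (by decide), ← hF'.ar 2 (by decide),
      ← hF'.ar 3 (by decide)] at hpost
    have hu' : u τ = u τ₁ := by simp only [u, hF'.ai 7 (by decide)]
    rw [← hF'.ai 8 (by decide), hu'] at hb
    have hk₁' : k₁ ≤ 12 * (e + 1) + 3 := by omega
    have hscan : ∀ b₂ Q, HRun B (.ite (.v 19 =ₑ .c 1) cmSettle .skip) τ₁ b₂ Q →
        HRun B (cmScan ;; .ite (.v 19 =ₑ .c 1) cmSettle .skip) τ (k₁ + b₂) Q := fun b₂ Q h =>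
      HRun.seq (R := fun τ' => τ' = τ₁) ⟨k₁, τ₁, hex, le_rfl, rfl⟩ (by rintro _ rfl; exact h)
    have hfit : (Cd.eq (.v 19) (.c 1)).fits B τ₁ := ⟨trivial, by simp only [Ex.fits]; omega⟩
    rcases hpost with ⟨g19, hcl⟩ | ⟨g19, a, c, w, hbest, g23, g24, g1⟩
    · refine ⟨_, 1, ?_, hscan 2 _ (HRun.ite (b := 1) hfit (fun h => ?_) fun _ =>
        ⟨1, τ₁, .skip _, le_rfl, hM', hU', .inr ⟨g19, hcl, le_rfl⟩⟩)⟩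
      · have := Nat.le_mul_of_pos_left (12 * (e + 1) + 12)
          (Nat.succ_pos (u τ₁ + if τ₁.ints 8 f = 0 then 1 else 0))
        rw [Nat.succ_eq_add_one] at this
        have := Nat.zero_le ((if τ₁.ints 8 f = 0 then 1 else 0) * (5 * n + 1))
        linarith
      · simp [g19] at h
    · obtain ⟨han, hbn⟩ := hcfg.lt _ _ _ hbest.arc
      have hcb := hcfg.cls_le c hbn
      have hcb0 : cls c ≠ 0 := fun h => hbest.dst (.inl h)
      rcases (by omega : cls c = 1 ∨ cls c = 2) with hc1 | hc2
      · have hrun := cmSettle_small_run N hB hE' hC' hkb hM' hbest g23 g24 g1 hc1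
        refine ⟨_, (u τ₁ + (if τ₁.ints 8 f = 0 then 1 else 0)) * (12 * (e + 1) + 12) +
          (if τ₁.ints 8 f = 0 then 1 else 0) * (5 * n + 1) + 1, ?_, hscan 6 _
          (HRun.ite (b := 5) hfit (fun _ => ?_) fun h => absurd g19 h)⟩
        · nlinarith
        refine (hrun.frame).imp ?_
        rintro τ₂ ⟨⟨hM₂, hsp, hxs, hU₂⟩, hF₂⟩
        refine ⟨hM₂, hU'.trans hU₂, .inl ⟨(hF₂.i 19 (by decide)).trans g19, ?_⟩⟩
        have hu2 : u τ₂ + 1 = u τ₁ := by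
          have h0 : τ₁.ints 7 (kb + c) = 0 := by
            by_contra h
            exact hbest.dst (.inr (.inl ⟨hc1, h⟩))
          have := card_unset_update (sp := fun y => τ₁.ints 7 (kb + y)) hbn hc1 h0
            (Nat.succ_ne_zero a)
          rw [← hsp] at this
          exact this
        rw [hxs, ← hu2]
        refine le_of_eq ?_
        ring
      · have hrun := cmSettle_large_run N hB hE' hC' hM' hbest g23 g24 g1 hc2
        have hx0 : τ₁.ints 8 f = 0 := by
          by_contra h
          exact hbest.dst (.inr (.inr ⟨hc2, h⟩))
        refine ⟨_, (u τ₁ + 1) * (12 * (e + 1) + 12) + 1, ?_, hscan (n * 5 + 6 + 1) _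
          (HRun.ite (b := n * 5 + 6) hfit (fun _ => ?_) fun h => absurd g19 h)⟩
        · rw [if_pos hx0] at hb
          nlinarith
        refine (hrun.frame).imp ?_
        rintro τ₂ ⟨⟨hM₂, hsp, hxs, hU₂⟩, hF₂⟩
        refine ⟨hM₂, hU'.trans hU₂, .inl ⟨(hF₂.i 19 (by decide)).trans g19, ?_⟩⟩
        have hu2 : u τ₂ = u τ₁ := by simp only [u, hsp]
        rw [hxs, hu2]
        simp
  · rintro b τ ⟨hM, hU, hb⟩ hF hc
    simp only [Cd.holds, Ex.eval] at hc
    rcases hb with h | ⟨-, hcl, hb⟩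
    · exact absurd h.1 hc
    · exact ⟨hb, ⟨_, _, hM.inv, hcl, fun y _ _ => ⟨rfl, rfl⟩⟩, hU⟩

end

/-! ### The construction for all failures -/

/-- The failures have numbers below `2 * n`; this is the lower vertex. -/
def lowOf (n f : ℕ) : ℕ := if f < n then f else f - n

/-- The upper vertex of a failure. -/
def highOf (n : ℕ) (par : ℕ → ℕ) (f : ℕ) : ℕ := if f < n then f else par (f - n)

/-- The whole construction. -/
def cmBuild : Cm :=
  cmPrep ;;
  .for 4 (.v 0 +ₑ .v 0)
    (.ite (.v 4 <ₑ .v 0) (10 ≔ .v 4 ;; 9 ≔ .v 4) (10 ≔ .v 4 -ₑ .v 0 ;; 9 ≔ .ld 2 (.v 10)) ;;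
     .ite (.not (.v 9 =ₑ .v 2) &ₑ .not (.v 10 =ₑ .v 2)) (cmLoad ;; cmConfig) .skip)

section
variable {B n m r : ℕ} {par dep : ℕ → ℕ} {pw : ℕ → ℝ} {aS aD : ℕ → ℕ} {aW : ℕ → ℝ}
  {v₁ v₂ f : ℕ} {σ τ : MState}

theorem lowOf_lt (hf : f < 2 * n) : lowOf n f < n := by unfold lowOf; split_ifs <;> omega

/-- For the failure of a single edge the whole subtree below it is the large part, and the small
part is empty. -/
theorem not_lowSmall_self {v : ℕ} (hv : v < n) :
    ¬ LowSmall n r par v v := by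
  have := RTree.sz_pos (r := r) (par := par) hv
  unfold LowSmall; omega

theorem validPair_of (H : RTree n r par dep) (hf : f < 2 * n) (h1 : highOf n par f ≠ r)
    (h2 : lowOf n f ≠ r) : ValidPair n r par (highOf n par f) (lowOf n f) := by
  refine .inr ⟨?_, lowOf_lt hf, h1, h2, ?_⟩
  · unfold highOf
    split_ifs
    · assumption
    · exact H.par_lt _ (by omega)
  · unfold highOf lowOf
    split_ifs <;> simp

/-- Only failures of two edges have a nonempty small part, and it is the one that the combinatorics
of light vertices treats. -/
theorem cfgCls_eq_one_of {y : ℕ}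
    (hc : cfgCls n r par (highOf n par f) (lowOf n f) y = 1) :
    n ≤ f ∧ InSmall n r par (lowOf n f) y := by
  rw [cfgCls_eq_one] at hc
  by_cases h : f < n
  · simp only [highOf, lowOf, h, if_true] at hc
    exact absurd (hc.2.1 hc.1) (not_lowSmall_self h)
  · refine ⟨by omega, ?_⟩
    simp only [highOf, lowOf, h, if_false] at hc ⊢
    have hl : LowSmall n r par (par (f - n)) (f - n) ↔ Light n r par (f - n) := Iff.rfl
    rw [hl] at hc
    unfold InSmall
    tauto

theorem CfgStored.frame (h : CfgStored n m r par dep pw aS aD aW v₁ v₂ f σ) {W : List (ℕ × ℕ)}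
    (hF : Frame W σ τ) (hW : ∀ x ∈ storeCells, x ∉ W) :
    CfgStored n m r par dep pw aS aD aW v₁ v₂ f τ := by
  obtain ⟨sp, sv, h1, h2, h3⟩ := h
  refine ⟨sp, sv, ?_, ?_, ?_⟩
  · rwa [hF.ai 8 (hW _ (by decide)), hF.ai 9 (hW _ (by decide)), hF.ar 3 (hW _ (by decide))]
  · rwa [hF.ai 8 (hW _ (by decide))]
  · rwa [hF.ai 7 (hW _ (by decide)), hF.ar 2 (hW _ (by decide))]

/-- A common cell of two failures determines, by its index, the row and the vertex `y`. Both small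
parts then contain `y` and have the same key, so by `RTree.rowKey_injOn` the failures coincide. -/
theorem CfgStored.untouched (H : RTree n r par dep) {g : ℕ} (hf : f < 2 * n) (hg : g < 2 * n)
    (hgf : g ≠ f) (hfr : lowOf n f ≠ r) (hgr : lowOf n g ≠ r)
    (h : CfgStored n m r par dep pw aS aD aW (highOf n par g) (lowOf n g) g σ)
    (hU : Untouched n (rowKey n r par dep (lowOf n f) * n)
      (cfgCls n r par (highOf n par f) (lowOf n f)) f σ τ) :
    CfgStored n m r par dep pw aS aD aW (highOf n par g) (lowOf n g) g τ := by
  obtain ⟨sp, sv, h1, h2, h3⟩ := h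
  obtain ⟨e8, e9, e3⟩ := hU.2 g hgf
  refine ⟨sp, sv, by rwa [e8, e9, e3], by rwa [e8], fun y hy hc => ?_⟩
  have h4 := hU.1 (rowKey n r par dep (lowOf n g) * n + y) ?_
  · rw [h4.1, h4.2]; exact h3 y hy hc
  intro z hz hcz heq
  obtain ⟨hg', hgs⟩ := cfgCls_eq_one_of hc
  obtain ⟨hf', hfs⟩ := cfgCls_eq_one_of hcz
  have hn : 0 < n := by omega
  have hyz : y = z := by
    have := congrArg (· % n) heq
    simpa [Nat.mul_add_mod_self_right, Nat.mod_eq_of_lt hy, Nat.mod_eq_of_lt hz] using this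
  subst hyz
  have hk : rowKey n r par dep (lowOf n g) = rowKey n r par dep (lowOf n f) :=
    Nat.eq_of_mul_eq_mul_right hn (Nat.add_right_cancel heq)
  have := H.rowKey_injOn (lowOf_lt hg) (lowOf_lt hf) hgr hfr hgs hfs hk
  unfold lowOf at this
  rw [if_neg (by omega), if_neg (by omega)] at this
  omega

open Classical in
/-- The arcs that touch the small part for `v`. -/
noncomputable def smallArcs (n m r : ℕ) (par aS aD : ℕ → ℕ) (v : ℕ) : Finset ℕ :=
  (Finset.range (2 * m)).filter fun q => aS q ∈ smallPart n r par v ∨ aD q ∈ smallPart n r par v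

theorem card_clsOne_mul (hS : ∀ q < 2 * m, aS q < n) (hD : ∀ q < 2 * m, aD q < n) :
    (clsOne n (cfgCls n r par (highOf n par f) (lowOf n f))).card *
        (touchArcs m (cfgCls n r par (highOf n par f) (lowOf n f)) aS aD).card ≤
      if f < n then 0 else
        (smallPart n r par (lowOf n f)).card * (smallArcs n m r par aS aD (lowOf n f)).card := by
  classical
  split_ifs with h
  · have : clsOne n (cfgCls n r par (highOf n par f) (lowOf n f)) = ∅ :=
      Finset.filter_eq_empty_iff.2 fun y _ hc => by
        have := (cfgCls_eq_one_of hc).1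
        omega
    simp [this]
  · gcongr
    · intro y hy
      simp only [clsOne, Finset.mem_filter, Finset.mem_range] at hy
      exact mem_smallPart.2 ⟨hy.1, (cfgCls_eq_one_of hy.2).2⟩
    · intro q hq
      simp only [touchArcs, smallArcs, Finset.mem_filter, Finset.mem_range, TouchIdx] at hq ⊢
      refine ⟨hq.1, hq.2.imp (fun h => ?_) fun h => ?_⟩
      · exact mem_smallPart.2 ⟨hS _ hq.1, (cfgCls_eq_one_of h).2⟩
      · exact mem_smallPart.2 ⟨hD _ hq.1, (cfgCls_eq_one_of h).2⟩

/-- Exchange the sums: each of the two endpoints of each of the `2 * m` arcs is charged the sizes of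
all small parts that contain it, which is at most `4 * n` by `sum_smallPart_le`. -/
theorem RTree.sum_smallArcs_le (H : RTree n r par dep) :
    ∑ v ∈ (Finset.range n).filter (· ≠ r),
      (smallPart n r par v).card * (smallArcs n m r par aS aD v).card ≤ 16 * (n * m) := by
  classical
  set s := (Finset.range n).filter (· ≠ r)
  have key : ∀ a : ℕ → ℕ, ∑ v ∈ s, (smallPart n r par v).card *
      ((Finset.range (2 * m)).filter fun q => a q ∈ smallPart n r par v).card ≤ 2 * m * (4 * n) := by
    intro a
    calc _ = ∑ v ∈ s, ∑ q ∈ Finset.range (2 * m),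
          if a q ∈ smallPart n r par v then (smallPart n r par v).card else 0 := by
          refine Finset.sum_congr rfl fun v _ => ?_
          rw [← Finset.sum_filter, Finset.sum_const, smul_eq_mul, mul_comm]
      _ = ∑ q ∈ Finset.range (2 * m), ∑ v ∈ s.filter fun v => a q ∈ smallPart n r par v,
          (smallPart n r par v).card := by
          rw [Finset.sum_comm]
          exact Finset.sum_congr rfl fun q _ => (Finset.sum_filter _ _).symm
      _ ≤ ∑ q ∈ Finset.range (2 * m), 4 * n := by
          refine Finset.sum_le_sum fun q _ => H.sum_smallPart_le (y := a q) _ fun v hv => ?_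
          simp only [s, Finset.mem_filter, Finset.mem_range] at hv
          exact ⟨hv.1.1, hv.1.2, hv.2⟩
      _ = 2 * m * (4 * n) := by simp
  calc _ ≤ ∑ v ∈ s, ((smallPart n r par v).card *
        ((Finset.range (2 * m)).filter fun q => aS q ∈ smallPart n r par v).card +
        (smallPart n r par v).card *
        ((Finset.range (2 * m)).filter fun q => aD q ∈ smallPart n r par v).card) := by
        refine Finset.sum_le_sum fun v _ => ?_
        rw [← mul_add]
        refine Nat.mul_le_mul_left _ ?_
        rw [smallArcs, Finset.filter_or]
        exact Finset.card_union_le _ _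
    _ ≤ _ := by
        rw [Finset.sum_add_distrib]
        have h1 := key aS
        have h2 := key aD
        nlinarith

theorem cmBuild_run {ea eb : ℕ → ℕ} {ew : ℕ → ℝ} (hB : BigWord B n m)
    (N : Net n (2 * m) r par dep pw (twoWay m ea eb) (twoWay m eb ea) (twoWay m ew ew))
    (hn : σ.ivar 0 = n) (hm : σ.ivar 1 = m) (hr : σ.ivar 2 = r)
    (hea : σ.ints 0 = ea) (heb : σ.ints 1 = eb) (hew : σ.reals 0 = ew) (hpar : σ.ints 2 = par) :
    HRun B cmBuild σ (140 * (n * n) + 410 * n + 28 * m + 400 * (n * m) + 60) fun τ =>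
      TreeTables n r par dep pw τ ∧
      ∀ f < 2 * n, highOf n par f ≠ r → lowOf n f ≠ r → CfgStored n m r par dep pw
        (twoWay m ea eb) (twoWay m eb ea) (twoWay m ew ew) (highOf n par f) (lowOf n f) f τ := by
  classical
  have hB' := hB
  unfold BigWord at hB'
  have H := N.tree
  set aS := twoWay m ea eb
  set aD := twoWay m eb ea
  set aW := twoWay m ew ew
  let cost : ℕ → ℕ := fun f => 12 * (if f < n then 0 else if lowOf n f = r then 0 else
    (smallPart n r par (lowOf n f)).card * (smallArcs n m r par aS aD (lowOf n f)).card) +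
    (60 * n + 100 * m + 140)
  refine HRun.le (HRun.seq (cmPrep_run N hB hn hm hr hea heb hew hpar) fun σ₁ h₁ =>
    HRun.for (N := 2 * n) (fun i τ => Prepared n m r par dep pw aS aD aW τ ∧
      ∀ f < i, highOf n par f ≠ r → lowOf n f ≠ r →
        CfgStored n m r par dep pw aS aD aW (highOf n par f) (lowOf n f) f τ) cost ?_ (by omega) ?_
      (by decide) ?_ ?_) ?_
  · rintro i _ τ ⟨hP, -⟩ _
    simp [hP.i0]; omega
  · refine ⟨h₁.frame (W := [(0, 4)]) ?_ (by decide), by omega⟩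
    exact ⟨fun x hx => by simp_all, fun _ _ => rfl, fun _ _ => rfl, fun _ _ => rfl⟩
  · rintro f hf τ ⟨hP, hI⟩ hx hF
    refine HRun.le (HRun.seq (R := fun τ' => (τ'.ivar 9 = highOf n par f ∧
      τ'.ivar 10 = lowOf n f) ∧ Frame [(0, 9), (0, 10)] τ τ') (b₁ := 3)
      (b₂ := 12 * (if f < n then 0 else if lowOf n f = r then 0 else
        (smallPart n r par (lowOf n f)).card * (smallArcs n m r par aS aD (lowOf n f)).card) +
        (60 * n + 100 * m + 130))
      (HRun.imp (HRun.frame (HRun.of_wp (c := .ite _ _ _) (Q := fun τ' => τ'.ivar 9 = highOf n par f ∧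
        τ'.ivar 10 = lowOf n f) ?_)) fun τ' h => ⟨h.1, h.2.mono (by decide)⟩) ?_) (by simp only [cost]; omega)
    · have h2 := hP.parent
      simp [hP.i0, hx, highOf, lowOf]
      grind
    rintro τ₁ ⟨⟨h9, h10⟩, hF₁⟩
    have hP₁ := hP.frame hF₁ (by decide)
    have h4 : τ₁.ivar 4 = f := (hF₁.i 4 (by decide)).trans hx
    have hI₁ : ∀ g < f, highOf n par g ≠ r → lowOf n g ≠ r →
        CfgStored n m r par dep pw aS aD aW (highOf n par g) (lowOf n g) g τ₁ := by
      intro g hg h1 h2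
      exact (hI g hg h1 h2).frame hF₁ (by decide)
    have hfin : ∀ τ' : MState, Prepared n m r par dep pw aS aD aW τ' →
        (∀ g < f + 1, highOf n par g ≠ r → lowOf n g ≠ r →
          CfgStored n m r par dep pw aS aD aW (highOf n par g) (lowOf n g) g τ') →
        Prepared n m r par dep pw aS aD aW (τ'.setI 4 (f + 1)) ∧
        ∀ g < f + 1, highOf n par g ≠ r → lowOf n g ≠ r →
          CfgStored n m r par dep pw aS aD aW (highOf n par g) (lowOf n g) g (τ'.setI 4 (f + 1)) :=
      fun τ' h h' => ⟨h.frame (W := [(0, 4)])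
        ⟨fun x hx => by simp_all, fun _ _ => rfl, fun _ _ => rfl, fun _ _ => rfl⟩ (by decide), h'⟩
    refine HRun.le (HRun.ite (b := 12 * (if f < n then 0 else if lowOf n f = r then 0 else
        (smallPart n r par (lowOf n f)).card * (smallArcs n m r par aS aD (lowOf n f)).card) +
        (60 * n + 100 * m + 129)) ⟨⟨trivial, trivial⟩, trivial, trivial⟩ (fun h => ?_) fun h => ?_)
        (by omega)
    · simp only [Cd.holds, Ex.eval, h9, h10, hP₁.i2] at h
      obtain ⟨hh, hl⟩ := h
      have hV := validPair_of H hf hh hl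
      have hlt : highOf n par f < n := by
        rcases hV with hV | hV
        · have := lowOf_lt hf; omega
        · exact hV.1
      have hc := card_clsOne_mul (par := par) (f := f) (r := r) N.src_lt N.dst_lt
      rw [if_neg hl]
      refine HRun.le (HRun.seq (HRun.of_wp (cmLoad_wp hB hP₁.toTreeTables hV hlt h9 h10)).frame
        fun τ₂ h₂ => HRun.imp (HRun.frame (cmConfig_run N hB
          ⟨hP₁.frame h₂.2 (by decide), h₂.1, hlt, (h₂.2.i 4 (by decide)).trans h4,
            (h₂.2.i 9 (by decide)).trans h9, (h₂.2.i 10 (by decide)).trans h10⟩))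
          fun τ₃ h₃ => ?_) (le_trans (Nat.add_le_add_right (show _ ≤ 9 by decide) _) ?_)
      · obtain ⟨⟨hS, hU⟩, hF₃⟩ := h₃
        refine hfin τ₃ ((hP₁.frame h₂.2 (by decide)).frame hF₃ (by decide)) fun g hg g1 g2 => ?_
        rcases Nat.lt_succ_iff_lt_or_eq.1 hg with hg | rfl
        · exact ((hI₁ g hg g1 g2).frame h₂.2 (by decide)).untouched H hf (by omega) hg.ne hl g2 hU
        · exact hS
      · omega
    · refine ⟨1, τ₁, .skip _, by omega, hfin τ₁ hP₁ fun g hg g1 g2 => ?_⟩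
      rcases Nat.lt_succ_iff_lt_or_eq.1 hg with hg | rfl
      · exact hI₁ g hg g1 g2
      · simp [Cd.holds, h9, h10, hP₁.i2, g1, g2] at h
  · rintro τ ⟨hP, hI⟩ _
    exact ⟨hP.toTreeTables, hI⟩
  · have hsum := H.sum_smallArcs_le (m := m) (aS := aS) (aD := aD)
    -- The first `n` failures have empty small parts. The other `n` are indexed by their lower
    -- vertex, so the main term is the sum bounded above.
    have : ∑ f ∈ Finset.range (2 * n), (cost f + 2) = 12 * ∑ v ∈ (Finset.range n).filter (· ≠ r),
        (smallPart n r par v).card * (smallArcs n m r par aS aD v).card +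
        2 * n * (60 * n + 100 * m + 142) := by
      simp only [cost, add_assoc]
      rw [Finset.sum_add_distrib, ← Finset.mul_sum, two_mul, Finset.sum_range_add,
        Finset.sum_eq_zero fun x hx => if_pos (Finset.mem_range.1 hx), zero_add, Finset.sum_filter]
      congr 1
      · congr 1
        refine Finset.sum_congr rfl fun x _ => ?_
        simp [lowOf]
      · simp
    rw [this]
    nlinarith

end

/-! ## The queries -/

/-- Read the query; the target goes to variable `18`, the number of the failure to variable `4`. -/
def cmRead : Cm :=
  (18 ≔ .v 0 ;; 26 ≔ .ld 10 (.c 0)) ;;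
  .ite (.v 1 =ₑ .c 0)
    (14 ≔ .c 0 ;; 15 ≔ .c 0 ;; 16 ≔ .c 0 ;; 17 ≔ .c 0 ;; 4 ≔ .c 0)
    ((.ite (.ld 5 (.v 2) <ₑ .ld 5 (.v 3)) (9 ≔ .v 3) (9 ≔ .v 2) ;;
     .ite (.v 1 =ₑ .c 1) (10 ≔ .v 9 ;; 4 ≔ .v 9)
      (.ite (.ld 5 (.v 4) <ₑ .ld 5 (.v 5)) (10 ≔ .v 5) (10 ≔ .v 4) ;;
       .ite (.ld 5 (.v 10) <ₑ .ld 5 (.v 9)) (27 ≔ .v 9 ;; 9 ≔ .v 10 ;; 10 ≔ .v 27) .skip ;;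
       4 ≔ .v 26 +ₑ .v 10)) ;;
     cmLoad)

/-- The distance query. The class of the target remains in variable `8`. -/
def cmDist : Cm :=
  cmRead ;; 6 ≔ .v 18 ;; cmClassify ;;
  .ite (.v 8 =ₑ .c 0) (0 ≔ .c 1 ;; 0 ≔ᵣ .ld 1 (.v 6))
    (.ite (.v 8 =ₑ .c 1)
      (.ite (.ld 7 (.v 11 +ₑ .v 6) =ₑ .c 0) (0 ≔ .c 0)
        (0 ≔ .c 1 ;; 0 ≔ᵣ .ld 2 (.v 11 +ₑ .v 6)))
      (.ite (.ld 8 (.v 4) =ₑ .c 0) (0 ≔ .c 0)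
        (0 ≔ .c 1 ;; 27 ≔ .ld 8 (.v 4) -ₑ .c 1 ;;
         0 ≔ᵣ .ld 3 (.v 4) +ᵣ (.ld 1 (.v 27) -ᵣ .ld 1 (.v 13)) +ᵣ
          (.ld 1 (.v 6) -ᵣ .ld 1 (.v 13)))))

/-- The number of the failure with lower vertices `v₁` and `v₂`. -/
def numOf (n v₁ v₂ : ℕ) : ℕ := if v₁ = n + 1 then 0 else if v₁ = v₂ then v₂ else n + v₂

/-- The results for the failure `f` as seen by a query. -/
structure QueryMem (n r : ℕ) (par dep : ℕ → ℕ) (v₁ v₂ f : ℕ) (sp : ℕ → ℕ) (sv : ℕ → ℝ) (xs z : ℕ)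
    (lam : ℝ) (σ : MState) : Prop where
  small : ∀ y < n, cfgCls n r par v₁ v₂ y = 1 →
    σ.ints 7 (rowKey n r par dep v₂ * n + y) = sp y ∧
    σ.reals 2 (rowKey n r par dep v₂ * n + y) = sv y
  large : ∀ y < n, cfgCls n r par v₁ v₂ y = 2 →
    σ.ints 8 f = xs ∧ σ.ints 9 f = z ∧ σ.reals 3 f = lam

/-- What is known about the memory during a query. -/
structure QueryEnv (n r : ℕ) (par dep : ℕ → ℕ) (pw : ℕ → ℝ) (v₁ v₂ : ℕ) (sp : ℕ → ℕ)
    (sv : ℕ → ℝ) (xs z : ℕ) (lam : ℝ) (σ : MState) : Prop extends TreeTables n r par dep pw σ,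
    PairVars n r par dep v₁ v₂ σ,
    QueryMem n r par dep v₁ v₂ (numOf n v₁ v₂) sp sv xs z lam σ where
  i4 : σ.ivar 4 = numOf n v₁ v₂

section
variable {B n m r : ℕ} {par dep : ℕ → ℕ} {pw : ℕ → ℝ} {v₁ v₂ f : ℕ} {sp : ℕ → ℕ} {sv : ℕ → ℝ}
  {xs z : ℕ} {lam : ℝ} {σ τ : MState}

theorem QueryMem.frame (h : QueryMem n r par dep v₁ v₂ f sp sv xs z lam σ) {W : List (ℕ × ℕ)}
    (hF : Frame W σ τ) (hW : ∀ x ∈ storeCells, x ∉ W) :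
    QueryMem n r par dep v₁ v₂ f sp sv xs z lam τ := by
  constructor
  · rw [hF.ai 7 (hW _ (by decide)), hF.ar 2 (hW _ (by decide))]; exact h.small
  · rw [hF.ai 8 (hW _ (by decide)), hF.ai 9 (hW _ (by decide)), hF.ar 3 (hW _ (by decide))]
    exact h.large

theorem QueryEnv.frame (h : QueryEnv n r par dep pw v₁ v₂ sp sv xs z lam σ) {W : List (ℕ × ℕ)}
    (hF : Frame W σ τ) (hW : ∀ x ∈ (0, 4) :: pairCells ++ (treeCells ++ storeCells), x ∉ W) :
    QueryEnv n r par dep pw v₁ v₂ sp sv xs z lam τ :=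
  ⟨h.toTreeTables.frame hF fun x hx => hW x (by simp [hx]),
    h.toPairVars.frame hF fun x hx => hW x (by simp [hx]),
    h.toQueryMem.frame hF fun x hx => hW x (by simp [hx]),
    (hF.i 4 (hW _ (by decide))).trans h.i4⟩

theorem QueryEnv.lt_of_cls (h : QueryEnv n r par dep pw v₁ v₂ sp sv xs z lam σ)
    (H : RTree n r par dep) {y : ℕ} (hy : y < n) (hc : cfgCls n r par v₁ v₂ y ≠ 0) :
    v₁ < n ∧ v₂ < n ∧ v₁ ≠ r ∧ v₂ ≠ r ∧ σ.ivar 13 = cfgTop n r par v₁ v₂ ∧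
      σ.ivar 11 = rowKey n r par dep v₂ * n := by
  have h1 : v₁ < n := by
    rw [Ne, cfgCls_eq_zero, not_not] at hc
    exact H.anc_lt hc hy
  rcases h.valid with h' | h'
  · omega
  rcases h.range with h'' | h''
  · omega
  exact ⟨h1, h'.2.1, h'.2.2.1, h'.2.2.2.1, h''.2.2.2.2.2.2⟩

/-- The lower endpoint of a tree edge is the deeper one. Comparing depths finds it for each failed
edge and then orders the two edges, whatever their order and orientation in the input. -/
theorem cmRead_run (H : RTree n r par dep) (hB : BigWord B n m)
    (hT : TreeTables n r par dep pw σ) (hV : ValidPair n r par v₁ v₂)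
    (hI : PairInput n par v₁ v₂ (σ.ivar 1) (σ.ivar 2) (σ.ivar 3) (σ.ivar 4) (σ.ivar 5)) :
    HRun B cmRead σ 30 fun τ => PairVars n r par dep v₁ v₂ τ ∧ τ.ivar 4 = numOf n v₁ v₂ ∧
      τ.ivar 18 = σ.ivar 0 := by
  have hB' := hB
  unfold BigWord at hB'
  have load : ∀ τ : MState, TreeTables n r par dep pw τ → v₁ < n → τ.ivar 9 = v₁ →
      τ.ivar 10 = v₂ → τ.ivar 4 = numOf n v₁ v₂ → τ.ivar 18 = σ.ivar 0 → HRun B cmLoad τ 9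
      fun τ => PairVars n r par dep v₁ v₂ τ ∧ τ.ivar 4 = numOf n v₁ v₂ ∧ τ.ivar 18 = σ.ivar 0 := by
    intro τ hT' h1 h9 h10 h4 h18
    refine HRun.mono (HRun.of_wp (cmLoad_wp hB hT' hV h1 h9 h10)).frame (by decide) ?_
    exact fun τ' h => ⟨h.1, (h.2.i 4 (by decide)).trans h4, (h.2.i 18 (by decide)).trans h18⟩
  refine HRun.le (HRun.seq (R := fun τ => (τ.ivar 18 = σ.ivar 0 ∧ τ.ivar 26 = n) ∧
    Frame [(0, 18), (0, 26)] σ τ) (b₁ := 2) (b₂ := 10 + 9 + 1) (HRun.frame (HRun.of_wp ?_))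
    fun σ₁ h₁ => ?_) (by omega)
  · simp [hT.count]; omega
  obtain ⟨⟨h18, h26⟩, hF₁⟩ := h₁
  have hT₁ := hT.frame hF₁ (by decide)
  rw [← hF₁.i 1 (by decide), ← hF₁.i 2 (by decide), ← hF₁.i 3 (by decide), ← hF₁.i 4 (by decide),
    ← hF₁.i 5 (by decide)] at hI
  refine HRun.ite ⟨trivial, by simp only [Ex.fits]; omega⟩ (fun h => ?_) (fun h => ?_)
  · simp only [Cd.holds, Ex.eval] at h
    rcases hI with ⟨-, h1, h2⟩ | ⟨h1, -⟩ | ⟨h1, -⟩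
    · refine (HRun.of_wp ?_).le (show _ ≤ 19 by decide)
      simp [h18, numOf, h1]
      refine ⟨by omega, by rw [← h1]; exact hV, .inl ⟨rfl, by simp⟩⟩
    · omega
    · omega
  · simp only [Cd.holds, Ex.eval] at h
    have hd : ∀ v < n, v ≠ r → par v < n ∧ dep v = dep (par v) + 1 := fun v hv hr =>
      ⟨H.par_lt v hv, H.dep_par v hv hr⟩
    have h5 := hT₁.depth
    have hlt : v₁ < n ∧ v₂ < n ∧ v₁ ≠ r ∧ v₂ ≠ r := by
      rcases hI with ⟨h1, -⟩ | ⟨-, h1, h2, -⟩ | ⟨-, h1, h2, -⟩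
      · omega
      · rcases hV with h' | h'
        · omega
        · exact ⟨h'.1, h'.2.1, h'.2.2.1, h'.2.2.2.1⟩
      · rcases hV with h' | h'
        · omega
        · exact ⟨h'.1, h'.2.1, h'.2.2.1, h'.2.2.2.1⟩
    refine HRun.seq (HRun.frame (HRun.le (HRun.of_wp (Q := fun τ => τ.ivar 9 = v₁ ∧ τ.ivar 10 = v₂ ∧
      τ.ivar 4 = numOf n v₁ v₂) ?_) (show _ ≤ 10 by decide))) fun τ hτ =>
      load τ (hT₁.frame hτ.2 (by decide)) hlt.1 hτ.1.1 hτ.1.2.1 hτ.1.2.2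
        ((hτ.2.i 18 (by decide)).trans h18)
    obtain ⟨l1, l2, l3, l4⟩ := hlt
    have d1 := hd v₁ l1 l3
    have d2 := hd v₂ l2 l4
    have e1 := h5 v₁ l1
    have e2 := h5 v₂ l2
    have e3 := h5 _ d1.1
    have e4 := h5 _ d2.1
    have hn1 : v₁ ≠ n + 1 := by omega
    rcases hI with ⟨h1, -⟩ | ⟨k1, -, rfl, hE⟩ | ⟨k2, -, hp, hE⟩
    · omega
    · rcases hE with ⟨g1, g2⟩ | ⟨g1, g2⟩
      · simp [g1, g2, k1, e1, e3, numOf]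
        omega
      · simp [g1, g2, k1, e1, e3, numOf]
        omega
    · have hne : v₁ ≠ v₂ := by rintro rfl; rw [← hp] at d1; omega
      rw [← hp] at d2 e4
      rcases hE with ⟨⟨g1, g2⟩ | ⟨g1, g2⟩, ⟨g3, g4⟩ | ⟨g3, g4⟩⟩ |
          ⟨⟨g1, g2⟩ | ⟨g1, g2⟩, ⟨g3, g4⟩ | ⟨g3, g4⟩⟩ <;>
        simp [g1, g2, g3, g4, k2, e1, e2, e3, numOf, h26, hne, hn1, ← hp] <;> omega

theorem cfgCls_le_two (y : ℕ) : cfgCls n r par v₁ v₂ y ≤ 2 := by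
  unfold cfgCls; split_ifs <;> omega

theorem cmDist_run (H : RTree n r par dep) (hB : BigWord B n m)
    (hT : TreeTables n r par dep pw σ) (hV : ValidPair n r par v₁ v₂)
    (hQ : QueryMem n r par dep v₁ v₂ (numOf n v₁ v₂) sp sv xs z lam σ)
    (hI : PairInput n par v₁ v₂ (σ.ivar 1) (σ.ivar 2) (σ.ivar 3) (σ.ivar 4) (σ.ivar 5)) {t : ℕ}
    (ht : t < n) (hσ : σ.ivar 0 = t) (hxs : xs ≤ n) :
    HRun B cmDist σ 60 fun τ => QueryEnv n r par dep pw v₁ v₂ sp sv xs z lam τ ∧ τ.ivar 6 = t ∧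
      τ.ivar 8 = cfgCls n r par v₁ v₂ t ∧
      (Settled (cfgCls n r par v₁ v₂) sp xs t ∧ τ.ivar 0 = 1 ∧
        τ.rvar 0 = settledVal (climbSum par dep pw) (cfgCls n r par v₁ v₂) (cfgTop n r par v₁ v₂)
          sv xs lam t ∨ ¬ Settled (cfgCls n r par v₁ v₂) sp xs t ∧ τ.ivar 0 = 0) := by
  have hB' := hB
  unfold BigWord at hB'
  refine HRun.le (HRun.seq (HRun.frame (cmRead_run H hB hT hV hI)) fun σ₁ h₁ => ?_)
    (b₁ := 30 + 30) le_rfl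
  obtain ⟨⟨hP, h4, h18⟩, hF⟩ := h₁
  have hE : QueryEnv n r par dep pw v₁ v₂ sp sv xs z lam σ₁ :=
    ⟨hT.frame hF (by decide), hP, hQ.frame hF (by decide), h4⟩
  have hE' : QueryEnv n r par dep pw v₁ v₂ sp sv xs z lam (σ₁.setI 6 t) :=
    hE.frame (W := [(0, 6)]) ⟨fun x hx => by simp_all, fun _ _ => rfl, fun _ _ => rfl,
      fun _ _ => rfl⟩ (by decide)
  have hcls := cfgCls_le_two (n := n) (r := r) (par := par) (v₁ := v₁) (v₂ := v₂) t
  refine HRun.mono (HRun.frame (HRun.of_wp (c := 6 ≔ .v 18 ;; cmClassify ;;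
    .ite (.v 8 =ₑ .c 0) _ _) (Q := fun τ => τ.ivar 6 = t ∧ τ.ivar 8 = cfgCls n r par v₁ v₂ t ∧
      (Settled (cfgCls n r par v₁ v₂) sp xs t ∧ τ.ivar 0 = 1 ∧
        τ.rvar 0 = settledVal (climbSum par dep pw) (cfgCls n r par v₁ v₂) (cfgTop n r par v₁ v₂)
          sv xs lam t ∨ ¬ Settled (cfgCls n r par v₁ v₂) sp xs t ∧ τ.ivar 0 = 0)) ?_)) (by decide)
    fun τ h => ⟨hE.frame h.2 (by decide), h.1⟩
  refine ⟨trivial, ?_⟩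
  simp only [Ex.eval, h18, hσ]
  refine cmClassify_wp H hB hE'.toTreeTables hE'.toPairVars ht (by simp) ?_
  have hd := hE.dist t ht
  have hlt := fun h => hE.lt_of_cls H ht h
  have hsm := hE.small t ht
  have hla := hE.large t ht
  have hrow := fun h : v₂ < n => H.row_le (dep := dep) h
  have hdx := hE.dist (xs - 1) 
  have hdt := hE.dist (cfgTop n r par v₁ v₂)
  have htop : v₁ < n → v₂ < n → cfgTop n r par v₁ v₂ < n := by
    intro h1 h2; unfold cfgTop; split_ifs <;> assumption
  set cls := cfgCls n r par v₁ v₂ with hc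
  rcases (by omega : cls t = 0 ∨ cls t = 1 ∨ cls t = 2) with h0 | h1 | h2
  · simp [h0, Settled, settledVal, hd]
    omega
  · obtain ⟨l1, l2, -, -, l3, l4⟩ := hlt (by omega)
    have := hrow l2
    simp [h1, Settled, settledVal, l4, hsm h1]
    omega
  · obtain ⟨l1, l2, -, -, l3, l4⟩ := hlt (by omega)
    simp [h2, Settled, settledVal, l3, hE.i4, hla h2, hd, hdt (htop l1 l2)]
    refine ⟨by omega, by omega, by omega, fun h => ⟨by omega, h⟩, fun h => ⟨by omega, h, ?_⟩⟩
    rw [hdx (by omega)]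

end

/-! ### The path query -/

/-- Append the first vertices on the way from variable `20` to the root to the buffer; their number
is in variable `21`. -/
def cmPush : Cm :=
  .while (.c 0 <ₑ .v 21)
    (.st 12 (.v 19) (.v 20) ;; 19 ≔ .v 19 +ₑ .c 1 ;; 20 ≔ .ld 2 (.v 20) ;; 21 ≔ .v 21 -ₑ .c 1)

/-- Append the same vertices in the opposite order. -/
def cmPushRev : Cm :=
  (19 ≔ .v 19 +ₑ .v 21 ;; 22 ≔ .v 19) ;;
  .while (.c 0 <ₑ .v 21)
    (22 ≔ .v 22 -ₑ .c 1 ;; .st 12 (.v 22) (.v 20) ;; 20 ≔ .ld 2 (.v 20) ;; 21 ≔ .v 21 -ₑ .c 1)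

/-- Append the way through the large part to the buffer and go on at its entry. -/
def cmLarge : Cm :=
  21 ≔ .ld 5 (.v 20) -ₑ .ld 5 (.v 13) +ₑ .c 1 ;; cmPush ;;
  (20 ≔ .ld 8 (.v 4) -ₑ .c 1 ;; 21 ≔ .ld 5 (.v 20) -ₑ .ld 5 (.v 13)) ;; cmPushRev ;;
  20 ≔ .ld 9 (.v 4)

/-- Collect the reversed path in the buffer, up to the part that contains the root. -/
def cmTrace : Cm :=
  .while (.not (.v 8 =ₑ .c 0))
    (.ite (.v 8 =ₑ .c 1)
      (.st 12 (.v 19) (.v 20) ;; 19 ≔ .v 19 +ₑ .c 1 ;; 20 ≔ .ld 7 (.v 11 +ₑ .v 20) -ₑ .c 1)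
      cmLarge ;;
     (6 ≔ .v 20 ;; cmClassify))

/-- Write the output. -/
def cmOutput : Cm :=
  .for 22 (.v 19) (.st 11 (.v 22) (.ld 12 (.v 19 -ₑ .c 1 -ₑ .v 22))) ;;
  (0 ≔ .c 1 ;; 1 ≔ .v 19 -ₑ .c 1)

/-- The path query. -/
def cmPath : Cm :=
  cmDist ;;
  .ite (.v 0 =ₑ .c 1)
    ((19 ≔ .c 0 ;; 20 ≔ .v 6) ;; cmTrace ;; 21 ≔ .ld 5 (.v 20) +ₑ .c 1 ;; cmPush ;; cmOutput)
    .skip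

/-- The buffer holds the list. -/
def Buffer (l : List ℕ) (σ : MState) : Prop :=
  σ.ivar 19 = l.length ∧ ∀ i (h : i < l.length), σ.ints 12 i = l[i]

section
variable {B n m r : ℕ} {par dep : ℕ → ℕ} {pw : ℕ → ℝ} {v₁ v₂ f : ℕ} {sp : ℕ → ℕ} {sv : ℕ → ℝ}
  {xs z : ℕ} {lam : ℝ} {σ τ : MState}

theorem Buffer.frame {l : List ℕ} (h : Buffer l σ) {W : List (ℕ × ℕ)} (hF : Frame W σ τ)
    (hW : ∀ x ∈ [(0, 19), (2, 12)], x ∉ W) : Buffer l τ := by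
  unfold Buffer
  rw [hF.i 19 (hW _ (by decide)), hF.ai 12 (hW _ (by decide))]
  exact h

theorem getElem_update_append {a : ℕ → ℕ} {l : List ℕ} (h : ∀ i (h : i < l.length), a i = l[i])
    (v : ℕ) : ∀ i (h : i < (l ++ [v]).length), Function.update a l.length v i = (l ++ [v])[i] := by
  intro i hi
  by_cases hil : i < l.length
  · rw [Function.update_of_ne hil.ne, List.getElem_append_left hil]
    exact h i hil
  · have : i = l.length := by simp at hi; omega
    subst this
    simp

theorem RTree.iterate_lt (H : RTree n r par dep) {y : ℕ} (hy : y < n) (k : ℕ) : par^[k] y < n := by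
  induction k with
  | zero => exact hy
  | succ k ih => rw [Function.iterate_succ_apply']; exact H.par_lt _ ih

theorem cmPush_run (H : RTree n r par dep) (hT : TreeTables n r par dep pw σ) (hB : 1 < B) {y k : ℕ}
    (hy : y < n) (h20 : σ.ivar 20 = y) (h21 : σ.ivar 21 = k) {l : List ℕ} (hl : Buffer l σ)
    (hlB : l.length + k < B) :
    HRun B cmPush σ (5 * k + 1) (Buffer (l ++ climbList par y k)) := by
  refine HRun.while' (fun b τ => ∃ j ≤ k, τ.ivar 20 = par^[j] y ∧ τ.ivar 21 = k - j ∧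
    Buffer (l ++ climbList par y j) τ ∧ b = 5 * (k - j) + 1) ?_ ?_ ?_ ?_
  · exact ⟨0, by omega, by simpa using h20, by simpa using h21, by simpa using hl, by simp⟩
  · intro b τ _ _
    exact ⟨by simp only [Ex.fits]; omega, trivial⟩
  · rintro b τ ⟨j, hj, h1, h2, ⟨h3, h4⟩, rfl⟩ hF hc
    simp only [Cd.holds, Ex.eval, h2] at hc
    have hTτ := hT.frame hF (by decide)
    refine ⟨4, 5 * (k - (j + 1)) + 1, by omega, (HRun.of_wp ?_).le (show _ ≤ 4 by decide)⟩
    have hp := hTτ.parent _ (H.iterate_lt hy j)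
    simp only [List.length_append, climbList_length] at h3
    simp [h1, h2, h3, hp]
    refine ⟨by omega, by omega, j + 1, by omega, ?_, by omega, ⟨?_, ?_⟩, rfl⟩
    · rw [Function.iterate_succ_apply']
    · simp; omega
    · intro i hi
      simp only [List.length_append, climbList_length] at hi
      have := getElem_update_append h4 (par^[j] y) i (by simp; omega)
      simpa [climbList_succ', List.append_assoc] using this
  · rintro b τ ⟨j, hj, h1, h2, h3, rfl⟩ hF hc
    simp only [Cd.holds, Ex.eval, h2] at hc
    obtain rfl : j = k := by omega
    exact ⟨by omega, h3⟩

theorem cmPushRev_run (H : RTree n r par dep) (hT : TreeTables n r par dep pw σ) (hB : 1 < B)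
    {y k : ℕ}
    (hy : y < n) (h20 : σ.ivar 20 = y) (h21 : σ.ivar 21 = k) {l : List ℕ} (hl : Buffer l σ)
    (hlB : l.length + k < B) :
    HRun B cmPushRev σ (5 * k + 3) (Buffer (l ++ (climbList par y k).reverse)) := by
  refine HRun.le (HRun.seq (R := fun τ => (τ.ivar 19 = l.length + k ∧ τ.ivar 22 = l.length + k) ∧
    Frame [(0, 19), (0, 22)] σ τ) (b₁ := 2) (b₂ := 5 * k + 1) (HRun.frame (HRun.of_wp ?_)) ?_)
    (by omega)
  · simp [hl.1, h21]; omega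
  rintro σ₁ ⟨⟨e19, e22⟩, hF₁⟩
  have hl12 := hl.2
  rw [← hF₁.ai 12 (by decide)] at hl12
  rw [← hF₁.i 20 (by decide)] at h20
  rw [← hF₁.i 21 (by decide)] at h21
  replace hT := hT.frame hF₁ (by decide)
  refine HRun.while' (fun b τ => ∃ j ≤ k, τ.ivar 20 = par^[j] y ∧ τ.ivar 21 = k - j ∧
    τ.ivar 22 = l.length + k - j ∧ (∀ i (h : i < l.length), τ.ints 12 i = l[i]) ∧
    (∀ i < j, τ.ints 12 (l.length + k - 1 - i) = par^[i] y) ∧ b = 5 * (k - j) + 1) ?_ ?_ ?_ ?_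
  · exact ⟨0, by omega, by simpa using h20, by simpa using h21, by simpa using e22, hl12,
      by simp, by simp⟩
  · intro b τ _ _
    exact ⟨by simp only [Ex.fits]; omega, trivial⟩
  · rintro b τ ⟨j, hj, h1, h2, h3, h4, h5, rfl⟩ hF hc
    simp only [Cd.holds, Ex.eval, h2] at hc
    have hTτ := hT.frame hF (by decide)
    refine ⟨4, 5 * (k - (j + 1)) + 1, by omega, (HRun.of_wp ?_).le (show _ ≤ 4 by decide)⟩
    have hp := hTτ.parent _ (H.iterate_lt hy j)
    simp [h1, h2, h3, hp]
    refine ⟨by omega, j + 1, by omega, ?_, by omega, by omega, ?_, ?_, rfl⟩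
    · rw [Function.iterate_succ_apply']
    · intro i hi
      rw [Function.update_of_ne (by omega)]
      exact h4 i hi
    · intro i hi
      rcases Nat.lt_succ_iff_lt_or_eq.1 hi with hi | rfl
      · rw [Function.update_of_ne (by omega)]
        exact h5 i hi
      · rw [show l.length + k - 1 - i = l.length + k - i - 1 by omega, Function.update_self]
  · rintro b τ ⟨j, hj, h1, h2, h3, h4, h5, rfl⟩ hF hc
    simp only [Cd.holds, Ex.eval, h2] at hc
    obtain rfl : j = k := by omega
    refine ⟨by omega, ?_, ?_⟩
    · simpa using (hF.i 19 (by decide)).trans e19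
    · intro i hi
      simp at hi
      by_cases hil : i < l.length
      · rw [List.getElem_append_left hil]
        exact h4 i hil
      · have := h5 (l.length + j - 1 - i) (by omega)
        rw [show l.length + j - 1 - (l.length + j - 1 - i) = i by omega] at this
        rw [this, List.getElem_append_right (by omega)]
        simp [climbList]
        congr 1
        omega

/-- The class of the current vertex determines which rule applies, so a trace is the deterministic
run of the path query. -/
theorem Trace.unique {cls : ℕ → ℕ} {t y : ℕ} {l l' : List ℕ} (h : Trace par dep cls t sp xs z y l)
    (h' : Trace par dep cls t sp xs z y l') : l = l' := by
  induction h generalizing l' with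
  | base h => cases h' with
    | base _ => rfl
    | small h1 _ _ => omega
    | large h1 _ _ => omega
  | small h _ _ ih => cases h' with
    | base _ => omega
    | small _ _ h2 => rw [ih h2]
    | large h1 _ _ => omega
  | large h _ _ ih => cases h' with
    | base _ => omega
    | small h1 _ _ => omega
    | large _ _ h2 => rw [ih h2]

/-- Needed only so that buffer positions fit into words. Each round adds at most `2 * n` vertices,
and no vertex starts two rounds, since along a trace the remaining traces get strictly shorter and
each is determined by its start. -/
theorem Trace.length_le (H : RTree n r par dep) {cls : ℕ → ℕ} {t y : ℕ} {l : List ℕ}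
    (hsp : ∀ y < n, cls y = 1 → sp y ≤ n) (hxs : xs ≤ n) (hz : xs ≠ 0 → z < n) (hy : y < n)
    (h : Trace par dep cls t sp xs z y l) : l.length ≤ n * (2 * n) := by
  have hd : ∀ v < n, dep v < n := fun v hv => H.dep_lt hv
  -- `s` collects the vertices at which a round starts; each has a trace no longer than the present
  -- one, so a new start with a longer trace is not among them.
  suffices ∃ s : Finset ℕ, s ⊆ Finset.range n ∧
      (∀ x ∈ s, ∃ l', Trace par dep cls t sp xs z x l' ∧ l'.length ≤ l.length) ∧
      l.length ≤ s.card * (2 * n) by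
    obtain ⟨s, h1, -, h2⟩ := this
    have := Finset.card_le_card h1
    rw [Finset.card_range] at this
    exact h2.trans (Nat.mul_le_mul_right _ this)
  have key : ∀ (s : Finset ℕ) (y : ℕ) (l₀ l : List ℕ), y < n → s ⊆ Finset.range n →
      (∀ x ∈ s, ∃ l', Trace par dep cls t sp xs z x l' ∧ l'.length ≤ l₀.length) →
      l₀.length ≤ s.card * (2 * n) → Trace par dep cls t sp xs z y l → l₀.length < l.length →
      l.length ≤ l₀.length + 2 * n → ∃ s : Finset ℕ, s ⊆ Finset.range n ∧
      (∀ x ∈ s, ∃ l', Trace par dep cls t sp xs z x l' ∧ l'.length ≤ l.length) ∧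
      l.length ≤ s.card * (2 * n) := by
    intro s y l₀ l hy hs hs' hc hl hlt hle
    have hys : y ∉ s := by
      intro h
      obtain ⟨l', h1, h2⟩ := hs' y h
      rw [h1.unique hl] at h2
      omega
    refine ⟨insert y s, ?_, ?_, ?_⟩
    · intro x hx
      rcases Finset.mem_insert.1 hx with rfl | hx
      · exact Finset.mem_range.2 hy
      · exact hs hx
    · intro x hx
      rcases Finset.mem_insert.1 hx with rfl | hx
      · exact ⟨l, hl, le_rfl⟩
      · obtain ⟨l', h1, h2⟩ := hs' x hx
        exact ⟨l', h1, by omega⟩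
    · rw [Finset.card_insert_of_notMem hys, add_mul]
      omega
  induction h with
  | @base y h =>
    have := hd y hy
    exact key ∅ y [] _ hy (by simp) (by simp) (by simp) (.base h) (by simp) (by simp; omega)
  | @small y l h1 h2 h3 ih =>
    have := hsp y hy h1
    obtain ⟨s, g1, g2, g3⟩ := ih (by omega)
    exact key s y l _ hy g1 g2 g3 (.small h1 h2 h3) (by simp) (by simp; omega)
  | @large y l h1 h2 h3 ih =>
    obtain ⟨s, g1, g2, g3⟩ := ih (hz h2)
    have e1 := hd y hy
    have e2 := hd (xs - 1) (by omega)
    refine key s y l _ hy g1 g2 g3 (.large h1 h2 h3) (by simp; omega) (by simp; omega)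

/-- The loop of the path query follows the derivation of the trace, so it is verified by induction
on `Trace`, unfolding one pass at a time. -/
theorem HRun.while_step {c : Cd} {p : Cm} {b₁ b₂ : ℕ} {Q R : MState → Prop} (hf : c.fits B σ)
    (hc : c.holds σ) (h₁ : HRun B p σ b₁ R) (h₂ : ∀ τ, R τ → HRun B (.while c p) τ b₂ Q) :
    HRun B (.while c p) σ (b₁ + b₂ + 1) Q := by
  obtain ⟨k, τ, h, hk, hR⟩ := h₁
  obtain ⟨k', τ', h', hk', hQ⟩ := h₂ τ hR
  exact ⟨_, _, .while_true hf hc h h', by omega, hQ⟩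

/-- Every pass appends at least one vertex, so constant overhead is charged to the output. The loop
stops in the part of the root; the remaining climb is left to the caller, and as it is nonempty it
pays for the failing test. -/
theorem cmTrace_run (H : RTree n r par dep) (hB : BigWord B n m)
    (hsp : ∀ y < n, cfgCls n r par v₁ v₂ y = 1 → sp y ≤ n) (hxs : xs ≤ n) (hz : xs ≠ 0 → z < n)
    (hx2 : xs ≠ 0 → xs - 1 < n) {y : ℕ}
    {l : List ℕ} (h : Trace par dep (cfgCls n r par v₁ v₂) (cfgTop n r par v₁ v₂) sp xs z y l) :
    ∀ (σ : MState) (l₀ : List ℕ), QueryEnv n r par dep pw v₁ v₂ sp sv xs z lam σ → y < n →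
      σ.ivar 20 = y → σ.ivar 8 = cfgCls n r par v₁ v₂ y → Buffer l₀ σ →
      l₀.length + l.length < B →
      HRun B cmTrace σ (50 * l.length) fun τ => ∃ y₀ l₁, y₀ < n ∧ τ.ivar 20 = y₀ ∧ Buffer l₁ τ ∧
        l₁ ++ climbList par y₀ (dep y₀ + 1) = l₀ ++ l ∧
        QueryEnv n r par dep pw v₁ v₂ sp sv xs z lam τ := by
  have hB' := hB
  unfold BigWord at hB'
  have hfit : ∀ σ, (Cd.not (.eq (.v 8) (.c 0))).fits B σ := fun σ =>
    ⟨trivial, by simp only [Ex.fits]; omega⟩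
  set cls := cfgCls n r par v₁ v₂ with hcls
  have hclass : ∀ (σ : MState) (y : ℕ) (l : List ℕ), QueryEnv n r par dep pw v₁ v₂ sp sv xs z lam σ →
      y < n → σ.ivar 20 = y → Buffer l σ → HRun B (6 ≔ .v 20 ;; cmClassify) σ 8 fun τ =>
        QueryEnv n r par dep pw v₁ v₂ sp sv xs z lam τ ∧ τ.ivar 20 = y ∧ τ.ivar 8 = cls y ∧
        Buffer l τ := by
    intro σ y l hE hy h20 hl
    refine HRun.mono (HRun.frame (HRun.of_wp (Q := fun τ => τ.ivar 8 = cls y) ?_)) (by decide)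
      fun τ h => ⟨hE.frame h.2 (by decide), (h.2.i 20 (by decide)).trans h20, h.1,
        hl.frame h.2 (by decide)⟩
    have hE' : QueryEnv n r par dep pw v₁ v₂ sp sv xs z lam (σ.setI 6 y) :=
      hE.frame (W := [(0, 6)]) ⟨fun x hx => by simp_all, fun _ _ => rfl, fun _ _ => rfl,
        fun _ _ => rfl⟩ (by decide)
    refine ⟨trivial, ?_⟩
    simp only [Ex.eval, h20]
    exact cmClassify_wp H hB hE'.toTreeTables hE'.toPairVars hy (by simp) (by simp [hcls])
  induction h with
  | @base y hc =>
    intro σ l₀ hE hy h20 h8 hl hlB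
    refine ⟨1, σ, .while_false (hfit σ) ?_, ?_, y, l₀, hy, h20, hl, rfl, hE⟩
    · simp [h8, hc]
    · simp; omega
  | @small y l hc hs h' ih =>
    intro σ l₀ hE hy h20 h8 hl hlB
    have hlt := hsp y hy hc
    obtain ⟨g1, g2, -, -, g5, g6⟩ := hE.lt_of_cls H hy (by rw [← hcls]; omega)
    have hrow := H.row_le (dep := dep) g2
    refine HRun.le (HRun.while_step (b₁ := 4 + 8) (b₂ := 50 * l.length) (hfit σ)
      (by simp [h8, hc]) (HRun.seq (R := fun τ => QueryEnv n r par dep pw v₁ v₂ sp sv xs z lam τ ∧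
        τ.ivar 20 = sp y - 1 ∧ Buffer (l₀ ++ [y]) τ)
        (HRun.ite (b := 3) ⟨trivial, by simp only [Ex.fits]; omega⟩ (fun _ => ?_) fun h => ?_)
        fun τ hτ => hclass τ (sp y - 1) (l₀ ++ [y]) hτ.1 (by omega) hτ.2.1 hτ.2.2)
      fun τ hτ => ?_) (by simp only [List.length_cons]; omega)
    · refine HRun.imp (HRun.frame (HRun.of_wp (Q := fun τ =>
        τ.ivar 20 = sp y - 1 ∧ Buffer (l₀ ++ [y]) τ) ?_)) fun τ h => ⟨hE.frame h.2 (by decide), h.1⟩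
      have h7 := (hE.small y hy hc).1
      simp [h20, g6, h7, hl.1]
      simp only [List.length_cons] at hlB
      refine ⟨by omega, by omega, by simp, ?_⟩
      intro i hi
      simpa using getElem_update_append hl.2 y i hi
    · simp [h8, hc] at h
    · obtain ⟨e1, e2, e3, e4⟩ := hτ
      have := ih τ (l₀ ++ [y]) e1 (by omega) e2 e3 e4 (by simp at hlB ⊢; omega)
      simpa [cmTrace] using this
  | @large y l hc hx h' ih =>
    intro σ l₀ hE hy h20 h8 hl hlB
    obtain ⟨g1, g2, -, -, g5, g6⟩ := hE.lt_of_cls H hy (by rw [← hcls]; omega)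
    obtain ⟨m1, m2, m3⟩ := hE.large y hy hc
    have htop : cfgTop n r par v₁ v₂ < n := by unfold cfgTop; split_ifs <;> assumption
    have hdy := H.dep_lt hy
    have hxn := hx2 hx
    have hzn := hz hx
    set t := cfgTop n r par v₁ v₂ with ht
    set c₁ := dep y - dep t + 1 with hc₁
    set c₂ := dep (xs - 1) - dep t with hc₂
    set l₁ := l₀ ++ climbList par y c₁ with hl₁
    set l₂ := l₁ ++ (climbList par (xs - 1) c₂).reverse with hl₂
    have hlen₁ : l₁.length = l₀.length + c₁ := by simp [hl₁]
    have hlen₂ : l₂.length = l₁.length + c₂ := by simp [hl₂]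
    simp only [List.length_append, climbList_length, List.length_reverse] at hlB
    refine HRun.le (HRun.while_step (b₁ := (1 + (5 * c₁ + 1 + (2 + (5 * c₂ + 3 + 1))) + 1) + 8)
      (b₂ := 50 * l.length) (hfit σ)
      (by simp [h8, hc]) (HRun.seq (R := fun τ => QueryEnv n r par dep pw v₁ v₂ sp sv xs z lam τ ∧
        τ.ivar 20 = z ∧ Buffer l₂ τ)
        (HRun.ite ⟨trivial, by simp only [Ex.fits]; omega⟩ (fun h => ?_) fun h => ?_)
        fun τ hτ => hclass τ z l₂ hτ.1 (by omega) hτ.2.1 hτ.2.2)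
      fun τ hτ => ?_) (by
        simp only [List.length_append, climbList_length, List.length_reverse]; omega)
    · simp [h8, hc] at h
    · refine HRun.seq (R := fun τ => τ.ivar 21 = c₁ ∧ Frame [(0, 21)] σ τ)
        (HRun.frame (HRun.of_wp (c := 21 ≔ _) ?_)) fun τ₁ h₁ => ?_
      · simp [h20, g5, hE.depth y hy, hE.depth t htop]; omega
      have E₁ := hE.frame h₁.2 (by decide)
      refine HRun.seq (HRun.frame (cmPush_run H E₁.toTreeTables (by omega) hy
        ((h₁.2.i 20 (by decide)).trans h20) h₁.1 (hl.frame h₁.2 (by decide)) (by omega)))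
        fun τ₂ h₂ => ?_
      have E₂ := E₁.frame h₂.2 (by decide)
      refine HRun.seq (R := fun τ => (τ.ivar 20 = xs - 1 ∧ τ.ivar 21 = c₂) ∧
        Frame [(0, 20), (0, 21)] τ₂ τ) (HRun.frame (HRun.of_wp (c := 20 ≔ _ ;; 21 ≔ _) ?_))
        fun τ₃ h₃ => ?_
      · have e13 := (E₂.lt_of_cls H hy (by rw [← hcls]; omega)).2.2.2.2.1
        rw [← ht] at e13
        simp [E₂.i4, (E₂.large y hy hc).1, e13, E₂.depth _ hxn, E₂.depth t htop]
        omega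
      have E₃ := E₂.frame h₃.2 (by decide)
      refine HRun.seq (HRun.frame (cmPushRev_run (l := l₁) H E₃.toTreeTables (by omega) hxn
        h₃.1.1 h₃.1.2 (h₂.1.frame h₃.2 (by decide)) (by omega)))
        fun τ₄ h₄ => ?_
      have E₄ := E₃.frame h₄.2 (by decide)
      refine HRun.imp (HRun.frame (HRun.of_wp (c := 20 ≔ _) (Q := fun τ => τ.ivar 20 = z) ?_))
        fun τ h => ⟨E₄.frame h.2 (by decide), h.1, h₄.1.frame h.2 (by decide)⟩
      simp [E₄.i4, (E₄.large y hy hc).2.1]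
    · obtain ⟨e1, e2, e3, e4⟩ := hτ
      have := ih τ l₂ e1 hzn e2 e3 e4 (by omega)
      simpa [hl₂, hl₁, List.append_assoc, cmTrace] using this

theorem cmOutput_run (hB : n + 2 < B) {l : List ℕ} (hl : Buffer l σ)
    (hlB : l.length + 1 < B) :
    HRun B cmOutput σ (3 * l.length + 4) fun τ => τ.ivar 0 = 1 ∧ τ.ivar 1 = l.length - 1 ∧
      ∀ i (h : i < l.length), τ.ints 11 (l.length - 1 - i) = l[i] := by
  refine HRun.le (HRun.seq (HRun.for' (N := l.length) (fun i τ => ∀ j < i,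
    τ.ints 11 j = σ.ints 12 (l.length - 1 - j)) 1 ?_ hlB (by simp) (by decide) ?_
    (fun τ h hF => (⟨h, hF.mono (by decide)⟩ : _ ∧ Frame [(0, 22), (2, 11)] σ τ))) fun τ h =>
      (HRun.of_wp ?_).le (show _ ≤ 2 by decide)) (by omega)
  · intro i _ τ _ hF
    exact ⟨trivial, (hF.i 19 (by decide)).trans hl.1⟩
  · intro i hi τ hI hx hF
    have e19 := (hF.i 19 (by decide)).trans hl.1
    have e12 := hF.ai 12 (by decide)
    refine HRun.of_wp ?_
    simp [hx, e19, e12]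
    refine ⟨by omega, ?_⟩
    grind [Function.update_apply]
  · have e19 := (h.2.i 19 (by decide)).trans hl.1
    simp [e19]
    refine ⟨by omega, fun i hi => ?_⟩
    rw [h.1 _ (by omega), ← hl.2 i hi]
    congr 1
    omega

end

section
variable {B n m r : ℕ} {par dep : ℕ → ℕ} {pw : ℕ → ℝ} {v₁ v₂ f : ℕ} {sp : ℕ → ℕ} {sv : ℕ → ℝ}
  {xs z : ℕ} {lam : ℝ} {σ τ : MState}

theorem cmPath_run_of_not_settled (H : RTree n r par dep) (hB : BigWord B n m)
    (hT : TreeTables n r par dep pw σ) (hV : ValidPair n r par v₁ v₂)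
    (hQ : QueryMem n r par dep v₁ v₂ (numOf n v₁ v₂) sp sv xs z lam σ)
    (hI : PairInput n par v₁ v₂ (σ.ivar 1) (σ.ivar 2) (σ.ivar 3) (σ.ivar 4) (σ.ivar 5)) {t : ℕ}
    (ht : t < n) (hσ : σ.ivar 0 = t) (hxs : xs ≤ n)
    (hS : ¬ Settled (cfgCls n r par v₁ v₂) sp xs t) :
    HRun B cmPath σ 62 fun τ => τ.ivar 0 = 0 := by
  have hB' := hB
  unfold BigWord at hB'
  refine HRun.seq (cmDist_run H hB hT hV hQ hI ht hσ hxs) (b₂ := 2) fun τ hτ => ?_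
  have h0 : τ.ivar 0 = 0 := by
    rcases hτ.2.2.2 with h | h
    · exact absurd h.1 hS
    · exact h.2
  refine HRun.ite (b := 1) ⟨trivial, by simp only [Ex.fits]; omega⟩ (fun h => ?_) fun _ => ?_
  · simp [h0] at h
  · exact ⟨1, τ, .skip _, le_rfl, h0⟩

theorem cmPath_run (H : RTree n r par dep) (hB : BigWord B n m)
    (hT : TreeTables n r par dep pw σ) (hV : ValidPair n r par v₁ v₂)
    (hQ : QueryMem n r par dep v₁ v₂ (numOf n v₁ v₂) sp sv xs z lam σ)
    (hI : PairInput n par v₁ v₂ (σ.ivar 1) (σ.ivar 2) (σ.ivar 3) (σ.ivar 4) (σ.ivar 5)) {t : ℕ}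
    (ht : t < n) (hσ : σ.ivar 0 = t) (hsp : ∀ y < n, cfgCls n r par v₁ v₂ y = 1 → sp y ≤ n)
    (hxs : xs ≤ n) (hz : xs ≠ 0 → z < n) (hS : Settled (cfgCls n r par v₁ v₂) sp xs t) {l : List ℕ}
    (h : Trace par dep (cfgCls n r par v₁ v₂) (cfgTop n r par v₁ v₂) sp xs z t l) :
    HRun B cmPath σ (60 * l.length + 100) fun τ => τ.ivar 0 = 1 ∧ τ.ivar 1 = l.length - 1 ∧
      ∀ i (h : i < l.length), τ.ints 11 (l.length - 1 - i) = l[i] := by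
  have hB' := hB
  unfold BigWord at hB'
  have hlen := h.length_le H hsp hxs hz ht
  have hlen' : n * (2 * n) = 2 * (n * n) := by ring
  refine HRun.le (HRun.seq (cmDist_run H hB hT hV hQ hI ht hσ hxs)
    (b₂ := 2 + (50 * l.length + (1 + (5 * l.length + 1 + (3 * l.length + 4)))) + 1)
    fun τ hτ => ?_) (by omega)
  obtain ⟨hE, h6, h8, hd⟩ := hτ
  have h0 : τ.ivar 0 = 1 := by
    rcases hd with h | h
    · exact h.2.1
    · exact absurd hS h.1
  refine HRun.ite ⟨trivial, by simp only [Ex.fits]; omega⟩ (fun _ => ?_) fun h => ?_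
  · refine HRun.seq (R := fun τ₁ => (τ₁.ivar 19 = 0 ∧ τ₁.ivar 20 = t) ∧
      Frame [(0, 19), (0, 20)] τ τ₁) (HRun.frame (HRun.of_wp (c := 19 ≔ _ ;; 20 ≔ _) ?_))
      fun τ₁ h₁ => ?_
    · simp [h6]; omega
    refine HRun.seq (cmTrace_run H hB hsp hxs hz (fun _ => by omega) h τ₁ []
      (hE.frame h₁.2 (by decide)) ht h₁.1.2 ((h₁.2.i 8 (by decide)).trans h8)
      ⟨h₁.1.1, by simp⟩ (by simp; omega)) fun τ₂ h₂ => ?_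
    obtain ⟨y₀, l₁, hy₀, h20, hl₁, hl, hE₂⟩ := h₂
    have hll := congrArg List.length hl
    simp only [List.length_append, climbList_length, List.length_nil] at hll
    have hdep := hE₂.depth _ hy₀
    have hdy := H.dep_lt hy₀
    refine HRun.seq (R := fun τ₃ => τ₃.ivar 21 = dep y₀ + 1 ∧ Frame [(0, 21)] τ₂ τ₃)
      (HRun.frame (HRun.of_wp (c := 21 ≔ _) ?_)) fun τ₃ h₃ => ?_
    · simp [h20, hdep]; omega
    refine HRun.seq ((cmPush_run H (hE₂.frame h₃.2 (by decide)).toTreeTables (by omega) hy₀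
      ((h₃.2.i 20 (by decide)).trans h20) h₃.1 (hl₁.frame h₃.2 (by decide)) (by omega)).le
      (show _ ≤ 5 * l.length + 1 by omega)) fun τ₄ h₄ => ?_
    rw [hl, List.nil_append] at h₄
    exact cmOutput_run (n := n) (by omega) h₄ (by omega)
  · simp [h0] at h

end

/-! ## The values and the memory of the oracle -/

section
variable {n : ℕ} {G : SimpleGraph (Fin n)} {w : Sym2 (Fin n) → ℝ≥0} {r t : Fin n}
  {par dep : ℕ → ℕ} {d : ℕ → ℝ} {E : ℕ → ℕ → ℝ → Prop} {cls : ℕ → ℕ} {τ : ℕ} {sp : ℕ → ℕ}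
  {sv : ℕ → ℝ} {xs z : ℕ} {lam : ℝ}

theorem SimpleGraph.Walk.weight_reverse {V : Type*} {G : SimpleGraph V} (w : Sym2 V → ℝ≥0) {u v : V}
    (p : G.Walk u v) : p.reverse.weight w = p.weight w := by
  simp [Walk.weight, Walk.edges_reverse, List.map_reverse, List.sum_reverse]

/-- The traces of settled vertices are approximately shortest paths. -/
theorem Cfg.exists_walk (C : Cfg n r par dep d E cls τ)
    (hE : ∀ (a b : Fin n) (c : ℝ), E a b c ↔ G.Adj a b ∧ c = w s(a, b))
    (I : CfgInv n r par dep d E cls τ sp sv xs z lam) (hs : Settled cls sp xs t) :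
    ∃ (l : List ℕ) (p : G.Walk r t), Trace par dep cls τ sp xs z t l ∧
      p.support.map Fin.val = l.reverse ∧ (p.weight w : ℝ) = settledVal d cls τ sv xs lam t ∧
      wdist G w r t ≤ p.weight w ∧ (p.weight w : ℝ≥0∞) ≤ 3 * wdist G w r t := by
  obtain ⟨l, hl, hw⟩ := I.walk t t.2 hs
  obtain ⟨q, h1, h2⟩ := walk_of_revWalk (G' := G) (w := w) C.lt (fun a b c => (hE a b c).1) hw t.2
  refine ⟨l, q.reverse, hl, ?_, by rw [q.weight_reverse]; exact h2,
    iInf_le (fun p : G.Walk r t => (p.weight w : ℝ≥0∞)) q.reverse, ?_⟩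
  · rw [SimpleGraph.Walk.support_reverse, List.map_reverse, h1]
  -- The factor is moved into the infimum, so that it suffices to compare with each single walk.
  · rw [wdist, ENNReal.mul_iInf_of_ne (by norm_num) (by norm_num)]
    refine le_iInf fun p => ?_
    have h3 := I.approx t t.2 hs _ _
      (revWalk_of_walk (G' := G) (w := w) (fun a b h => (hE a b _).2 ⟨h, rfl⟩) p.reverse)
    rw [p.weight_reverse, ← h2] at h3
    rw [q.weight_reverse]
    have h4 : (q.weight w : ℝ) ≤ 3 * p.weight w := by
      refine h3.trans (mul_le_mul_of_nonneg_right ?_ (NNReal.coe_nonneg _))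
      split_ifs <;> norm_num
    have h5 : q.weight w ≤ 3 * p.weight w := by exact_mod_cast h4
    exact_mod_cast h5

/-- The settled set contains the root and no surviving arc leaves it, so a walk from the root cannot
reach `t`. -/
theorem Cfg.wdist_eq_top (C : Cfg n r par dep d E cls τ)
    (hE : ∀ (a b : Fin n) (c : ℝ), E a b c ↔ G.Adj a b ∧ c = w s(a, b))
    (hc : Closed E cls sp xs) (hs : ¬ Settled cls sp xs t) : wdist G w r t = ⊤ := by
  rw [wdist, iInf_eq_top]
  refine fun p => absurd ?_ hs
  exact Cfg.unreachable (P := Settled cls sp xs) (.inl C.cls_r) hc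
    (revWalk_of_walk (G' := G) (w := w) (fun a b h => (hE a b _).2 ⟨h, rfl⟩) p.reverse)

end

section
variable {n m r s : ℕ} {par dep : ℕ → ℕ} {pw : ℕ → ℝ} {aS aD : ℕ → ℕ} {aW : ℕ → ℝ}
  {v₁ v₂ : ℕ} {sp : ℕ → ℕ} {sv : ℕ → ℝ} {xs z : ℕ} {lam : ℝ} {σ τ : MState}

/-- The empty failure has no stored result: all vertices are in the part of the root, and arbitrary
data satisfy the conditions, which are then void. -/
theorem exists_queryMem (N : Net n (2 * m) r par dep pw aS aD aW) (hV : ValidPair n r par v₁ v₂)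
    (hσ : ∀ f < 2 * n, highOf n par f ≠ r → lowOf n f ≠ r →
      CfgStored n m r par dep pw aS aD aW (highOf n par f) (lowOf n f) f σ) :
    ∃ (sp : ℕ → ℕ) (sv : ℕ → ℝ) (xs z : ℕ) (lam : ℝ),
      CfgInv n r par dep (climbSum par dep pw) (LiveArc n (2 * m) r par aS aD aW v₁ v₂)
        (cfgCls n r par v₁ v₂) (cfgTop n r par v₁ v₂) sp sv xs z lam ∧
      Closed (LiveArc n (2 * m) r par aS aD aW v₁ v₂) (cfgCls n r par v₁ v₂) sp xs ∧
      QueryMem n r par dep v₁ v₂ (numOf n v₁ v₂) sp sv xs z lam σ := by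
  have C := N.cfg hV
  rcases hV with ⟨rfl, rfl⟩ | ⟨h1, h2, h3, h4, h5⟩
  · have h0 : ∀ y < n, cfgCls n r par (n + 1) (n + 1) y = 0 := by
      intro y hy
      rw [cfgCls_eq_zero]
      intro h
      have := N.tree.anc_lt h hy
      omega
    refine ⟨fun _ => 0, fun _ => 0, 0, 0, 0, C.init fun _ _ _ => rfl,
      fun a b c h _ => .inl (h0 b (C.lt a b c h).2), fun y hy h => ?_, fun y hy h => ?_⟩
    · rw [h0 y hy] at h; omega
    · rw [h0 y hy] at h; omega
  · have hn : v₁ ≠ n + 1 := by omega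
    have key : CfgStored n m r par dep pw aS aD aW v₁ v₂ (numOf n v₁ v₂) σ := by
      by_cases h6 : v₁ = v₂
      · subst h6
        have e1 : numOf n v₁ v₁ = v₁ := by simp [numOf, hn]
        have e2 : highOf n par v₁ = v₁ := by simp [highOf, h1]
        have e3 : lowOf n v₁ = v₁ := by simp [lowOf, h1]
        have := hσ v₁ (by omega) (by rwa [e2]) (by rwa [e3])
        rw [e2, e3] at this
        rwa [e1]
      · have h7 := h5.resolve_left h6
        have e1 : numOf n v₁ v₂ = n + v₂ := by simp [numOf, hn, h6]
        have e2 : highOf n par (n + v₂) = v₁ := by simp [highOf, h7]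
        have e3 : lowOf n (n + v₂) = v₂ := by simp [lowOf]
        have := hσ (n + v₂) (by omega) (by rwa [e2]) (by rwa [e3])
        rw [e2, e3] at this
        rwa [e1]
    obtain ⟨sp, sv, hI, hC, hm⟩ := key
    exact ⟨sp, sv, _, _, _, hI, hC, hm, fun _ _ _ => ⟨rfl, rfl, rfl⟩⟩

theorem TreeTables.same (h : TreeTables n r par dep pw σ) (hS : SameOracle 11 s σ τ) (hn : 0 < n)
    (hs : n ≤ s) : TreeTables n r par dep pw τ where
  parent v hv := (hS 2 (by decide) v (by omega)).1 ▸ h.parent v hv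
  pre v hv := (hS 3 (by decide) v (by omega)).1 ▸ h.pre v hv
  size v hv := (hS 4 (by decide) v (by omega)).1 ▸ h.size v hv
  depth v hv := (hS 5 (by decide) v (by omega)).1 ▸ h.depth v hv
  row v hv := (hS 6 (by decide) v (by omega)).1 ▸ h.row v hv
  count := (hS 10 (by decide) 0 (by omega)).1 ▸ h.count
  dist v hv := (hS 1 (by decide) v (by omega)).2 ▸ h.dist v hv

/-- Queries see just the first `s` cells of each array. Table cells have row key below `2 * Nat.log
2 n + 2`, and failure numbers are below `2 * n`, so nothing else is read. -/
theorem QueryMem.same (h : QueryMem n r par dep v₁ v₂ (numOf n v₁ v₂) sp sv xs z lam σ)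
    (H : RTree n r par dep) (hV : ValidPair n r par v₁ v₂)
    (hS : SameOracle 11 s σ τ) (hs : (2 * Nat.log 2 n + 2) * n ≤ s) :
    QueryMem n r par dep v₁ v₂ (numOf n v₁ v₂) sp sv xs z lam τ := by
  have hlt : ∀ y < n, cfgCls n r par v₁ v₂ y ≠ 0 → v₁ < n ∧ v₂ < n := by
    intro y hy hc
    rw [Ne, cfgCls_eq_zero, not_not] at hc
    have := H.anc_lt hc hy
    rcases hV with h | h
    · omega
    · exact ⟨h.1, h.2.1⟩
  constructor
  · intro y hy hc
    have h1 := H.rowKey_lt (hlt y hy (by omega)).2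
    have h2 : (rowKey n r par dep v₂ + 1) * n ≤ (2 * Nat.log 2 n + 2) * n :=
      Nat.mul_le_mul_right _ h1
    have h3 : rowKey n r par dep v₂ * n + y < s := by rw [add_mul] at h2; omega
    rw [← (hS 7 (by decide) _ h3).1, ← (hS 2 (by decide) _ h3).2]
    exact h.small y hy hc
  · intro y hy hc
    have h1 := hlt y hy (by omega)
    have h2 : 2 * n ≤ (2 * Nat.log 2 n + 2) * n := Nat.mul_le_mul_right _ (by omega)
    have h3 : numOf n v₁ v₂ < s := by unfold numOf; split_ifs <;> omega
    rw [← (hS 8 (by decide) _ h3).1, ← (hS 9 (by decide) _ h3).1, ← (hS 3 (by decide) _ h3).2]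
    exact h.large y hy hc

theorem Frame.sameOracle {W : List (ℕ × ℕ)} (h : Frame W σ τ)
    (hW : ∀ a < 11, (2, a) ∉ W ∧ (3, a) ∉ W) : SameOracle 11 s σ τ := fun a ha i _ => by
  rw [h.ai a (hW a ha).1, h.ar a (hW a ha).2]
  exact ⟨rfl, rfl⟩

theorem SameOracle.trans {K : ℕ} {σ₁ σ₂ σ₃ : MState} (h : SameOracle K s σ₁ σ₂)
    (h' : SameOracle K s σ₂ σ₃) : SameOracle K s σ₁ σ₃ := fun a ha i hi =>
  ⟨(h a ha i hi).1.trans (h' a ha i hi).1, (h a ha i hi).2.trans (h' a ha i hi).2⟩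

end

/-! ## The machine programs -/

/-- The code of a command, with auxiliary variables from number `100` on. -/
def Cm.code (c : Cm) : Prog := c.comp 100

theorem HRun.runsWithin {B M b : ℕ} {c : Cm} {σ : MState} {Q R : MState → Prop} {β : ℝ}
    (h : HRun B c σ b Q) (hB : 1 < B) (hc : c.varsLt 100 = true) (hM : c.size ≤ M)
    (hβ : ((M * b : ℕ) : ℝ) ≤ β) (hR : ∀ τ τ', Q τ → MState.Sim 100 τ τ' → R τ') :
    c.code.RunsWithin B σ β R := by
  obtain ⟨k, σ', h, hk, hQ⟩ := h
  obtain ⟨k', τ', h', hk', hS⟩ := h.comp hB hc hM σ (.refl _ _)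
  refine ⟨k', τ', h', le_trans ?_ hβ, hR _ _ hQ hS⟩
  exact_mod_cast hk'.trans (Nat.mul_le_mul_left _ hk)

theorem MState.Sim.sameOracle {T K s : ℕ} {σ τ : MState} (h : MState.Sim T σ τ) :
    SameOracle K s σ τ := fun a _ i _ => by rw [h.ints, h.reals]; exact ⟨rfl, rfl⟩

/-! ### Bounds -/

/-- The quadratic cost is absorbed by `n ^ 2 * log n`, except for `n = 1`, where the logarithm
vanishes and the summand `1` is needed. -/
theorem natCast_sq_le (n : ℕ) : (n : ℝ) ^ 2 ≤ 2 * ((n : ℝ) ^ 2 * Real.log n) + 1 := by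
  rcases Nat.lt_or_ge n 2 with h | h
  · interval_cases n <;> norm_num
  · have h1 : Real.log 2 ≤ Real.log n := Real.log_le_log (by norm_num) (by exact_mod_cast h)
    have h2 := Real.log_two_gt_d9
    nlinarith [sq_nonneg (n : ℝ)]

theorem log_mul_le (n : ℕ) : (((2 * Nat.log 2 n + 2) * n : ℕ) : ℝ) ≤ 7 * (n * Real.log n) + 2 := by
  rcases Nat.lt_or_ge n 2 with h | h
  · interval_cases n <;> norm_num
  · have h1 : Real.log 2 ≤ Real.log n := Real.log_le_log (by norm_num) (by exact_mod_cast h)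
    have h2 := Real.log_two_gt_d9
    have h3 : (Nat.log 2 n : ℝ) ≤ Real.logb 2 n := Real.natLog_le_logb n 2
    have h4 : Real.logb 2 n * Real.log 2 = Real.log n := 
      div_mul_cancel₀ _ (by positivity)
    -- For `n ≥ 2` both summands are at most `2 / log 2` times `log n`, and `4 / log 2 < 7`.
    have h5 : (2 * Nat.log 2 n + 2 : ℝ) ≤ 7 * Real.log n := by
      have : (0 : ℝ) ≤ Nat.log 2 n := Nat.cast_nonneg _
      nlinarith
    have h6 : (0 : ℝ) ≤ n := Nat.cast_nonneg _
    push_cast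
    nlinarith

/-- The exponent `7` leaves a factor `(n + 2) ^ 5 ≥ 243` before the square, which dominates all
coefficients, given that there are at most `n * n` edges. -/
theorem bigWord_pow {n m : ℕ} (hn : 1 ≤ n) (hm : m ≤ n * n) : BigWord ((n + 2) ^ 7) n m := by
  unfold BigWord
  have h1 : 3 ^ 5 ≤ (n + 2) ^ 5 := Nat.pow_le_pow_left (by omega) 5
  have h2 : (n + 2) ^ 7 = (n + 2) ^ 5 * (n + 2) ^ 2 := by ring
  have h3 := Nat.mul_le_mul_right ((n + 2) ^ 2) h1
  rw [h2]
  nlinarith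

theorem ListsEdges.length_eq {V : Type*} {L : List (V × V)} {E : Set (Sym2 V)}
    (h : ListsEdges L E) : E.ncard = L.length := by
  classical
  have h1 : E = ((L.map fun a => s(a.1, a.2)).toFinset : Set (Sym2 V)) := by
    ext e; simp [← h.2]
  rw [h1, Set.ncard_coe_finset, List.toFinset_card_of_nodup h.1, List.length_map]

theorem ListsEdges.length_le {n : ℕ} {L : List (Fin n × Fin n)} {E : Set (Sym2 (Fin n))}
    (h : ListsEdges L E) : L.length ≤ n * n := by
  have := (List.Nodup.of_map _ h.1).length_le_card
  simpa using this

/-- A bound for the size of every single step of the three programs. -/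
def progSize : ℕ := max cmBuild.size (max cmDist.size cmPath.size)

theorem cmDist_size_le : cmDist.size ≤ progSize := (le_max_left _ _).trans (le_max_right _ _)

theorem cmPath_size_le : cmPath.size ≤ progSize := (le_max_right _ _).trans (le_max_right _ _)

theorem one_le_progSize : 1 ≤ progSize := by decide

theorem build_cost_le (n m : ℕ) (hn : 1 ≤ n) :
    ((progSize * (140 * (n * n) + 410 * n + 28 * m + 400 * (n * m) + 60) : ℕ) : ℝ) ≤
      (progSize * 2000 : ℕ) * ((n : ℝ) * m + (n : ℝ) ^ 2 * Real.log n + 1) := by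
  have h1 := natCast_sq_le n
  have h2 : 140 * (n * n) + 410 * n + 28 * m + 400 * (n * m) + 60 ≤
      550 * (n * n) + 428 * (n * m) + 60 := by nlinarith [Nat.mul_le_mul_right m hn]
  have h3 : ((140 * (n * n) + 410 * n + 28 * m + 400 * (n * m) + 60 : ℕ) : ℝ) ≤
      550 * (n * n) + 428 * (n * m) + 60 := by exact_mod_cast h2
  have h4 : (0 : ℝ) ≤ n * m := by positivity
  have h5 : (0 : ℝ) ≤ (n : ℝ) ^ 2 * Real.log n :=
    mul_nonneg (sq_nonneg _) (Real.log_natCast_nonneg n)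
  rw [Nat.cast_mul, Nat.cast_mul, mul_assoc]
  refine mul_le_mul_of_nonneg_left (h3.trans ?_) (Nat.cast_nonneg _)
  push_cast
  nlinarith

theorem size_le (n : ℕ) : ((2 * 11 * ((2 * Nat.log 2 n + 2) * n) : ℕ) : ℝ) ≤
    (progSize * 2000 : ℕ) * ((n : ℝ) * Real.log n + 1) := by
  have h1 := log_mul_le n
  have h2 : (0 : ℝ) ≤ n * Real.log n :=
    mul_nonneg (Nat.cast_nonneg _) (Real.log_natCast_nonneg n)
  have h3 : (2000 : ℝ) ≤ (progSize * 2000 : ℕ) := by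
    have := one_le_progSize
    exact_mod_cast (by omega : 2000 ≤ progSize * 2000)
  rw [Nat.cast_mul]
  push_cast at h1 h3 ⊢
  nlinarith

theorem mainTheorem6 :
    ∃ (build distQuery pathQuery : Prog) (κ K : ℕ) (C : ℝ),
      ∀ (n : ℕ) (G : SimpleGraph (Fin n)) (w : Sym2 (Fin n) → ℝ≥0) (r : Fin n)
        (T : SimpleGraph (Fin n)) (par : Fin n → Fin n) (L : List (Fin n × Fin n)),
        IsShortestPathTree G w r T → IsParentMap T r par → ListsEdges L G.edgeSet →
        ∀ σ₀ : MState, BuildInput w r par L σ₀ →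
          -- the construction halts in time `O(nm + n² log n)`
          build.RunsWithin ((n + 2) ^ κ) σ₀
            (C * ((n : ℝ) * (G.edgeSet.ncard : ℝ) + (n : ℝ) ^ 2 * Real.log n + 1))
            fun σ₁ =>
              ∃ s : ℕ,
                -- the oracle occupies `O(n log n)` cells
                ((2 * K * s : ℕ) : ℝ) ≤ C * ((n : ℝ) * Real.log n + 1) ∧
                ∀ F : Set (Sym2 (Fin n)), IsPathFailure T r F → F.ncard ≤ 2 →
                ∀ t : Fin n, ∃ D : ℝ≥0∞,
                  wdist (G.deleteEdges F) w r t ≤ D ∧ D ≤ 3 * wdist (G.deleteEdges F) w r t ∧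
                  -- distance queries
                  (∀ (LF : List (Fin n × Fin n)) (σ : MState), ListsEdges LF F →
                    SameOracle K s σ₁ σ → QueryInput t LF σ →
                    distQuery.RunsWithin ((n + 2) ^ κ) σ C
                      fun σ' => OutputsDist D σ' ∧ SameOracle K s σ₁ σ') ∧
                  -- path queries, if there is no path
                  (D = ⊤ → ∀ (LF : List (Fin n × Fin n)) (σ : MState), ListsEdges LF F →
                    SameOracle K s σ₁ σ → QueryInput t LF σ →
                    pathQuery.RunsWithin ((n + 2) ^ κ) σ C
                      fun σ' => OutputsNoPath σ' ∧ SameOracle K s σ₁ σ') ∧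
                  -- path queries, if there is a path
                  (D ≠ ⊤ → ∃ p : (G.deleteEdges F).Walk r t, (p.weight w : ℝ≥0∞) = D ∧
                    ∀ (LF : List (Fin n × Fin n)) (σ : MState), ListsEdges LF F →
                      SameOracle K s σ₁ σ → QueryInput t LF σ →
                      pathQuery.RunsWithin ((n + 2) ^ κ) σ (C * ((p.length : ℝ) + 1))
                        fun σ' => OutputsPath K p σ' ∧ SameOracle K s σ₁ σ') := by
  -- Arrays `0` to `10` form the oracle. Queries write only to the arrays `11`, the output, and
  -- `12`, the buffer, so `K = 11` serves both as the number of oracle arrays and as the name of the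
  -- output array.
  refine ⟨cmBuild.code, cmDist.code, cmPath.code, 7, 11, (progSize * 2000 : ℕ), ?_⟩
  intro n G w r T par L hT hp hL σ₀ h₀
  have hpar := h₀.par_eq
  have hn : 1 ≤ n := by have := r.2; omega
  have N := hT.net hp hL hpar h₀.fst_eq h₀.snd_eq h₀.weight_eq
  have H := N.tree
  have hB := bigWord_pow hn hL.length_le
  have hB1 : 1 < (n + 2) ^ 7 := Nat.one_lt_pow (by decide) (by omega)
  rw [hL.length_eq]
  refine (cmBuild_run hB N h₀.n_eq h₀.m_eq h₀.r_eq rfl rfl rfl rfl).runsWithin hB1 (by decide)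
    (le_max_left _ _) (build_cost_le n _ hn) fun ρ σ₁ hρ hS₁ =>
      ⟨(2 * Nat.log 2 n + 2) * n, size_le n, fun F hF hF2 t => ?_⟩
  obtain ⟨hTT, hst⟩ := hρ
  -- The vertices `v₁`, `v₂` and the stored data are fixed here, before any query list is given;
  -- hence `D` and the path do not depend on how the failure is listed.
  obtain ⟨v₁, v₂, hV, hFA, hPI⟩ := hF.exists_pair hT.isTree hp hpar hF2
  obtain ⟨sp, sv, xs, z, lam, hI, hC, hQ⟩ := exists_queryMem N hV hst
  have C := N.cfg hV
  have hE := liveArc_iff H hL hpar h₀.fst_eq h₀.snd_eq h₀.weight_eq hV hFA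
  set cls := cfgCls n r (σ₀.ints 2) v₁ v₂ with hcls
  set top := cfgTop n r (σ₀.ints 2) v₁ v₂ with htop
  have hns : n ≤ (2 * Nat.log 2 n + 2) * n := Nat.le_mul_of_pos_left _ (by omega)
  have mem : ∀ σ : MState, SameOracle 11 ((2 * Nat.log 2 n + 2) * n) σ₁ σ →
      TreeTables n r (σ₀.ints 2) (depN T r) (pwN w par) σ ∧
      QueryMem n r (σ₀.ints 2) (depN T r) v₁ v₂ (numOf n v₁ v₂) sp sv xs z lam σ := fun σ hσ =>
    ⟨hTT.same (hS₁.sameOracle.trans hσ) hn hns,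
      hQ.same H hV (hS₁.sameOracle.trans hσ) le_rfl⟩
  have out : ∀ {σ τ τ' : MState} {W : List (ℕ × ℕ)},
      SameOracle 11 ((2 * Nat.log 2 n + 2) * n) σ₁ σ → Frame W σ τ →
      (∀ a < 11, (2, a) ∉ W ∧ (3, a) ∉ W) → MState.Sim 100 τ τ' →
      SameOracle 11 ((2 * Nat.log 2 n + 2) * n) σ₁ τ' := fun h hF hW h' =>
    (h.trans (hF.sameOracle hW)).trans h'.sameOracle
  have cost : ∀ b ≤ 2000, ((progSize * b : ℕ) : ℝ) ≤ (progSize * 2000 : ℕ) := fun b hb => by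
    exact_mod_cast Nat.mul_le_mul_left _ hb
  -- If `t` is settled, `D` is the weight of the traced walk; otherwise `t` is unreachable and `D =
  -- ⊤`.
  by_cases hs : Settled cls sp xs t
  · obtain ⟨l, q, hl, hq, hw, hD, hD'⟩ := C.exists_walk hE hI hs
    have hlen : l.length = q.length + 1 := by
      rw [← l.length_reverse, ← hq, List.length_map, SimpleGraph.Walk.length_support]
    refine ⟨_, hD, hD', fun LF σ hLF hσ hIn => ?_, fun h => absurd h ENNReal.coe_ne_top,
      fun _ => ⟨q, rfl, fun LF σ hLF hσ hIn => ?_⟩⟩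
    · refine (cmDist_run H hB (mem σ hσ).1 hV (mem σ hσ).2 (hPI LF σ t hLF hIn) t.2 hIn.t_eq
        hI.xs_lt).frame.runsWithin hB1 (by decide) cmDist_size_le (cost _ (by decide))
        fun τ τ' hτ hS => ⟨.inr ⟨ENNReal.coe_ne_top, ?_⟩, out hσ hτ.2 (by decide) hS⟩
      obtain ⟨-, h0, hv⟩ := hτ.1.2.2.2.resolve_right fun h => h.1 hs
      rw [hS.ivar 0 (by decide), hS.rvar 0 (by decide)]
      exact ⟨h0, hv.trans hw.symm⟩
    · refine (cmPath_run H hB (mem σ hσ).1 hV (mem σ hσ).2 (hPI LF σ t hLF hIn) t.2 hIn.t_eq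
        hI.sp_lt hI.xs_lt hI.z_lt hs hl).frame.runsWithin hB1 (by decide) cmPath_size_le ?_
        fun τ τ' hτ hS => ⟨?_, out hσ hτ.2 (by decide) hS⟩
      · rw [hlen]
        exact_mod_cast (by rw [mul_assoc]; exact Nat.mul_le_mul_left _ (by omega) :
          progSize * (60 * (q.length + 1) + 100) ≤ progSize * 2000 * (q.length + 1))
      · obtain ⟨⟨h0, h1, h2⟩, -⟩ := hτ
        refine ⟨(hS.ivar 0 (by decide)).trans h0, (hS.ivar 1 (by decide)).trans (by omega),
          fun i hi => ?_⟩
        -- The trace runs from `t` to the root and the output is its reversal, so position `i` of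
        -- the walk is position `q.length - i` of the trace.
        have h3 := h2 (q.length - i) (by omega)
        rw [show l.length - 1 - (q.length - i) = i by omega] at h3
        have h4 := List.getElem_of_eq hq (i := i) (by simp; omega)
        rw [List.getElem_map, SimpleGraph.Walk.support_getElem_eq_getVert,
          List.getElem_reverse] at h4
        rw [hS.ints, h3, h4]
        congr 1
        omega
  · have h := C.wdist_eq_top hE hC hs
    refine ⟨⊤, le_top, by simp [h], fun LF σ hLF hσ hIn => ?_, fun _ LF σ hLF hσ hIn => ?_,
      fun h => absurd rfl h⟩
    · refine (cmDist_run H hB (mem σ hσ).1 hV (mem σ hσ).2 (hPI LF σ t hLF hIn) t.2 hIn.t_eq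
        hI.xs_lt).frame.runsWithin hB1 (by decide) cmDist_size_le (cost _ (by decide))
        fun τ τ' hτ hS => ⟨.inl ⟨rfl, ?_⟩, out hσ hτ.2 (by decide) hS⟩
      exact (hS.ivar 0 (by decide)).trans (hτ.1.2.2.2.resolve_left fun h => hs h.1).2
    · refine (cmPath_run_of_not_settled H hB (mem σ hσ).1 hV (mem σ hσ).2 (hPI LF σ t hLF hIn) t.2
        hIn.t_eq hI.xs_lt hs).frame.runsWithin hB1 (by decide) cmPath_size_le (cost _ (by decide))
        fun τ τ' hτ hS => ⟨(hS.ivar 0 (by decide)).trans hτ.1, out hσ hτ.2 (by decide) hS⟩
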